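/- **Theorem.** Let $H$ be a countable non-amenable group, let $F=F(a,b)$ be the free group of rank two, and put $G=H\times F\times\mathbb Z\times\mathbb Z$ and $K=H\times F\times\mathbb Z$. Let $\zeta_1,\zeta_2\colon G\to\mathbb Z$ be the two projections to $\mathbb Z$, let $\pi_i\colon G\to K$, $\pi_i(h,u,n_1,n_2)=(h,u,n_i)$, and let $\tau\colon G\to G$, $\tau(h,u,n_1,n_2)=(1,1,\bar u)$, where $u\mapsto\bar u\in\mathbb Z^2$ is the abelianization of $F$ with $\bar a=(1,0)$, $\bar b=(0,1)$. On the alphabet $X=Y\sqcup Z$, $Y=\{y_n^i: n\in\mathbb Z,\ i=1,2\}$, $Z=\{z_k^i:k\in K,\ i=1,2\}$, let $G$ act faithfully and self-similarly by $$g(y_n^i)=y^i_{\zeta_i(g)+n},\quad g|_{y_n^i}=\tau(g),\qquad g(z_k^i)=z^i_{\pi_i(g)k},\quad g|_{z_k^i}=1.$$ Let $S=\{\alpha g\beta^*:\alpha,\beta\in X^*,\ g\in G\}\cup\{0\}$ be the associated inverse monoid, acting on finite and right-infinite words $X^*\cup X^\omega$ by $\alpha g\beta^*\colon \beta w\mapsto\alpha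 g(w)$ from $D(\beta)=\beta X^*\cup\beta X^\omega$ to $D(\alpha)$. Let $\mathcal G$ be its groupoid of germs $[s,w]$ (where $[s,w]=[t,w]$ iff $s\gamma=t\gamma$ for some finite prefix $\gamma$ of $w$), with the topology having as basis the sets $(\alpha g\beta^*,U)=\{[\alpha g\beta^*,w]:w\in U\}$, where $U\subseteq D(\beta)$ is of the form $D(\delta)\setminus\bigcup_{j\le m}D(\delta\beta_j)$; units $[1,w]$ are identified with words $w$. For an ample groupoid $\Gamma$ (étale, with locally compact Hausdorff unit space and a basis of compact open bisections) let $A(\Gamma)$ be the span of the characteristic functions of compact open bisections (the Steinberg algebra), let $\mathcal C(\Gamma)$ be the span of the functions that are continuous and compactly supported on an open bisection and extended by $0$, and let $C^*_r(\Gamma)$ be the completion of $\mathcal C(\Gamma)$ in the norm $\|f\|=\sup_w\|\lambda_w(f)\|$, with $\lambda_w$ the left regular representation on $\ell^2(\Gamma w)$, where $\Gamma w$ is the set of arrows with source $w$. Elements of $C^*_r(\Gamma)$ are viewed as functions on $\Gamma$. The $C^*$-singular ideal $J\subseteq C^*_r(\Gamma)$ consists of the elements $f$ for which $\{\gamma: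 f(\gamma)\ne0\}$ has empty interior. 1. The groupoid $\mathcal G$ is ample, non-Hausdorff, minimal (all orbits are dense in the unit space) and effective (the interior of the isotropy is the unit space). Neither $J\cap\mathcal C(\mathcal G)$ nor $J\cap A(\mathcal G)$ is dense in $J$. More precisely, let $B=\bigcup_{y\in Y}D(y)\subseteq\mathcal G^{(0)}$ and $$\mathfrak a=\chi_{(1,D(\epsilon))}-\chi_{(a,D(\epsilon))}-\chi_{(b,D(\epsilon))}+\chi_{(ab,D(\epsilon))}\in A(\mathcal G),$$ where $\epsilon$ is the empty word. There are finite non-empty sets $H_n\subseteq H$ such that $\frac1{|H_n|}\sum_{h\in H_n}\chi_{(h,D(\epsilon))}\in A(\mathcal G)$ converges in the reduced norm to $\chi_B$; in particular $\chi_B\in C^*_r(\mathcal G)$. Moreover $\mathfrak a*\chi_B\in J$, but $\mathfrak a*\chi_B$ is not in the norm closure of $J\cap\mathcal C(\mathcal G)$; it is not even the limit in supremum norm of a sequence in $J\cap\mathcal C(\mathcal G)$. 2. In particular, there exist ample groupoids $\Gamma$, which can be taken minimal and effective, such that $J\cap\mathcal C(\Gamma)$ is not dense in $J$, and $J\cap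 A(\Gamma)$ is not dense in $J$. -/

import Mathlib

open Set Filter Topology TopologicalSpace
open scoped ENNReal Pointwise

universe u v

/-- A group is amenable if it carries a left-invariant finitely additive probability measure
defined on all subsets. -/
def IsAmenableGroup (G : Type u) [Group G] : Prop :=
  ∃ m : Set G → ℝ≥0∞, m univ = 1 ∧
    (∀ s t, Disjoint s t → m (s ∪ t) = m s + m t) ∧
    ∀ (g : G) (s : Set G), m (g • s) = m s

/-! ### Groupoids as sets of arrows -/

/-- A groupoid, viewed as its set of arrows; objects are identified with their identity arrows
(the units).  The product `mul a b h` is defined exactly when `src a = rng b`. -/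
class ArrowGroupoid (Γ : Type u) where
  src : Γ → Γ
  rng : Γ → Γ
  inv : Γ → Γ
  mul : ∀ a b : Γ, src a = rng b → Γ
  src_src : ∀ a, src (src a) = src a
  rng_src : ∀ a, rng (src a) = src a
  src_rng : ∀ a, src (rng a) = rng a
  rng_rng : ∀ a, rng (rng a) = rng a
  src_inv : ∀ a, src (inv a) = rng a
  rng_inv : ∀ a, rng (inv a) = src a
  src_mul : ∀ a b h, src (mul a b h) = src b
  rng_mul : ∀ a b h, rng (mul a b h) = rng a
  assoc : ∀ a b c (hab : src a = rng b) (hbc : src b = rng c)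
    (h₁ : src (mul a b hab) = rng c) (h₂ : src a = rng (mul b c hbc)),
    mul (mul a b hab) c h₁ = mul a (mul b c hbc) h₂
  mul_unit : ∀ a h, mul a (src a) h = a
  unit_mul : ∀ a h, mul (rng a) a h = a
  inv_mul_self : ∀ a h, mul (inv a) a h = src a
  mul_inv_self : ∀ a h, mul a (inv a) h = rng a

namespace ArrowGroupoid

section Algebraic

variable (Γ : Type u) [ArrowGroupoid Γ]

/-- The set of units (the object space). -/
def units : Set Γ := {x | src x = x}

/-- The isotropy: arrows with equal source and range. -/
def isotropy : Set Γ := {γ | src γ = rng γ}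

variable {Γ}

/-- The units in the orbit of `w`: the ranges of arrows starting at `w`. -/
def orbit (w : Γ) : Set Γ := {x | ∃ γ, src γ = w ∧ rng γ = x}

/-- The convolution product `(f ∗ g)(γ) = ∑_{αβ = γ} f(α) g(β)`. -/
noncomputable def conv (f g : Γ → ℂ) (γ : Γ) : ℂ :=
  ∑ᶠ p : {p : Γ × Γ // ∃ h : src p.1 = rng p.2, mul p.1 p.2 h = γ}, f p.1.1 * g p.1.2

end Algebraic

section Topological

variable (Γ : Type u) [ArrowGroupoid Γ] [TopologicalSpace Γ]

variable {Γ} in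
/-- Source and range restrict to homeomorphisms from `B` onto their images. -/
def IsBisection (B : Set Γ) : Prop :=
  IsEmbedding (fun γ : B => src (γ : Γ)) ∧ IsEmbedding (fun γ : B => rng (γ : Γ))

/-- A topological groupoid whose unit space is Hausdorff and locally compact (the groupoid
itself need not be Hausdorff) is étale if its open bisections form a basis of the topology and
the source map to the unit space is open (so that it is a local homeomorphism). -/
structure IsEtale : Prop where
  continuous_src : Continuous (src : Γ → Γ)
  continuous_rng : Continuous (rng : Γ → Γ)
  continuous_inv : Continuous (inv : Γ → Γ)
  continuous_mul :
    Continuous (fun p : {p : Γ × Γ // src p.1 = rng p.2} => mul p.1.1 p.1.2 p.2)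
  t2_units : T2Space (units Γ)
  locallyCompact_units : LocallyCompactSpace (units Γ)
  isOpenMap_src : IsOpenMap (fun γ : Γ => (⟨src γ, src_src γ⟩ : units Γ))
  basis : IsTopologicalBasis {U : Set Γ | IsOpen U ∧ IsBisection U}

/-- An étale groupoid is ample if its compact open bisections form a basis. -/
structure IsAmple : Prop extends IsEtale Γ where
  compact_basis : IsTopologicalBasis {U : Set Γ | IsOpen U ∧ IsCompact U ∧ IsBisection U}

/-- All orbits are dense in the unit space. -/
def IsMinimal : Prop := ∀ w ∈ units Γ, units Γ ⊆ closure (orbit w)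

/-- The interior of the isotropy is the unit space. -/
def IsEffective : Prop := interior (isotropy Γ) = units Γ

/-! ### Function algebras -/

/-- The Steinberg algebra `A(Γ)`: the span of characteristic functions of compact open
bisections. -/
noncomputable def steinbergAlg : Submodule ℂ (Γ → ℂ) :=
  Submodule.span ℂ
    {f | ∃ U : Set Γ, IsOpen U ∧ IsCompact U ∧ IsBisection U ∧ f = U.indicator 1}

/-- The algebra `𝒞(Γ)`: the span of the functions that are continuous and compactly supported on
some open bisection `U` and are extended by zero outside `U`. -/
noncomputable def contAlg : Submodule ℂ (Γ → ℂ) :=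
  Submodule.span ℂ
    {f | ∃ U : Set Γ, IsOpen U ∧ IsBisection U ∧ Continuous (fun γ : U => f γ) ∧
      HasCompactSupport (fun γ : U => f γ) ∧ ∀ γ ∉ U, f γ = 0}

end Topological

/-! ### The reduced C*-algebra -/

section Reduced

/-- The Hilbert space `ℓ²(Γ)`, which is the direct sum of the spaces `ℓ²(Γw)` over all units `w`,
where `Γw` is the set of arrows with source `w`. -/
abbrev L2 (Γ : Type u) : Type u := lp (fun _ : Γ => ℂ) 2

/-- Weighted partial permutations are bounded on `ℓ²`. -/
theorem exists_weighted_perm {Γ : Type u} (S : Set Γ) (σ : Γ → Γ) (hσ : InjOn σ S) (c : Γ → ℂ)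
    (hc0 : ∀ η ∉ S, c η = 0) (C : ℝ) (hC : ∀ η, ‖c η‖ ≤ C) :
    ∃ T : L2 Γ →L[ℂ] L2 Γ, ∀ ξ η, (T ξ) η = c η * ξ (σ η) := by
  classical
  have p0 : (0 : ℝ) < ENNReal.toReal 2 := by norm_num
  by_cases hΓ : IsEmpty Γ
  · exact ⟨0, fun ξ η => (hΓ.false η).elim⟩
  have hne : Nonempty Γ := not_isEmpty_iff.mp hΓ
  have hC0 : 0 ≤ C := (norm_nonneg _).trans (hC (Classical.arbitrary Γ))
  have key : ∀ (ξ : L2 Γ) (s : Finset Γ),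
      ∑ η ∈ s, ‖c η * ξ (σ η)‖ ^ (ENNReal.toReal 2) ≤ (C * ‖ξ‖) ^ (ENNReal.toReal 2) := by
    intro ξ s
    have h1 : ∀ η ∈ s, η ∉ s.filter (· ∈ S) → ‖c η * ξ (σ η)‖ ^ (ENNReal.toReal 2) = 0 := by
      intro η hη hη'
      have : η ∉ S := fun h => hη' (Finset.mem_filter.mpr ⟨hη, h⟩)
      rw [hc0 η this]; simp
    rw [← Finset.sum_subset (Finset.filter_subset (· ∈ S) s) h1]
    calc ∑ η ∈ s.filter (· ∈ S), ‖c η * ξ (σ η)‖ ^ (ENNReal.toReal 2)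
        ≤ ∑ η ∈ s.filter (· ∈ S), C ^ (ENNReal.toReal 2) * ‖ξ (σ η)‖ ^ (ENNReal.toReal 2) := by
          refine Finset.sum_le_sum fun η _ => ?_
          rw [norm_mul, Real.mul_rpow (norm_nonneg _) (norm_nonneg _)]
          gcongr
          exact hC η
      _ = C ^ (ENNReal.toReal 2) *
            ∑ γ ∈ (s.filter (· ∈ S)).image σ, ‖ξ γ‖ ^ (ENNReal.toReal 2) := by
          rw [← Finset.mul_sum, Finset.sum_image]
          intro a ha b hb h
          simp only [Finset.coe_filter, mem_ofPred_eq] at ha hb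
          exact hσ ha.2 hb.2 h
      _ ≤ C ^ (ENNReal.toReal 2) * ‖ξ‖ ^ (ENNReal.toReal 2) := by
          gcongr
          exact lp.sum_rpow_le_norm_rpow p0 ξ _
      _ = (C * ‖ξ‖) ^ (ENNReal.toReal 2) := (Real.mul_rpow hC0 (norm_nonneg _)).symm
  let T₀ : L2 Γ →ₗ[ℂ] L2 Γ :=
    { toFun := fun ξ => ⟨fun η => c η * ξ (σ η), memℓp_gen' (key ξ)⟩
      map_add' := fun ξ ζ => by
        apply lp.ext; funext η; exact mul_add _ _ _
      map_smul' := fun a ξ => by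
        apply lp.ext; funext η; exact mul_left_comm _ _ _ }
  refine ⟨T₀.mkContinuous C fun ξ => ?_, fun ξ η => rfl⟩
  exact lp.norm_le_of_forall_sum_le p0 (by positivity) (key ξ)

variable {Γ : Type u} [ArrowGroupoid Γ]

open Classical in
/-- The standard basis vector at `γ`. -/
noncomputable def delta (γ : Γ) : L2 Γ := lp.single 2 γ 1

/-- `T` is the direct sum over all units `w` of the left regular representations
`λ_w(f) δ_γ = ∑_α f(α) δ_{αγ}` (sum over the arrows `α` with source `rng γ`) on `ℓ²(Γw)`: the
coefficient of `T δ_γ` at `η` is `f (η γ⁻¹)` if `η` and `γ` have the same source, and zero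
otherwise. -/
def IsRegularRep (f : Γ → ℂ) (T : L2 Γ →L[ℂ] L2 Γ) : Prop :=
  ∀ γ η : Γ,
    (∀ h : src η = rng (inv γ), (T (delta γ)) η = f (mul η (inv γ) h)) ∧
    (src η ≠ src γ → (T (delta γ)) η = 0)

open Classical in
/-- The operator `λ(f) = ⨁_w λ_w(f)` on `ℓ²(Γ) = ⨁_w ℓ²(Γw)`, whose operator norm is
`sup_w ‖λ_w(f)‖`.  (It is set to `0` if `λ(f)` is not bounded, which does not happen for
`f ∈ 𝒞(Γ)`, see `isRegularRep_regularRep`.) -/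
noncomputable def regularRep (f : Γ → ℂ) : L2 Γ →L[ℂ] L2 Γ :=
  if h : ∃ T, IsRegularRep f T then h.choose else 0

theorem src_eq_rng_inv {η γ : Γ} (h : src η = src γ) : src η = rng (inv γ) := by
  rw [rng_inv, h]

theorem exists_isRegularRep_of_injOn (U : Set Γ) (hs : InjOn (src : Γ → Γ) U)
    (hr : InjOn (rng : Γ → Γ) U) (f : Γ → ℂ) (hf0 : ∀ γ ∉ U, f γ = 0) (C : ℝ)
    (hC : ∀ γ, ‖f γ‖ ≤ C) : ∃ T, IsRegularRep f T := by
  classical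
  let S : Set Γ := {η | ∃ α ∈ U, rng α = rng η}
  have hex : ∀ η : S, ∃ α ∈ U, rng α = rng (η : Γ) := fun η => η.2
  choose A hAU hAr using hex
  have hcomp : ∀ η : S, src (inv (A η)) = rng (η : Γ) := fun η => by rw [src_inv, hAr]
  let σ : Γ → Γ := fun η => if h : η ∈ S then mul (inv (A ⟨η, h⟩)) η (hcomp ⟨η, h⟩) else η
  let c : Γ → ℂ := fun η => if h : η ∈ S then f (A ⟨η, h⟩) else 0
  have hcancel : ∀ (a b : Γ) (h : src (inv a) = rng b)
      (h' : src a = rng (mul (inv a) b h)), mul a (mul (inv a) b h) h' = b := by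
    intro a b h h'
    have h1 : src a = rng (inv a) := (rng_inv a).symm
    rw [← assoc a (inv a) b h1 h (by rw [src_mul, h])]
    have h2 := mul_inv_self a h1
    have h3 : rng a = rng b := by rw [← h, src_inv]
    have h4 : mul a (inv a) h1 = rng b := h2.trans h3
    have : ∀ x (hx : x = rng b) (h5 : src x = rng b), mul x b h5 = b := by
      rintro x rfl h5; exact unit_mul b h5
    exact this _ h4 _
  have hσ : InjOn σ S := by
    intro η hη η' hη' h
    simp only [σ, dif_pos hη, dif_pos hη'] at h
    have hA : A ⟨η, hη⟩ = A ⟨η', hη'⟩ := by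
      apply hs (hAU _) (hAU _)
      have := congrArg rng h
      rwa [rng_mul, rng_mul, rng_inv, rng_inv] at this
    have e1 := hcancel (A ⟨η, hη⟩) η (hcomp ⟨η, hη⟩) (by rw [rng_mul, rng_inv])
    have e2 := hcancel (A ⟨η', hη'⟩) η' (hcomp ⟨η', hη'⟩) (by rw [rng_mul, rng_inv])
    rw [← e1, ← e2]
    congr 1
  obtain ⟨T, hT⟩ := exists_weighted_perm S σ hσ c (fun η hη => by simp [c, hη])
    (max C 0) (fun η => by
      by_cases h : η ∈ S
      · simp only [c, dif_pos h]; exact (hC _).trans (le_max_left _ _)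
      · simp [c, h])
  have hd : ∀ γ η : Γ, (delta γ : L2 Γ) η = if η = γ then 1 else 0 := by
    intro γ η
    by_cases h : η = γ
    · subst h; simp [delta]
    · simp [delta, h]
  refine ⟨T, fun γ η => ⟨fun h => ?_, fun h => ?_⟩⟩
  · rw [hT, hd]
    have hsη : src η = src γ := by rw [h, rng_inv]
    by_cases hU : mul η (inv γ) h ∈ U
    · have hηS : η ∈ S := ⟨_, hU, rng_mul _ _ _⟩
      have hA : A ⟨η, hηS⟩ = mul η (inv γ) h :=
        hr (hAU _) hU (by rw [hAr, rng_mul])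
      have hση : σ η = γ := by
        simp only [σ, dif_pos hηS]
        have h1 : src (mul η (inv γ) h) = rng γ := by rw [src_mul, src_inv]
        have h2 : mul (mul η (inv γ) h) γ h1 = η := by
          rw [assoc η (inv γ) γ h (src_inv γ) h1 (by rw [rng_mul, h])]
          have : ∀ x (hx : x = src η) (h5 : src η = rng x), mul η x h5 = η := by
            rintro x rfl h5; exact mul_unit η h5
          exact this _ ((inv_mul_self γ _).trans hsη.symm) _
        have h3 : src (inv (mul η (inv γ) h)) = rng (mul (mul η (inv γ) h) γ h1) := by
          rw [src_inv, rng_mul (mul η (inv γ) h) γ h1]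
        have h4 : mul (inv (mul η (inv γ) h)) (mul (mul η (inv γ) h) γ h1) h3 = γ := by
          rw [← assoc _ (mul η (inv γ) h) γ (src_inv _) h1
            (by rw [src_mul (inv (mul η (inv γ) h)), h1])]
          have : ∀ x (hx : x = rng γ) (h5 : src x = rng γ), mul x γ h5 = γ := by
            rintro x rfl h5; exact unit_mul γ h5
          exact this _ ((inv_mul_self _ _).trans h1) _
        have h6 : ∀ a b (h7 : src (inv a) = rng b) (ha : a = mul η (inv γ) h)
            (hb : b = mul (mul η (inv γ) h) γ h1), mul (inv a) b h7 = γ := by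
          rintro a b h7 rfl rfl; exact h4
        exact h6 _ _ _ hA h2.symm
      rw [if_pos hση, mul_one]
      simp only [c, dif_pos hηS, hA]
    · rw [hf0 _ hU]
      by_cases hηS : η ∈ S
      · rw [if_neg, mul_zero]
        intro hση
        apply hU
        simp only [σ, dif_pos hηS] at hση
        have h1 : src (A ⟨η, hηS⟩) = rng γ := by rw [← hση, rng_mul, rng_inv]
        have h2 : η = mul (A ⟨η, hηS⟩) γ h1 := by
          have := hcancel (A ⟨η, hηS⟩) η (hcomp ⟨η, hηS⟩) (by rw [rng_mul, rng_inv])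
          refine this.symm.trans ?_
          congr 1
        have h3 : ∀ x (hx : x = mul (A ⟨η, hηS⟩) γ h1) (h4 : src x = rng (inv γ)),
            mul x (inv γ) h4 = A ⟨η, hηS⟩ := by
          rintro x rfl h4
          rw [assoc _ γ (inv γ) h1 (rng_inv γ).symm h4 (by rw [rng_mul, h1])]
          have : ∀ x (hx : x = src (A ⟨η, hηS⟩)) (h5 : src (A ⟨η, hηS⟩) = rng x),
              mul (A ⟨η, hηS⟩) x h5 = A ⟨η, hηS⟩ := by
            rintro x rfl h5; exact mul_unit _ h5
          exact this _ ((mul_inv_self γ _).trans h1.symm) _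
        rw [h3 η h2 h]
        exact hAU _
      · simp [c, hηS]
  · rw [hT, hd]
    by_cases hηS : η ∈ S
    · rw [if_neg, mul_zero]
      intro hση
      apply h
      simp only [σ, dif_pos hηS] at hση
      rw [← hση, src_mul]
    · simp [c, hηS]

theorem exists_isRegularRep [TopologicalSpace Γ] {f : Γ → ℂ} (hf : f ∈ contAlg Γ) :
    ∃ T, IsRegularRep f T := by
  refine Submodule.span_induction ?_ ?_ ?_ ?_ hf
  · rintro f ⟨U, -, hU, hcont, hsupp, h0⟩
    obtain ⟨C, hC⟩ := hsupp.exists_bound_of_continuous hcont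
    refine exists_isRegularRep_of_injOn U ?_ ?_ f h0 (max C 0) fun γ => ?_
    · exact injOn_iff_injective.mpr hU.1.injective
    · exact injOn_iff_injective.mpr hU.2.injective
    · by_cases h : γ ∈ U
      · exact (hC ⟨γ, h⟩).trans (le_max_left _ _)
      · simp [h0 γ h]
  · exact ⟨0, fun γ η => ⟨fun _ => rfl, fun _ => rfl⟩⟩
  · rintro f g - - ⟨T, hT⟩ ⟨T', hT'⟩
    refine ⟨T + T', fun γ η => ⟨fun h => ?_, fun h => ?_⟩⟩
    · exact congrArg₂ (· + ·) ((hT γ η).1 h) ((hT' γ η).1 h)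
    · exact (congrArg₂ (· + ·) ((hT γ η).2 h) ((hT' γ η).2 h)).trans (add_zero _)
  · rintro a f - ⟨T, hT⟩
    refine ⟨a • T, fun γ η => ⟨fun h => ?_, fun h => ?_⟩⟩
    · exact congrArg (a * ·) ((hT γ η).1 h)
    · exact (congrArg (a * ·) ((hT γ η).2 h)).trans (mul_zero _)

/-- For `f ∈ 𝒞(Γ)` the operator `λ(f)` is indeed the regular representation of `f`. -/
theorem isRegularRep_regularRep [TopologicalSpace Γ] {f : Γ → ℂ} (hf : f ∈ contAlg Γ) :
    IsRegularRep f (regularRep f) := by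
  have h := exists_isRegularRep hf
  rw [regularRep, dif_pos h]
  exact h.choose_spec

variable (Γ) [TopologicalSpace Γ]

/-- The reduced C*-algebra `C*_r(Γ)`: the completion of `𝒞(Γ)` in the reduced norm
`‖f‖ = sup_w ‖λ_w(f)‖`, realised as the norm closure of `λ(𝒞(Γ))` in the bounded operators on
`ℓ²(Γ)`. -/
noncomputable def reducedCStar : Set (L2 Γ →L[ℂ] L2 Γ) :=
  closure (regularRep '' (contAlg Γ : Set (Γ → ℂ)))

variable {Γ} in
/-- The canonical map `j` from `C*_r(Γ)` to functions on `Γ`, the continuous extension of the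
inclusion of `𝒞(Γ)` into the bounded functions:  `j(T)(γ) = ⟨δ_γ, T δ_{src γ}⟩`. -/
noncomputable def jMap (T : L2 Γ →L[ℂ] L2 Γ) : Γ → ℂ := fun γ => (T (delta (src γ))) γ

variable {Γ} in
/-- A function is singular if its (open) support has empty interior. -/
def IsSingular (f : Γ → ℂ) : Prop := interior (Function.support f) = ∅

/-- The C*-singular ideal `J`: the elements of the reduced C*-algebra which, viewed as functions
on `Γ`, are singular. -/
noncomputable def singularIdeal : Set (L2 Γ →L[ℂ] L2 Γ) :=
  {T | T ∈ reducedCStar Γ ∧ IsSingular (jMap T)}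

/-- The algebraic singular ideal `J ∩ 𝒞(Γ)`, inside the reduced C*-algebra. -/
noncomputable def algSingularIdeal : Set (L2 Γ →L[ℂ] L2 Γ) :=
  singularIdeal Γ ∩ regularRep '' (contAlg Γ : Set (Γ → ℂ))

/-- The singular ideal `J ∩ A(Γ)` of the Steinberg algebra, inside the reduced C*-algebra. -/
noncomputable def steinbergSingularIdeal : Set (L2 Γ →L[ℂ] L2 Γ) :=
  singularIdeal Γ ∩ regularRep '' (steinbergAlg Γ : Set (Γ → ℂ))

end Reduced

end ArrowGroupoid

/-! ### Self-similar groups and their groupoids of germs -/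

/-- The letter action and the sections `g|_x` of a self-similar action of `G` on the alphabet `X`.
Such data are the same as a length-preserving action on finite words with
`g(xγ) = g(x) (g|_x)(γ)`. -/
class SelfSimilarAction (G : Type u) (X : Type v) [Group G] extends MulAction G X where
  sec : G → X → G
  sec_one : ∀ x, sec 1 x = 1
  sec_mul : ∀ (g h : G) (x : X), sec (g * h) x = sec g (h • x) * sec h x

namespace SelfSimilarAction

/-- Finite and right-infinite words over `X`. -/
inductive Word (X : Type v) : Type v
  | fin : List X → Word X
  | inf : (ℕ → X) → Word X

namespace Word

variable {X : Type v}

/-- Add a first letter. -/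
def cons (x : X) : Word X → Word X
  | fin l => fin (x :: l)
  | inf w => inf (fun n => Nat.casesOn n x w)

/-- Delete the first letter. -/
def tail : Word X → Word X
  | fin l => fin l.tail
  | inf w => inf (fun n => w (n + 1))

/-- The concatenation `α w`. -/
def prepend (α : List X) (w : Word X) : Word X := α.foldr cons w

/-- Delete the first `n` letters. -/
def drop (n : ℕ) (w : Word X) : Word X := tail^[n] w

/-- The cylinder `D(α) = α X* ∪ α X^ω`. -/
def D (α : List X) : Set (Word X) := {w | ∃ v, w = prepend α v}

/-- The sets `D(α) ∩ D(αβ₁)ᶜ ∩ ⋯ ∩ D(αβₙ)ᶜ`. -/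
def IsBasic (U : Set (Word X)) : Prop :=
  ∃ (α : List X) (s : Finset (List X)), U = D α \ ⋃ β ∈ s, D (α ++ β)

theorem tail_cons (x : X) (w : Word X) : tail (cons x w) = w := by
  cases w <;> rfl

theorem cons_inj {x y : X} {v w : Word X} : cons x v = cons y w ↔ x = y ∧ v = w := by
  constructor
  · intro h
    refine ⟨?_, by rw [← tail_cons x v, h, tail_cons]⟩
    cases v <;> cases w <;> simp only [cons, fin.injEq, inf.injEq, reduceCtorEq] at h
    · exact (List.cons.inj h).1
    · exact congrFun h 0
  · rintro ⟨rfl, rfl⟩; rfl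

theorem prepend_append (α β : List X) (w : Word X) :
    prepend (α ++ β) w = prepend α (prepend β w) := by
  simp [prepend]

theorem drop_prepend (α : List X) (w : Word X) : drop α.length (prepend α w) = w := by
  induction α with
  | nil => rfl
  | cons x α ih =>
    have : prepend (x :: α) w = cons x (prepend α w) := rfl
    rw [this, drop, List.length_cons, Function.iterate_succ_apply, tail_cons]
    exact ih

theorem prepend_inj (α : List X) {v w : Word X} : prepend α v = prepend α w ↔ v = w :=
  ⟨fun h => by rw [← drop_prepend α v, h, drop_prepend], fun h => h ▸ rfl⟩

theorem prepend_mem (α : List X) (w : Word X) : prepend α w ∈ D α := ⟨w, rfl⟩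

/-- Two prefixes of one word are comparable. -/
theorem prefix_total {α β : List X} {w : Word X} (hα : w ∈ D α) (hβ : w ∈ D β) :
    α <+: β ∨ β <+: α := by
  induction α generalizing β w with
  | nil => exact Or.inl (List.nil_prefix)
  | cons x α ih =>
    cases β with
    | nil => exact Or.inr (List.nil_prefix)
    | cons y β =>
      obtain ⟨v, rfl⟩ := hα
      obtain ⟨v', h⟩ := hβ
      obtain ⟨rfl, h'⟩ := cons_inj.mp (show cons x (prepend α v) = cons y (prepend β v') from h)
      rcases ih (w := prepend α v) ⟨v, rfl⟩ ⟨v', h'⟩ with h | h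
      · exact Or.inl (List.cons_prefix_cons.mpr ⟨rfl, h⟩)
      · exact Or.inr (List.cons_prefix_cons.mpr ⟨rfl, h⟩)

theorem mem_D_of_prefix {α β : List X} {w : Word X} (h : α <+: β) (hw : w ∈ D β) : w ∈ D α := by
  obtain ⟨γ, rfl⟩ := h
  obtain ⟨v, rfl⟩ := hw
  exact ⟨prepend γ v, prepend_append _ _ _⟩

end Word

open Word

section Action

variable {G : Type u} {X : Type v} [Group G] [SelfSimilarAction G X]

/-- The action on finite words. -/
def lact (g : G) : List X → List X
  | [] => []
  | x :: l => (g • x) :: lact (sec g x) l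

/-- The section `g|_α` at a finite word. -/
def lsec (g : G) : List X → G
  | [] => g
  | x :: l => lsec (sec g x) l

/-- The section of `g` at the first `n` letters of an infinite word. -/
def secInf (g : G) (w : ℕ → X) : ℕ → G
  | 0 => g
  | n + 1 => sec (secInf g w n) (w n)

/-- The action on finite and infinite words. -/
def wact (g : G) : Word X → Word X
  | fin l => fin (lact g l)
  | inf w => inf (fun n => secInf g w n • w n)

theorem secInf_succ (g : G) (w : ℕ → X) (n : ℕ) :
    secInf g w (n + 1) = secInf (sec g (w 0)) (fun k => w (k + 1)) n := by
  induction n with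
  | zero => rfl
  | succ n ih => rw [secInf, ih]; rfl

theorem wact_cons (g : G) (x : X) (w : Word X) :
    wact g (cons x w) = cons (g • x) (wact (sec g x) w) := by
  cases w with
  | fin l => rfl
  | inf w =>
    simp only [cons, wact, inf.injEq]
    funext n
    cases n with
    | zero => rfl
    | succ n => exact congrArg (· • w n) (secInf_succ _ _ n)

theorem wact_prepend (g : G) (α : List X) (w : Word X) :
    wact g (prepend α w) = prepend (lact g α) (wact (lsec g α) w) := by
  induction α generalizing g with
  | nil => rfl
  | cons x α ih =>
    have : prepend (x :: α) w = cons x (prepend α w) := rfl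
    rw [this, wact_cons, ih]; rfl

theorem lact_length (g : G) (α : List X) : (lact g α).length = α.length := by
  induction α generalizing g with
  | nil => rfl
  | cons x α ih => simp [lact, ih]

theorem lact_append (g : G) (α β : List X) :
    lact g (α ++ β) = lact g α ++ lact (lsec g α) β := by
  induction α generalizing g with
  | nil => rfl
  | cons x α ih => simp [lact, lsec, ih]

theorem lsec_append (g : G) (α β : List X) : lsec g (α ++ β) = lsec (lsec g α) β := by
  induction α generalizing g with
  | nil => rfl
  | cons x α ih => simp [lsec, ih]

theorem lact_one (α : List X) : lact (1 : G) α = α := by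
  induction α with
  | nil => rfl
  | cons x α ih => simp [lact, sec_one, ih]

theorem lsec_one (α : List X) : lsec (1 : G) α = 1 := by
  induction α with
  | nil => rfl
  | cons x α ih => simp [lsec, sec_one, ih]

theorem lact_mul (g h : G) (α : List X) : lact (g * h) α = lact g (lact h α) := by
  induction α generalizing g h with
  | nil => rfl
  | cons x α ih => simp [lact, sec_mul, mul_smul, ih]

theorem lsec_mul (g h : G) (α : List X) :
    lsec (g * h) α = lsec g (lact h α) * lsec h α := by
  induction α generalizing g h with
  | nil => rfl
  | cons x α ih => simp [lact, lsec, sec_mul, ih]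

theorem secInf_mul (g h : G) (w : ℕ → X) (n : ℕ) :
    secInf (g * h) w n = secInf g (fun k => secInf h w k • w k) n * secInf h w n := by
  induction n with
  | zero => rfl
  | succ n ih => simp only [secInf]; rw [ih, sec_mul]

theorem wact_mul (g h : G) (w : Word X) : wact (g * h) w = wact g (wact h w) := by
  cases w with
  | fin l => simp [wact, lact_mul]
  | inf w =>
    simp only [wact, inf.injEq]
    funext n
    rw [secInf_mul, mul_smul]

theorem wact_one (w : Word X) : wact (1 : G) w = w := by
  cases w with
  | fin l => simp [wact, lact_one]
  | inf w =>
    have : ∀ n, secInf (1 : G) w n = 1 := by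
      intro n
      induction n with
      | zero => rfl
      | succ n ih => rw [secInf, ih, sec_one]
    simp [wact, this]

theorem lact_inv_lact (g : G) (α : List X) : lact g⁻¹ (lact g α) = α := by
  rw [← lact_mul, inv_mul_cancel, lact_one]

theorem lact_lact_inv (g : G) (α : List X) : lact g (lact g⁻¹ α) = α := by
  rw [← lact_mul, mul_inv_cancel, lact_one]

theorem lsec_inv_lact (g : G) (α : List X) : lsec g⁻¹ (lact g α) = (lsec g α)⁻¹ := by
  rw [eq_inv_iff_mul_eq_one, ← lsec_mul, inv_mul_cancel, lsec_one]

variable (G X) in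
/-- The action on finite words is faithful. -/
def IsFaithful : Prop := ∀ g : G, (∀ α : List X, lact g α = α) → g = 1

end Action

/-- A nonzero element `α g β*` of the inverse monoid associated to a self-similar group. -/
structure Elt (G : Type u) (X : Type v) where
  pre : List X
  mid : G
  suf : List X

/-- The inverse `(α g β*)* = β g⁻¹ α*`. -/
def Elt.star {G : Type u} {X : Type v} [Group G] (t : Elt G X) : Elt G X := ⟨t.suf, t.mid⁻¹, t.pre⟩

theorem Elt.star_star {G : Type u} {X : Type v} [Group G] (t : Elt G X) : t.star.star = t := by
  simp [Elt.star]

section Germs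

variable {G : Type u} {X : Type v} [Group G] [SelfSimilarAction G X]

namespace Elt

open Classical in
/-- The product of nonzero elements in the inverse monoid, with `none` as the zero:
`(α g β*)(βγ h δ*) = α g(γ) g|_γ h δ*`, `(α g (γβ)*)(γ h δ*) = α g β* h δ*` with
`β* h = h|_{h⁻¹(β)} (h⁻¹(β))*`, and all other products are zero. -/
noncomputable def mul (s t : Elt G X) : Option (Elt G X) :=
  if s.suf <+: t.pre then
    let γ := t.pre.drop s.suf.length
    some ⟨s.pre ++ lact s.mid γ, lsec s.mid γ * t.mid, t.suf⟩
  else if t.pre <+: s.suf then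
    let β := lact t.mid⁻¹ (s.suf.drop t.pre.length)
    some ⟨s.pre, s.mid * lsec t.mid β, t.suf ++ β⟩
  else none

/-- The element `γ` of the monoid given by a finite word. -/
def ofWord (γ : List X) : Elt G X := ⟨γ, 1, []⟩

/-- The element given by a group element. -/
def ofGroup (g : G) : Elt G X := ⟨[], g, []⟩

/-- The partial homeomorphism `α g β* : D(β) → D(α)`, `βw ↦ α g(w)` (only used on `D(β)`). -/
def act (t : Elt G X) (w : Word X) : Word X := prepend t.pre (wact t.mid (drop t.suf.length w))

theorem act_prepend (t : Elt G X) (w : Word X) :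
    t.act (prepend t.suf w) = prepend t.pre (wact t.mid w) := by
  rw [act, drop_prepend]

theorem act_mem (t : Elt G X) (w : Word X) : t.act w ∈ D t.pre := ⟨_, rfl⟩

/-- `t γ = μ k` for words `γ, μ` and `k : G`, where `γ` begins with the domain word of `t`. -/
def Maps (t : Elt G X) (γ μ : List X) (k : G) : Prop :=
  ∃ γ', γ = t.suf ++ γ' ∧ μ = t.pre ++ lact t.mid γ' ∧ k = lsec t.mid γ'

theorem Maps.unique {t : Elt G X} {γ μ μ' : List X} {k k' : G} (h : t.Maps γ μ k)
    (h' : t.Maps γ μ' k') : μ = μ' ∧ k = k' := by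
  obtain ⟨γ₁, rfl, rfl, rfl⟩ := h
  obtain ⟨γ₂, h, rfl, rfl⟩ := h'
  obtain rfl := List.append_cancel_left h
  exact ⟨rfl, rfl⟩

theorem exists_maps {t : Elt G X} {γ : List X} (h : t.suf <+: γ) : ∃ μ k, t.Maps γ μ k := by
  obtain ⟨γ', rfl⟩ := h
  exact ⟨_, _, γ', rfl, rfl, rfl⟩

theorem Maps.append {t : Elt G X} {γ μ : List X} {k : G} (h : t.Maps γ μ k) (δ : List X) :
    t.Maps (γ ++ δ) (μ ++ lact k δ) (lsec k δ) := by
  obtain ⟨γ', rfl, rfl, rfl⟩ := h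
  exact ⟨γ' ++ δ, by simp, by simp [lact_append], by simp [lsec_append]⟩

theorem Maps.act {t : Elt G X} {γ μ : List X} {k : G} (h : t.Maps γ μ k) (w : Word X) :
    t.act (prepend γ w) = prepend μ (wact k w) := by
  obtain ⟨γ', rfl, rfl, rfl⟩ := h
  rw [prepend_append, act_prepend, wact_prepend, prepend_append]

theorem Maps.star {t : Elt G X} {γ μ : List X} {k : G} (h : t.Maps γ μ k) :
    t.star.Maps μ γ k⁻¹ := by
  obtain ⟨γ', rfl, rfl, rfl⟩ := h
  exact ⟨lact t.mid γ', rfl, by simp [Elt.star, lact_inv_lact], by simp [Elt.star, lsec_inv_lact]⟩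

theorem Maps.mul_ofWord {t : Elt G X} {γ μ : List X} {k : G} (h : t.Maps γ μ k) :
    t.mul (ofWord γ) = some ⟨μ, k, []⟩ := by
  obtain ⟨γ', rfl, rfl, rfl⟩ := h
  simp [mul, ofWord]

theorem mul_ofWord_of_prefix {t : Elt G X} {γ β : List X} (h : t.suf = γ ++ β) :
    t.mul (ofWord γ) = some ⟨t.pre, t.mid, β⟩ := by
  rcases eq_or_ne β [] with rfl | hβ
  · have h' : t.Maps γ t.pre t.mid := ⟨[], by simp [h], by simp [lact], rfl⟩
    exact h'.mul_ofWord
  · have h1 : ¬ t.suf <+: γ := by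
      intro h2
      have := h2.length_le
      rw [h, List.length_append] at this
      exact hβ (List.length_eq_zero_iff.mp (by omega))
    rw [mul, ofWord, if_neg h1, if_pos (h ▸ List.prefix_append γ β)]
    simp [h, lact_one, lsec_one]

theorem maps_of_mul_ofWord {t : Elt G X} {γ μ : List X} {k : G}
    (hγ : t.suf <+: γ) (h : t.mul (ofWord γ) = some ⟨μ, k, []⟩) : t.Maps γ μ k := by
  obtain ⟨μ', k', h'⟩ := exists_maps hγ
  rw [h'.mul_ofWord] at h
  simp only [Option.some.injEq, Elt.mk.injEq] at h
  obtain ⟨rfl, rfl, -⟩ := h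
  exact h'

/-- The product acts as the composition. -/
theorem maps_of_mul {s t r : Elt G X} (h : s.mul t = some r) {γ : List X} (hγ : r.suf <+: γ) :
    ∃ μ k ν l, t.Maps γ μ k ∧ s.Maps μ ν l ∧ r.Maps γ ν (l * k) := by
  obtain ⟨γ', rfl⟩ := hγ
  unfold mul at h
  split_ifs at h with h1 h2
  · obtain ⟨δ, hδ⟩ := h1
    simp only [← hδ, List.drop_left, Option.some.injEq] at h
    subst h
    refine ⟨t.pre ++ lact t.mid γ', lsec t.mid γ', _, _, ⟨γ', rfl, rfl, rfl⟩,
      ⟨δ ++ lact t.mid γ', by simp [← hδ], rfl, rfl⟩, ⟨γ', rfl, ?_, ?_⟩⟩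
    · simp [lact_append, lact_mul]
    · simp [lsec_append, lsec_mul]
  · obtain ⟨δ, hδ⟩ := h2
    simp only [← hδ, List.drop_left, Option.some.injEq] at h
    subst h
    refine ⟨s.suf ++ lact (lsec t.mid (lact t.mid⁻¹ δ)) γ', lsec (lsec t.mid (lact t.mid⁻¹ δ)) γ',
      _, _, ⟨lact t.mid⁻¹ δ ++ γ', by simp, ?_, ?_⟩,
      ⟨lact (lsec t.mid (lact t.mid⁻¹ δ)) γ', rfl, rfl, rfl⟩, ⟨γ', rfl, ?_, ?_⟩⟩
    · simp [lact_append, lact_lact_inv, ← hδ]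
    · simp [lsec_append]
    · simp [lact_mul]
    · simp [lsec_mul]

/-- If `w` is in the domain of `t` and `t w` is in the domain of `s`, then `s t ≠ 0` and `w` is in
the domain of `s t`. -/
theorem exists_mul {s t : Elt G X} {w : Word X} (hw : w ∈ D t.suf) (hv : t.act w ∈ D s.suf) :
    ∃ r, s.mul t = some r ∧ w ∈ D r.suf := by
  obtain ⟨v, rfl⟩ := hw
  rw [act_prepend] at hv
  unfold mul
  by_cases h1 : s.suf <+: t.pre
  · rw [if_pos h1]
    exact ⟨_, rfl, prepend_mem _ _⟩
  · rw [if_neg h1]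
    have h2 : t.pre <+: s.suf := (prefix_total hv (prepend_mem _ _)).resolve_left h1
    rw [if_pos h2]
    refine ⟨_, rfl, ?_⟩
    obtain ⟨δ, hδ⟩ := h2
    simp only [← hδ, List.drop_left]
    obtain ⟨u, hu⟩ := hv
    rw [← hδ, prepend_append, prepend_inj] at hu
    refine ⟨wact (lsec t.mid⁻¹ δ) u, ?_⟩
    rw [prepend_append, prepend_inj, ← wact_prepend, ← hu, ← wact_mul, inv_mul_cancel, wact_one]

end Elt

open Elt

variable (G X)

/-- Pairs `(t, w)` with `w` in the domain of `t`. -/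
abbrev PreGerm : Type (max u v) := {p : Elt G X × Word X // p.2 ∈ D p.1.suf}

variable {G X}

/-- `(t₁, w) ∼ (t₂, w)` if `t₁ γ = t₂ γ` in the inverse monoid for some finite prefix `γ`
of `w`. -/
def GermRel (p q : PreGerm G X) : Prop :=
  p.1.2 = q.1.2 ∧ ∃ γ : List X, p.1.2 ∈ D γ ∧ p.1.1.mul (ofWord γ) = q.1.1.mul (ofWord γ)

/-- Germ equivalence in terms of a sufficiently long prefix. -/
theorem germRel_iff {p q : PreGerm G X} :
    GermRel p q ↔ p.1.2 = q.1.2 ∧ ∃ γ μ k, p.1.2 ∈ D γ ∧ p.1.1.Maps γ μ k ∧ q.1.1.Maps γ μ k := by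
  constructor
  · rintro ⟨hw, γ, hγ, h⟩
    refine ⟨hw, ?_⟩
    have hp := p.2
    have hq := q.2
    rw [← hw] at hq
    rcases prefix_total hp hγ with h1 | h1
    · obtain ⟨μ, k, h2⟩ := exists_maps h1
      rw [h2.mul_ofWord] at h
      rcases prefix_total hq hγ with h3 | ⟨β, hβ⟩
      · exact ⟨γ, μ, k, hγ, h2, maps_of_mul_ofWord h3 h.symm⟩
      · rw [mul_ofWord_of_prefix hβ.symm] at h
        simp only [Option.some.injEq, Elt.mk.injEq] at h
        obtain ⟨rfl, rfl, rfl⟩ := h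
        exact ⟨γ, _, _, hγ, h2, ⟨[], by simpa using hβ, by simp [lact], rfl⟩⟩
    · obtain ⟨β, hβ⟩ := h1
      rw [mul_ofWord_of_prefix hβ.symm] at h
      rcases prefix_total hq hγ with h3 | ⟨β', hβ'⟩
      · obtain ⟨μ, k, h2⟩ := exists_maps h3
        rw [h2.mul_ofWord] at h
        simp only [Option.some.injEq, Elt.mk.injEq] at h
        obtain ⟨rfl, rfl, rfl⟩ := h
        exact ⟨γ, _, _, hγ, ⟨[], by simpa using hβ, by simp [lact], rfl⟩, h2⟩
      · rw [mul_ofWord_of_prefix hβ'.symm] at h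
        simp only [Option.some.injEq, Elt.mk.injEq] at h
        obtain ⟨h1, h2, rfl⟩ := h
        refine ⟨p.1.1.suf, p.1.1.pre, p.1.1.mid, hp, ⟨[], by simp, by simp [lact], rfl⟩,
          ⟨[], ?_, ?_, ?_⟩⟩
        · rw [← hβ, hβ']; simp
        · simp [lact, h1]
        · simp [lsec, h2]
  · rintro ⟨hw, γ, μ, k, hγ, h1, h2⟩
    exact ⟨hw, γ, hγ, by rw [h1.mul_ofWord, h2.mul_ofWord]⟩

theorem germRel_equivalence : Equivalence (GermRel (G := G) (X := X)) where
  refl p := ⟨rfl, [], ⟨_, rfl⟩, rfl⟩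
  symm := by
    rintro p q ⟨hw, γ, hγ, h⟩
    exact ⟨hw.symm, γ, hw ▸ hγ, h.symm⟩
  trans := by
    intro p q r hpq hqr
    rw [germRel_iff] at *
    obtain ⟨hw, γ, μ, k, hγ, h1, h2⟩ := hpq
    obtain ⟨hw', γ', μ', k', hγ', h1', h2'⟩ := hqr
    refine ⟨hw.trans hw', ?_⟩
    rw [← hw] at hγ'
    rcases prefix_total hγ hγ' with ⟨δ, rfl⟩ | ⟨δ, rfl⟩
    · obtain ⟨rfl, rfl⟩ := (h2.append δ).unique h1'
      exact ⟨_, _, _, hγ', h1.append δ, h2'⟩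
    · obtain ⟨rfl, rfl⟩ := (h1'.append δ).unique h2
      exact ⟨_, _, _, hγ, h1, h2'.append δ⟩

instance germSetoid (G : Type u) (X : Type v) [Group G] [SelfSimilarAction G X] :
    Setoid (PreGerm G X) := ⟨GermRel, germRel_equivalence⟩

/-- The groupoid of germs of a self-similar group (as a set of arrows). -/
def Germ (G : Type u) (X : Type v) [Group G] [SelfSimilarAction G X] : Type (max u v) :=
  Quotient (germSetoid G X)

namespace Germ

/-- The germ `[t, w]`. -/
def mk (t : Elt G X) (w : Word X) (h : w ∈ D t.suf) : Germ G X := Quotient.mk _ ⟨(t, w), h⟩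

theorem mk_eq_iff {t t' : Elt G X} {w w' : Word X} {h : w ∈ D t.suf} {h' : w' ∈ D t'.suf} :
    mk t w h = mk t' w' h' ↔
      w = w' ∧ ∃ γ μ k, w ∈ D γ ∧ t.Maps γ μ k ∧ t'.Maps γ μ k :=
  Quotient.eq.trans germRel_iff

theorem ind {P : Germ G X → Prop} (h : ∀ t w hw, P (mk t w hw)) (a : Germ G X) : P a :=
  Quotient.ind (fun p => h p.1.1 p.1.2 p.2) a

/-- The source of `[t, w]` as a word, namely `w`. -/
def srcWord : Germ G X → Word X := Quotient.lift (fun p => p.1.2) (fun _ _ h => h.1)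

theorem act_eq_of_rel {p q : PreGerm G X} (h : GermRel p q) :
    p.1.1.act p.1.2 = q.1.1.act q.1.2 := by
  obtain ⟨hw, γ, μ, k, ⟨v, hv⟩, h1, h2⟩ := germRel_iff.mp h
  rw [← hw, hv, h1.act, h2.act]

/-- The range of `[t, w]` as a word, namely `t(w)`. -/
def rngWord : Germ G X → Word X :=
  Quotient.lift (fun p => p.1.1.act p.1.2) (fun _ _ h => act_eq_of_rel h)

/-- The unit `[1, w]`. -/
def unit (w : Word X) : Germ G X := mk (ofGroup 1) w ⟨w, rfl⟩

theorem act_suf_mem {t : Elt G X} {w : Word X} : t.act w ∈ D t.star.suf := act_mem t w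

/-- The inverse `[t, w]⁻¹ = [t*, t(w)]`. -/
def inv : Germ G X → Germ G X :=
  Quotient.lift (fun p => mk p.1.1.star (p.1.1.act p.1.2) act_suf_mem) (by
    intro p q h
    have ha := act_eq_of_rel h
    obtain ⟨hw, γ, μ, k, ⟨v, hv⟩, h1, h2⟩ := germRel_iff.mp h
    refine mk_eq_iff.mpr ⟨ha, μ, γ, k⁻¹, ?_, h1.star, h2.star⟩
    rw [hv, h1.act]
    exact prepend_mem _ _)

open Classical in
/-- The product on representatives: `[s, t(w)] [t, w] = [s t, w]`; the value is irrelevant if the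
two germs are not composable. -/
noncomputable def preMul (p q : PreGerm G X) : Germ G X :=
  if h : ∃ r, p.1.1.mul q.1.1 = some r ∧ q.1.2 ∈ D r.suf ∧ p.1.2 = q.1.1.act q.1.2 then
    mk h.choose q.1.2 h.choose_spec.2.1
  else unit q.1.2

theorem preMul_eq {p q : PreGerm G X} (hpq : p.1.2 = q.1.1.act q.1.2) {r : Elt G X}
    (hr : p.1.1.mul q.1.1 = some r) (hw : q.1.2 ∈ D r.suf) :
    preMul p q = mk r q.1.2 hw := by
  have h : ∃ r, p.1.1.mul q.1.1 = some r ∧ q.1.2 ∈ D r.suf ∧ p.1.2 = q.1.1.act q.1.2 :=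
    ⟨r, hr, hw, hpq⟩
  have h' : h.choose = r := Option.some.inj (h.choose_spec.1.symm.trans hr)
  rw [preMul, dif_pos h]
  congr 1

theorem preMul_congr {p q p' q' : PreGerm G X} (hp : GermRel p p') (hq : GermRel q q') :
    preMul p q = preMul p' q' := by
  have ha := act_eq_of_rel hq
  by_cases hpq : p.1.2 = q.1.1.act q.1.2
  · have hpq' : p'.1.2 = q'.1.1.act q'.1.2 := by rw [← hp.1, hpq, ha]
    obtain ⟨r, hr, hw⟩ := exists_mul (s := p.1.1) q.2 (hpq ▸ p.2)
    obtain ⟨r', hr', hw'⟩ := exists_mul (s := p'.1.1) q'.2 (hpq' ▸ p'.2)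
    rw [preMul_eq hpq hr hw, preMul_eq hpq' hr' hw']
    obtain ⟨hpw, γ₁, μ₁, k₁, hγ₁, h1, h1'⟩ := germRel_iff.mp hp
    obtain ⟨hqw, γ₂, μ₂, k₂, hγ₂, h2, h2'⟩ := germRel_iff.mp hq
    refine mk_eq_iff.mpr ⟨hqw, ?_⟩
    -- the preimage of `γ₁` under `q`, as a prefix of the source
    have hst : q.1.1.act q.1.2 ∈ D q.1.1.star.suf := act_suf_mem
    have hback : q.1.1.star.act (q.1.1.act q.1.2) = q.1.2 := by
      obtain ⟨v, hv⟩ := hγ₂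
      rw [hv, h2.act, h2.star.act, ← wact_mul, inv_mul_cancel, wact_one]
    obtain ⟨γ, hγ, hγr, hγr', hγ2, hlong⟩ : ∃ γ, q.1.2 ∈ D γ ∧ r.suf <+: γ ∧ r'.suf <+: γ ∧
        γ₂ <+: γ ∧ ∀ μ k, q.1.1.Maps γ μ k → γ₁ <+: μ := by
      obtain ⟨γ₃, hγ₃, hγ₃'⟩ : ∃ γ₃, q.1.2 ∈ D γ₃ ∧
          ∀ γ, γ₃ <+: γ → ∀ μ k, q.1.1.Maps γ μ k → γ₁ <+: μ := by
        have hm : q.1.1.act q.1.2 ∈ D γ₁ := hpq ▸ hγ₁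
        rcases prefix_total hm hst with h | h
        · refine ⟨[], ⟨_, rfl⟩, fun γ _ μ k hμ => ?_⟩
          obtain ⟨δ, -, rfl, -⟩ := hμ
          exact h.trans (List.prefix_append _ _)
        · obtain ⟨δ, k, hδ⟩ := exists_maps h
          refine ⟨δ, ?_, fun γ hγ μ l hμ => ?_⟩
          · obtain ⟨v, hv⟩ := hm
            rw [← hback, hv, hδ.act]
            exact prepend_mem _ _
          · obtain ⟨ε, rfl⟩ := hγ
            have h3 := hδ.star.append ε
            rw [Elt.star_star] at h3
            obtain ⟨rfl, -⟩ := hμ.unique h3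
            exact List.prefix_append _ _
      have hw'' : q.1.2 ∈ D r'.suf := by rw [hqw]; exact hw'
      have hmax : ∀ a b, q.1.2 ∈ D a → q.1.2 ∈ D b →
          ∃ c, q.1.2 ∈ D c ∧ a <+: c ∧ b <+: c := by
        intro a b h3 h4
        rcases prefix_total h3 h4 with h | h
        · exact ⟨b, h4, h, List.prefix_rfl⟩
        · exact ⟨a, h3, List.prefix_rfl, h⟩
      obtain ⟨c, hc, hc1, hc2⟩ := hmax _ _ hw hw''
      obtain ⟨d, hd, hd1, hd2⟩ := hmax _ _ hγ₂ hγ₃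
      obtain ⟨e, he, he1, he2⟩ := hmax _ _ hc hd
      exact ⟨e, he, hc1.trans he1, hc2.trans he1, hd1.trans he2, hγ₃' e (hd2.trans he2)⟩
    obtain ⟨μ, k, ν, l, m1, m2, m3⟩ := maps_of_mul hr hγr
    obtain ⟨μ', k', ν', l', m1', m2', m3'⟩ := maps_of_mul hr' hγr'
    have hμγ := hlong μ k m1
    obtain ⟨δ, rfl⟩ := hγ2
    obtain ⟨rfl, rfl⟩ := m1.unique (h2.append δ)
    obtain ⟨rfl, rfl⟩ := m1'.unique (h2'.append δ)
    obtain ⟨δ', hδ'⟩ := hμγ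
    have n := h1.append δ'
    have n' := h1'.append δ'
    rw [hδ'] at n n'
    obtain ⟨rfl, rfl⟩ := m2.unique n
    obtain ⟨rfl, rfl⟩ := m2'.unique n'
    exact ⟨_, _, _, hγ, m3, m3'⟩
  · have hpq' : ¬ p'.1.2 = q'.1.1.act q'.1.2 := by rwa [← hp.1, ← ha]
    rw [preMul, preMul, dif_neg (by rintro ⟨_, -, -, h⟩; exact hpq h),
      dif_neg (by rintro ⟨_, -, -, h⟩; exact hpq' h), hq.1]

/-- The product of germs (relevant only for composable germs). -/
noncomputable def mul : Germ G X → Germ G X → Germ G X :=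
  Quotient.lift₂ preMul (fun _ _ _ _ h h' => preMul_congr h h')

theorem mul_mk {s t r : Elt G X} {v w : Word X} {hv : v ∈ D s.suf} {hw : w ∈ D t.suf}
    (h : v = t.act w) (hr : s.mul t = some r) (hwr : w ∈ D r.suf) :
    mul (mk s v hv) (mk t w hw) = mk r w hwr :=
  preMul_eq (p := ⟨(s, v), hv⟩) (q := ⟨(t, w), hw⟩) h hr hwr

theorem act_mul {s t r : Elt G X} (h : s.mul t = some r) {w : Word X} (hw : w ∈ D r.suf) :
    r.act w = s.act (t.act w) := by
  obtain ⟨μ, k, ν, l, h1, h2, h3⟩ := maps_of_mul h List.prefix_rfl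
  obtain ⟨v, rfl⟩ := hw
  rw [h3.act, h1.act, h2.act, wact_mul]

theorem exists_mul_mk {s t : Elt G X} {v w : Word X} (hv : v ∈ D s.suf) (hw : w ∈ D t.suf)
    (h : v = t.act w) : ∃ r, ∃ hwr : w ∈ D r.suf, s.mul t = some r ∧
      mul (mk s v hv) (mk t w hw) = mk r w hwr := by
  obtain ⟨r, hr, hwr⟩ := exists_mul hw (h ▸ hv)
  exact ⟨r, hwr, hr, mul_mk h hr hwr⟩

theorem unit_inj {v w : Word X} : (unit v : Germ G X) = unit w ↔ v = w :=
  ⟨fun h => congrArg srcWord h, fun h => h ▸ rfl⟩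

theorem ofGroup_one_maps (γ : List X) : (ofGroup (1 : G) : Elt G X).Maps γ γ 1 :=
  ⟨γ, rfl, by simp [ofGroup, lact_one], by simp [ofGroup, lsec_one]⟩

theorem ofGroup_one_act (w : Word X) : (ofGroup (1 : G) : Elt G X).act w = w := by
  simpa [prepend, wact_one] using (ofGroup_one_maps (G := G) ([] : List X)).act w

/-- The groupoid structure: `src [t, w] = [1, w]`, `rng [t, w] = [1, t(w)]`,
`[t, w]⁻¹ = [t*, t(w)]` and `[s, t(w)] [t, w] = [s t, w]`. -/
noncomputable instance : ArrowGroupoid (Germ G X) where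
  src a := unit (srcWord a)
  rng a := unit (rngWord a)
  inv := inv
  mul a b _ := mul a b
  src_src _ := rfl
  rng_src a := congrArg unit (ofGroup_one_act _)
  src_rng _ := rfl
  rng_rng a := congrArg unit (ofGroup_one_act _)
  src_inv := ind fun _ _ _ => rfl
  rng_inv := ind fun t w hw => by
    refine congrArg unit ?_
    obtain ⟨v, rfl⟩ := hw
    have h : t.Maps t.suf t.pre t.mid := ⟨[], by simp, by simp [lact], rfl⟩
    change t.star.act (t.act (prepend t.suf v)) = _
    rw [h.act, h.star.act, ← wact_mul, inv_mul_cancel, wact_one]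
    rfl
  src_mul := ind fun s v hv => ind fun t w hw => by
    intro h
    obtain ⟨r, hwr, -, e⟩ := exists_mul_mk hv hw (unit_inj.mp h)
    rw [e]; rfl
  rng_mul := ind fun s v hv => ind fun t w hw => by
    intro h
    have h' : v = t.act w := unit_inj.mp h
    obtain ⟨r, hwr, hr, e⟩ := exists_mul_mk hv hw h'
    rw [e]
    refine congrArg unit ?_
    change r.act w = s.act v
    rw [act_mul hr hwr, h']
  assoc := ind fun a x hx => ind fun b y hy => ind fun c z hz => by
    intro hab hbc _ _
    have hab : x = b.act y := unit_inj.mp hab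
    have hbc : y = c.act z := unit_inj.mp hbc
    obtain ⟨p, hyp, hp, e1⟩ := exists_mul_mk hx hy hab
    obtain ⟨q, hzq, hq, e2⟩ := exists_mul_mk hy hz hbc
    obtain ⟨m, hzm, hm, e3⟩ := exists_mul_mk hyp hz hbc
    obtain ⟨n, hzn, hn, e4⟩ := exists_mul_mk (s := a) hx hzq
      (by rw [act_mul hq hzq, ← hbc, hab])
    rw [e1, e2, e3, e4]
    refine mk_eq_iff.mpr ⟨rfl, ?_⟩
    obtain ⟨γ, hγ, hγm, hγn⟩ : ∃ γ, z ∈ D γ ∧ m.suf <+: γ ∧ n.suf <+: γ := by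
      rcases prefix_total hzm hzn with h | h
      · exact ⟨_, hzn, h, List.prefix_rfl⟩
      · exact ⟨_, hzm, List.prefix_rfl, h⟩
    obtain ⟨μ, k, ν, l, c1, p1, m1⟩ := maps_of_mul hm hγm
    obtain ⟨μ', k', ν', l', q1, a1, n1⟩ := maps_of_mul hn hγn
    obtain ⟨μ₂, k₂, ν₂, l₂, b2, a2, p2⟩ := maps_of_mul hp (γ := μ)
      (by obtain ⟨δ, rfl, -, -⟩ := p1; exact List.prefix_append _ _)
    obtain ⟨μ₃, k₃, ν₃, l₃, c3, b3, q3⟩ := maps_of_mul hq (γ := γ)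
      (by obtain ⟨δ, rfl, -, -⟩ := q1; exact List.prefix_append _ _)
    obtain ⟨rfl, rfl⟩ := c3.unique c1
    obtain ⟨rfl, rfl⟩ := b3.unique b2
    obtain ⟨rfl, rfl⟩ := q3.unique q1
    obtain ⟨rfl, rfl⟩ := p2.unique p1
    obtain ⟨rfl, rfl⟩ := a2.unique a1
    exact ⟨γ, _, _, hγ, m1, by rw [mul_assoc]; exact n1⟩
  mul_unit := ind fun t w hw => by
    intro _
    obtain ⟨r, hwr, hr, e⟩ := exists_mul_mk (t := ofGroup 1) hw ⟨w, rfl⟩ (ofGroup_one_act w).symm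
    refine e.trans (mk_eq_iff.mpr ⟨rfl, ?_⟩)
    obtain ⟨μ, k, ν, l, h1, h2, h3⟩ := maps_of_mul hr List.prefix_rfl
    obtain ⟨rfl, rfl⟩ := h1.unique (ofGroup_one_maps _)
    rw [mul_one] at h3
    exact ⟨_, _, _, hwr, h3, h2⟩
  unit_mul := ind fun t w hw => by
    intro _
    obtain ⟨r, hwr, hr, e⟩ := exists_mul_mk (s := ofGroup 1) ⟨t.act w, rfl⟩ hw rfl
    refine e.trans (mk_eq_iff.mpr ⟨rfl, ?_⟩)
    obtain ⟨μ, k, ν, l, h1, h2, h3⟩ := maps_of_mul hr List.prefix_rfl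
    obtain ⟨rfl, rfl⟩ := h2.unique (ofGroup_one_maps _)
    rw [one_mul] at h3
    exact ⟨_, _, _, hwr, h3, h1⟩
  inv_mul_self := ind fun t w hw => by
    intro _
    obtain ⟨r, hwr, hr, e⟩ := exists_mul_mk (s := t.star) act_suf_mem hw rfl
    refine e.trans (mk_eq_iff.mpr ⟨rfl, ?_⟩)
    obtain ⟨μ, k, ν, l, h1, h2, h3⟩ := maps_of_mul hr List.prefix_rfl
    obtain ⟨rfl, rfl⟩ := h2.unique h1.star
    rw [inv_mul_cancel] at h3
    exact ⟨_, _, _, hwr, h3, ofGroup_one_maps _⟩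
  mul_inv_self := ind fun t w hw => by
    intro h
    have hc : w = t.star.act (t.act w) := unit_inj.mp h
    obtain ⟨r, hwr, hr, e⟩ := exists_mul_mk (t := t.star) hw act_suf_mem hc
    refine e.trans (mk_eq_iff.mpr ⟨rfl, ?_⟩)
    obtain ⟨μ, k, ν, l, h1, h2, h3⟩ := maps_of_mul hr List.prefix_rfl
    obtain ⟨rfl, rfl⟩ := h2.unique (Elt.star_star t ▸ h1.star)
    rw [inv_mul_cancel] at h3
    exact ⟨_, _, _, hwr, h3, ofGroup_one_maps _⟩

/-- The set `(t, U) = {[t, w] : w ∈ U}`. -/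
def bisection (t : Elt G X) (U : Set (Word X)) : Set (Germ G X) :=
  {a | ∃ w, ∃ h : w ∈ D t.suf, w ∈ U ∧ a = mk t w h}

/-- The topology with basis the sets `(α g β*, U)`, where `U ⊆ D(β)` is a basic compact open set
of words. -/
instance : TopologicalSpace (Germ G X) :=
  TopologicalSpace.generateFrom
    {A | ∃ (t : Elt G X) (U : Set (Word X)), IsBasic U ∧ U ⊆ D t.suf ∧ A = bisection t U}

end Germ

end Germs

end SelfSimilarAction

/-! ### The example -/

namespace SingularExample

open SelfSimilarAction SelfSimilarAction.Word ArrowGroupoid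

section

variable (H : Type u) [Group H]

/-- The group `G = H × F(a,b) × ℤ × ℤ`. -/
abbrev GrpG : Type u := H × FreeGroup (Fin 2) × Multiplicative ℤ × Multiplicative ℤ

/-- The group `K = H × F(a,b) × ℤ`. -/
abbrev GrpK : Type u := H × FreeGroup (Fin 2) × Multiplicative ℤ

/-- The alphabet `Y ⊔ Z` with letters `y_n^i` (`n ∈ ℤ`) and `z_k^i` (`k ∈ K`), where `i` takes two
values. -/
inductive Letter : Type u
  | y : Fin 2 → ℤ → Letter
  | z : Fin 2 → GrpK H → Letter

end

variable {H : Type u} [Group H]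

/-- The abelianization `F(a,b) → ℤ²`, composed with the `i`-th projection. -/
def expo (i : Fin 2) : FreeGroup (Fin 2) →* Multiplicative ℤ :=
  FreeGroup.lift (fun j => if j = i then Multiplicative.ofAdd 1 else 1)

/-- The endomorphism `τ` of `G`: the abelianization of `F(a,b)` followed by the embedding of `ℤ²`,
trivial on `H` and on `ℤ²`. -/
def tau : GrpG H →* GrpG H where
  toFun g := (1, 1, expo 0 g.2.1, expo 1 g.2.1)
  map_one' := by simp
  map_mul' g h := by simp

/-- `ζ_i : G → ℤ`, the projections to the two copies of `ℤ`. -/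
def zeta : Fin 2 → GrpG H → Multiplicative ℤ
  | 0, g => g.2.2.1
  | 1, g => g.2.2.2

/-- `π_i : G → K`, the projections keeping the `i`-th copy of `ℤ`. -/
def proj (i : Fin 2) (g : GrpG H) : GrpK H := (g.1, g.2.1, zeta i g)

theorem zeta_one (i : Fin 2) : zeta i (1 : GrpG H) = 1 := by fin_cases i <;> rfl

theorem zeta_mul (i : Fin 2) (g h : GrpG H) : zeta i (g * h) = zeta i g * zeta i h := by
  fin_cases i <;> rfl

theorem proj_one (i : Fin 2) : proj i (1 : GrpG H) = 1 := by
  simp only [proj, zeta_one]; rfl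

theorem proj_mul (i : Fin 2) (g h : GrpG H) : proj i (g * h) = proj i g * proj i h := by
  simp only [proj, zeta_mul]; rfl

/-- The self-similar action: `g(y_n^i) = y_{ζ_i(g)+n}^i` and `g(z_k^i) = z_{π_i(g)k}^i`, with
sections `τ(g)` at the letters in `Y` and `1` at the letters in `Z`. -/
instance : SelfSimilarAction (GrpG H) (Letter H) where
  smul g x := match x with
    | .y i n => .y i (Multiplicative.toAdd (zeta i g) + n)
    | .z i k => .z i (proj i g * k)
  one_smul x := by
    cases x with
    | y i n =>
      change Letter.y i (Multiplicative.toAdd (zeta i (1 : GrpG H)) + n) = _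
      rw [zeta_one]; simp
    | z i k =>
      change Letter.z i (proj i (1 : GrpG H) * k) = _
      rw [proj_one, one_mul]
  mul_smul g h x := by
    cases x with
    | y i n =>
      change Letter.y i (Multiplicative.toAdd (zeta i (g * h)) + n) =
        Letter.y i (Multiplicative.toAdd (zeta i g) + (Multiplicative.toAdd (zeta i h) + n))
      rw [zeta_mul, toAdd_mul, add_assoc]
    | z i k =>
      change Letter.z i (proj i (g * h) * k) = Letter.z i (proj i g * (proj i h * k))
      rw [proj_mul, mul_assoc]
  sec g x := match x with
    | .y _ _ => tau g
    | .z _ _ => 1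
  sec_one x := by cases x <;> simp
  sec_mul g h x := by
    cases x with
    | y i n => exact map_mul tau g h
    | z i k => exact (mul_one (1 : GrpG H)).symm

/-- The action is faithful, so that `G` is a self-similar group. -/
theorem isFaithful : IsFaithful (GrpG H) (Letter H) := by
  intro g hg
  have key : ∀ i, proj i g = 1 := by
    intro i
    have h : [Letter.z i (proj i g * 1)] = [Letter.z i (1 : GrpK H)] := hg [Letter.z i 1]
    simpa using h
  have h0 := key 0
  have h1 := key 1
  simp only [proj, zeta, Prod.mk_eq_one] at h0 h1
  exact Prod.ext h0.1 (Prod.ext h0.2.1 (Prod.ext h0.2.2 h1.2.2))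

variable (H) in
/-- The groupoid of germs of the self-similar group `G`. -/
abbrev Grpd : Type u := Germ (GrpG H) (Letter H)

variable (H) in
/-- The set `B = ⋃_{y ∈ Y} D(y)` of units. -/
def setB : Set (Grpd H) :=
  Germ.bisection (Elt.ofGroup 1) (⋃ (i : Fin 2) (n : ℤ), D [Letter.y i n])

/-- The characteristic function of the bisection `(g, D(ε))`, for `g ∈ G`. -/
noncomputable def chi (g : GrpG H) : Grpd H → ℂ :=
  (Germ.bisection (Elt.ofGroup g) (D [])).indicator 1

variable (H) in
/-- The function `χ_B`. -/
noncomputable def chiB : Grpd H → ℂ := (setB H).indicator 1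

/-- The average of the functions `χ_{(h, D(ε))}` over a finite set of elements `h` of `H`. -/
noncomputable def average (S : Finset H) : Grpd H → ℂ :=
  (S.card : ℂ)⁻¹ • ∑ h ∈ S, chi ((h, 1, 1, 1) : GrpG H)

variable (H) in
/-- The function `a = χ_{(1,D(ε))} - χ_{(a,D(ε))} - χ_{(b,D(ε))} + χ_{(ab,D(ε))}`. -/
noncomputable def funA : Grpd H → ℂ :=
  chi 1 - chi (1, FreeGroup.of 0, 1, 1) - chi (1, FreeGroup.of 1, 1, 1) +
    chi (1, FreeGroup.of 0 * FreeGroup.of 1, 1, 1)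

end SingularExample

/-! Indices follow the code: the two colours of letters are 0 and 1.

Why χ_B lies in the reduced algebra. An element of H fixes every letter of Y with trivial section,
so left multiplication by H is trivial on the arrows with range in B (`permH_apply_of_mem`). On all
other arrows it is free (`eq_one_of_permH_apply_eq`): germs of distinct group elements differ at the
empty word, and H acts on the letters of Z by left translation of K. For a free action of a
non-amenable group, averages over suitable finite sets tend to zero in norm
(`exists_averages_tendsto_zero`). Hence the averages over these subsets of H converge to the
projection onto the arrows with range in B, which is the operator of χ_B.

The averages come from a spectral gap: if no finite set had one, almost invariant unit vectors would
exist and would define an invariant mean (`exists_spectral_gap`). Powers of the corresponding group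
ring element have exponentially small norm relative to their mass. A dyadic level set of the
coefficients carries a fraction of order 1/n of the mass of the n-th power (`exists_level`), and by
positivity the sum over that level set inherits the norm bound. This replaces weighted averages by
averages over sets.

Why a ∗ χ_B is singular. The four elements 1, a, b, ab fix every letter of Y, with section their
abelianization in ℤ². That section moves a second letter of colour j only through its j-th
coordinate, and its further section is trivial. So over words with first letter in Y and at least
two letters, the four terms of a cancel in pairs (`funA_eq_zero`). What survives sits over
one-letter words, a set with empty interior. At the units y_n of colour 0, however, the value is 1,
since the four sections are distinct.

Why it cannot be approximated. For f in 𝒞 and words whose first letters are distinct and run to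
infinity, the values f([g₁, w_n]) tend to the sum of f([g, ε]) over those g that have the same germ
as g₁ at w_n (`tendsto_of_mem_contAlg`). If f is singular, zeros of f can be chosen in each D(z_k),
so the sum of f([g, ε]) over every fibre of π_0 vanishes (`finsum_proj_eq_zero`). Along y_n the
relevant g are those with ζ_0(g) = 0 and τ(g) = 1, and this set is a union of fibres of π_0.
Therefore f(y_n) tends to 0 (`tendsto_unit_y`), whereas a ∗ χ_B equals 1 at every y_n. Norm
convergence implies uniform convergence of coefficients, which rules out both kinds of
approximation. -/

/-! ### The space of finite and infinite words -/

namespace SelfSimilarAction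

namespace Word

variable {X : Type v}

/-- The topology with basis the sets `D(α) \ (D(αβ₁) ∪ ⋯ ∪ D(αβₙ))`. -/
instance : TopologicalSpace (Word X) := generateFrom {U | IsBasic U}

@[simp] theorem D_nil : D ([] : List X) = univ := eq_univ_of_forall fun w => ⟨w, rfl⟩

theorem prepend_preimage_D (β α : List X) :
    prepend (X := X) β ⁻¹' D (β ++ α) = D α := by
  ext w
  simp only [mem_preimage, D, mem_ofPred_eq, prepend_append, prepend_inj]

theorem prepend_image_D (β α : List X) : prepend (X := X) β '' D α = D (β ++ α) := by
  ext w
  constructor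
  · rintro ⟨_, ⟨v, rfl⟩, rfl⟩
    exact ⟨v, (prepend_append _ _ _).symm⟩
  · rintro ⟨v, rfl⟩
    exact ⟨_, ⟨v, rfl⟩, (prepend_append _ _ _).symm⟩

theorem prepend_injective (β : List X) : Function.Injective (prepend (X := X) β) :=
  fun _ _ => (prepend_inj β).mp

theorem prepend_fin (α l : List X) : prepend α (fin l) = fin (α ++ l) := by
  induction α with
  | nil => rfl
  | cons x α ih => exact congrArg (cons x) ih

theorem fin_mem_D {l α : List X} : fin l ∈ D α ↔ α <+: l := by
  constructor
  · rintro ⟨v, hv⟩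
    cases v with
    | fin l' =>
      rw [prepend_fin] at hv
      cases hv
      exact List.prefix_append _ _
    | inf w =>
      exfalso
      have : ∀ α : List X, ∃ w', prepend α (inf w) = inf w' := by
        intro α
        induction α with
        | nil => exact ⟨_, rfl⟩
        | cons x α ih =>
          obtain ⟨w', hw'⟩ := ih
          exact ⟨_, congrArg (cons x) hw'⟩
      obtain ⟨w', hw'⟩ := this α
      rw [hw'] at hv
      cases hv
  · rintro ⟨l', rfl⟩
    exact ⟨fin l', (prepend_fin _ _).symm⟩

theorem cons_head_tail_inf (w : ℕ → X) : cons (w 0) (inf fun n => w (n + 1)) = inf w := by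
  simp only [cons, inf.injEq]
  funext n
  cases n <;> rfl

theorem inf_mem_D {w : ℕ → X} {α : List X} :
    inf w ∈ D α ↔ α = (List.range α.length).map w := by
  induction α generalizing w with
  | nil => simp
  | cons x α ih =>
    have h : inf w ∈ D (x :: α) ↔ x = w 0 ∧ inf (fun n => w (n + 1)) ∈ D α := by
      rw [← cons_head_tail_inf]
      constructor
      · rintro ⟨v, hv⟩
        obtain ⟨h1, h2⟩ := cons_inj.mp (show _ = cons x (prepend α v) from hv)
        exact ⟨h1.symm, v, h2⟩
      · rintro ⟨rfl, v, hv⟩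
        exact ⟨v, congrArg (cons (w 0)) hv⟩
    rw [h, ih, List.length_cons, List.range_succ_eq_map, List.map_cons, List.map_map,
      List.cons.injEq]
    rfl

theorem ext_of_D {v w : Word X} (h : ∀ α, v ∈ D α ↔ w ∈ D α) : v = w := by
  cases v with
  | fin l =>
    cases w with
    | fin l' =>
      congr 1
      have h1 := fin_mem_D.mp ((h l).mp (fin_mem_D.mpr List.prefix_rfl))
      have h2 := fin_mem_D.mp ((h l').mpr (fin_mem_D.mpr List.prefix_rfl))
      exact h1.eq_of_length (le_antisymm h1.length_le h2.length_le)
    | inf w =>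
      have := (fin_mem_D.mp ((h ((List.range (l.length + 1)).map w)).mpr
        (inf_mem_D.mpr (by simp)))).length_le
      simp at this
  | inf v =>
    cases w with
    | fin l =>
      have := (fin_mem_D.mp ((h ((List.range (l.length + 1)).map v)).mp
        (inf_mem_D.mpr (by simp)))).length_le
      simp at this
    | inf w =>
      congr 1
      funext n
      have := inf_mem_D.mp ((h ((List.range (n + 1)).map v)).mp (inf_mem_D.mpr (by simp)))
      simp only [List.length_map, List.length_range, List.map_inj_left, List.mem_range] at this
      exact this n (Nat.lt_succ_self n)

/-- Every prefix-closed chain of finite words is the set of finite prefixes of a word. -/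
theorem exists_of_chain {C : Set (List X)} (h0 : [] ∈ C)
    (hpre : ∀ α β, α <+: β → β ∈ C → α ∈ C)
    (htot : ∀ α ∈ C, ∀ β ∈ C, α <+: β ∨ β <+: α) : ∃ w : Word X, ∀ α, w ∈ D α ↔ α ∈ C := by
  by_cases hmax : ∃ α ∈ C, ∀ β ∈ C, β <+: α
  · obtain ⟨α, hα, h⟩ := hmax
    exact ⟨fin α, fun β => fin_mem_D.trans ⟨fun hβ => hpre _ _ hβ hα, h β⟩⟩
  · push Not at hmax
    have hstep : ∀ α : C, ∃ x : X, (α : List X) ++ [x] ∈ C := by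
      rintro ⟨α, hα⟩
      obtain ⟨β, hβ, hn⟩ := hmax α hα
      obtain ⟨γ, rfl⟩ := (htot α hα β hβ).resolve_right hn
      cases γ with
      | nil => simp at hn
      | cons x γ => exact ⟨x, hpre _ _ ⟨γ, by simp⟩ hβ⟩
    choose x hx using hstep
    let a : ℕ → C := fun n => Nat.rec (motive := fun _ => C) ⟨[], h0⟩ (fun _ α => ⟨α ++ [x α], hx α⟩) n
    let w : ℕ → X := fun n => x (a n)
    have ha : ∀ n, (a n).1 = (List.range n).map w := by
      intro n
      induction n with
      | zero => rfl
      | succ n ih =>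
        rw [List.range_succ, List.map_append, ← ih]
        rfl
    refine ⟨inf w, fun α => inf_mem_D.trans ⟨fun h => ?_, fun h => ?_⟩⟩
    · rw [h, ← ha]
      exact (a _).2
    · have hl : α.length = (a α.length : List X).length := by simp [ha]
      rw [← ha]
      rcases htot α h _ (a α.length).2 with h | h
      · exact h.eq_of_length hl
      · exact (h.eq_of_length hl.symm).symm

theorem isBasic_D (α : List X) : IsBasic (D α) := ⟨α, ∅, by simp⟩

theorem isOpen_of_isBasic {U : Set (Word X)} (h : IsBasic U) : IsOpen U :=
  isOpen_generateFrom_of_mem h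

theorem isOpen_D (α : List X) : IsOpen (D α) := isOpen_of_isBasic (isBasic_D α)

theorem isClosed_D (α : List X) : IsClosed (D α) := by
  rw [← isOpen_compl_iff]
  have : (D α)ᶜ = D [] \ ⋃ β ∈ ({α} : Finset (List X)), D ([] ++ β) := by
    simp [compl_eq_univ_sdiff]
  rw [this]
  exact isOpen_of_isBasic ⟨_, _, rfl⟩

theorem isClosed_of_isBasic {U : Set (Word X)} (h : IsBasic U) : IsClosed U := by
  obtain ⟨α, s, rfl⟩ := h
  exact (isClosed_D α).sdiff (isOpen_biUnion fun β _ => isOpen_D _)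

/-- Continuity into the space of words can be tested on the clopen sets `D(α)`. -/
theorem continuous_of_preimage_D {Z : Type*} [TopologicalSpace Z] {f : Z → Word X}
    (h : ∀ α, IsClopen (f ⁻¹' D α)) : Continuous f := by
  refine continuous_generateFrom_iff.mpr ?_
  rintro _ ⟨α, s, rfl⟩
  rw [preimage_sdiff, preimage_iUnion₂]
  exact (h α).isOpen.sdiff (isClosed_biUnion_finset fun β _ => (h _).isClosed)

instance : T2Space (Word X) := by
  refine ⟨fun v w hvw => ?_⟩
  have : ∃ α, ¬ (v ∈ D α ↔ w ∈ D α) := by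
    by_contra h
    push Not at h
    exact hvw (ext_of_D h)
  obtain ⟨α, hα⟩ := this
  by_cases hv : v ∈ D α
  · exact ⟨D α, (D α)ᶜ, isOpen_D α, (isClosed_D α).isOpen_compl, hv, fun hw => hα (by simp [hv, hw]),
      disjoint_compl_right⟩
  · exact ⟨(D α)ᶜ, D α, (isClosed_D α).isOpen_compl, isOpen_D α, hv,
      by_contra fun hw => hα (by simp [hv, hw]), disjoint_compl_left⟩

/-- A removed cylinder D(δ) with δ incomparable to α misses D(α) and can be dropped. A proper prefix
δ of α would leave the empty set, which the point `w` excludes. -/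
theorem isBasic_sdiff {α : List X} {s : Finset (List X)} {w : Word X}
    (hw : w ∈ D α \ ⋃ δ ∈ s, D δ) : IsBasic (D α \ ⋃ δ ∈ s, D δ) := by
  classical
  refine ⟨α, (s.filter (fun δ => α <+: δ)).image (fun δ => δ.drop α.length), ?_⟩
  ext v
  simp only [Set.mem_sdiff, mem_iUnion, not_exists, Finset.mem_image, Finset.mem_filter]
  refine and_congr_right fun hv => ⟨?_, fun h δ hδ h3 => ?_⟩
  · rintro h _ ⟨_, ⟨hδ, ε, rfl⟩, rfl⟩
    simpa using h _ hδ
  · rcases prefix_total hv h3 with h' | h'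
    · obtain ⟨ε, rfl⟩ := h'
      exact h ε ⟨_, ⟨hδ, ⟨ε, rfl⟩⟩, by simp⟩ h3
    · exact hw.2 (mem_iUnion₂.mpr ⟨δ, hδ, mem_D_of_prefix h' hw.1⟩)

theorem IsBasic.inter {U V : Set (Word X)} (hU : IsBasic U) (hV : IsBasic V) {w : Word X}
    (hw : w ∈ U ∩ V) : IsBasic (U ∩ V) := by
  classical
  obtain ⟨α, s, rfl⟩ := hU
  obtain ⟨β, t, rfl⟩ := hV
  obtain ⟨γ, hγ⟩ : ∃ γ, D α ∩ D β = D γ := by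
    rcases prefix_total hw.1.1 hw.2.1 with h | h
    · exact ⟨β, inter_eq_right.mpr fun _ hw => mem_D_of_prefix h hw⟩
    · exact ⟨α, inter_eq_left.mpr fun _ hw => mem_D_of_prefix h hw⟩
  have : (D α \ ⋃ δ ∈ s, D (α ++ δ)) ∩ (D β \ ⋃ δ ∈ t, D (β ++ δ)) =
      D γ \ ⋃ δ ∈ s.image (α ++ ·) ∪ t.image (β ++ ·), D δ := by
    rw [← hγ, Finset.set_biUnion_union, Finset.set_biUnion_finset_image,
      Finset.set_biUnion_finset_image]
    ext v
    simp only [mem_inter_iff, Set.mem_sdiff, mem_union]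
    tauto
  rw [this] at hw ⊢
  exact isBasic_sdiff hw

theorem isTopologicalBasis_isBasic : IsTopologicalBasis {U : Set (Word X) | IsBasic U} where
  exists_subset_inter U hU V hV _ hw := ⟨U ∩ V, IsBasic.inter hU hV hw, hw, subset_rfl⟩
  sUnion_eq := sUnion_eq_univ_iff.mpr fun w => ⟨D [], isBasic_D _, by simp⟩
  eq_generateFrom := rfl

/-- A basic set containing `w` contains the whole cylinder of its defining prefix. -/
theorem fin_mem_of_isBasic {U : Set (Word X)} (hU : IsBasic U) (hne : U.Nonempty) :
    ∃ (α : List X) (s : Finset (List X)), U = D α \ ⋃ β ∈ s, D (α ++ β) ∧ fin α ∈ U := by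
  obtain ⟨α, s, rfl⟩ := hU
  obtain ⟨w, hw⟩ := hne
  refine ⟨α, s, rfl, fin_mem_D.mpr List.prefix_rfl, ?_⟩
  simp only [mem_iUnion, not_exists]
  intro β hβ h
  have := fin_mem_D.mp h
  have hβ' : β = [] := by
    have := this.length_le
    rw [List.length_append] at this
    exact List.length_eq_zero_iff.mp (by omega)
  refine hw.2 (mem_iUnion₂.mpr ⟨β, hβ, ?_⟩)
  simpa [hβ'] using hw.1

/-- The cylinders belonging to an ultrafilter form a prefix-closed chain, so they are exactly the
cylinders around one word, and that word is a limit. -/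
instance : CompactSpace (Word X) := by
  refine ⟨isCompact_iff_ultrafilter_le_nhds.mpr fun F _ => ?_⟩
  obtain ⟨w, hw⟩ := exists_of_chain (C := {α | D α ∈ F})
    (by rw [mem_ofPred_eq, D_nil]; exact Filter.univ_mem)
    (fun α β h hβ => mem_of_superset hβ fun _ => mem_D_of_prefix h)
    (fun α hα β hβ => by
      obtain ⟨w, hw⟩ := F.nonempty_of_mem (inter_mem hα hβ)
      exact prefix_total hw.1 hw.2)
  refine ⟨w, mem_univ _, ?_⟩
  rw [isTopologicalBasis_isBasic.nhds_hasBasis.ge_iff]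
  rintro _ ⟨⟨α, s, rfl⟩, hα, hs⟩
  rw [sdiff_eq, compl_iUnion₂]
  refine inter_mem ((hw α).mp hα) ?_
  refine (biInter_finset_mem s).mpr fun β hβ => Ultrafilter.compl_mem_iff_notMem.mpr fun h => ?_
  exact hs (mem_iUnion₂.mpr ⟨β, hβ, (hw _).mpr h⟩)

/-- The preimage of a cylinder is everything, a cylinder or empty, according to how the two prefixes
compare. -/
theorem continuous_prepend (β : List X) : Continuous (prepend (X := X) β) := by
  refine continuous_of_preimage_D fun α => ?_
  by_cases h : ∃ w, w ∈ prepend β ⁻¹' D α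
  · obtain ⟨w, hw⟩ := h
    rcases prefix_total hw (prepend_mem β w) with h | h
    · have : prepend β ⁻¹' D α = univ :=
        eq_univ_of_forall fun v => mem_D_of_prefix h (prepend_mem _ _)
      rw [this]
      exact isClopen_univ
    · obtain ⟨δ, rfl⟩ := h
      rw [prepend_preimage_D]
      exact ⟨isClosed_D _, isOpen_D _⟩
  · rw [eq_empty_of_forall_notMem fun w hw => h ⟨w, hw⟩]
    exact isClopen_empty

theorem isOpenEmbedding_prepend (β : List X) : IsOpenEmbedding (prepend (X := X) β) := by
  refine .of_continuous_injective_isOpenMap (continuous_prepend β) (prepend_injective β) ?_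
  refine isTopologicalBasis_isBasic.isOpenMap_iff.mpr ?_
  rintro _ ⟨α, s, rfl⟩
  rw [image_sdiff (prepend_injective β), image_iUnion₂]
  simp_rw [prepend_image_D]
  exact (isOpen_D _).sdiff (isClosed_biUnion_finset fun _ _ => isClosed_D _)

end Word

open Word

variable {G : Type u} {X : Type v} [Group G] [SelfSimilarAction G X]

theorem wact_preimage_D (g : G) (α : List X) :
    wact g ⁻¹' D α = D (lact g⁻¹ α) := by
  ext w
  constructor
  · rintro ⟨v, hv⟩
    exact ⟨wact (lsec g⁻¹ α) v, by
      rw [← wact_prepend, ← hv, ← wact_mul, inv_mul_cancel, wact_one]⟩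
  · rintro ⟨v, rfl⟩
    rw [mem_preimage, wact_prepend, lact_lact_inv]
    exact prepend_mem _ _

theorem continuous_wact (g : G) : Continuous (wact (X := X) g) :=
  continuous_of_preimage_D fun α => by
    rw [wact_preimage_D]
    exact ⟨isClosed_D _, isOpen_D _⟩

end SelfSimilarAction

/-! ### The groupoid of germs is ample -/

namespace SelfSimilarAction

open Word Elt ArrowGroupoid

namespace Germ

variable {G : Type u} {X : Type v} [Group G] [SelfSimilarAction G X]

/-- The chart `v ↦ [α g β*, βv]`. -/
def chart (t : Elt G X) (v : Word X) : Germ G X := mk t (prepend t.suf v) (prepend_mem _ _)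

theorem exists_chart (a : Germ G X) : ∃ t v, chart t v = a := by
  induction a using ind with
  | h t w hw =>
    obtain ⟨v, rfl⟩ := hw
    exact ⟨t, v, rfl⟩

theorem chart_injective (t : Elt G X) : Function.Injective (chart t) := fun _ _ h =>
  (prepend_inj _).mp (congrArg srcWord h)

theorem isOpen_bisection {t : Elt G X} {U : Set (Word X)} (hU : IsBasic U) (h : U ⊆ D t.suf) :
    IsOpen (bisection t U) := isOpen_generateFrom_of_mem ⟨t, U, hU, h, rfl⟩

theorem chart_image (t : Elt G X) (V : Set (Word X)) :
    chart t '' V = bisection t (prepend t.suf '' V) := by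
  ext a
  constructor
  · rintro ⟨v, hv, rfl⟩
    exact ⟨_, prepend_mem _ _, ⟨v, hv, rfl⟩, rfl⟩
  · rintro ⟨_, _, ⟨v, hv, rfl⟩, rfl⟩
    exact ⟨v, hv, rfl⟩

theorem isBasic_prepend_image {U : Set (Word X)} (hU : IsBasic U) (β : List X) :
    IsBasic (prepend β '' U) := by
  obtain ⟨α, s, rfl⟩ := hU
  refine ⟨β ++ α, s, ?_⟩
  rw [image_sdiff (prepend_injective β), image_iUnion₂]
  simp_rw [prepend_image_D, List.append_assoc]

/-- Equality of two germs at a word is witnessed by a finite prefix γ, so it persists on all of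
D(γ). -/
theorem continuous_chart (t : Elt G X) : Continuous (chart t) := by
  refine continuous_generateFrom_iff.mpr ?_
  rintro _ ⟨s, U, hU, hUs, rfl⟩
  refine isOpen_iff_mem_nhds.mpr ?_
  rintro v ⟨w, hw, hwU, h⟩
  obtain ⟨rfl, γ, μ, k, hγ, h1, h2⟩ := mk_eq_iff.mp h
  refine mem_of_superset (((isOpen_of_isBasic hU).inter (isOpen_D γ)).preimage
    (continuous_prepend t.suf) |>.mem_nhds ⟨hwU, hγ⟩) ?_
  rintro v' ⟨h3, h4⟩
  exact ⟨_, hUs h3, h3, mk_eq_iff.mpr ⟨rfl, γ, μ, k, h4, h1, h2⟩⟩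

theorem isOpenEmbedding_chart (t : Elt G X) : IsOpenEmbedding (chart t) := by
  refine .of_continuous_injective_isOpenMap (continuous_chart t) (chart_injective t) ?_
  refine isTopologicalBasis_isBasic.isOpenMap_iff.mpr fun U hU => ?_
  rw [chart_image]
  refine isOpen_bisection (isBasic_prepend_image hU _) ?_
  rintro _ ⟨v, -, rfl⟩
  exact prepend_mem _ _

/-- The charts are open embeddings that cover the groupoid. Topological questions about the possibly
non-Hausdorff space of germs thereby become questions about the compact Hausdorff space of words. -/
theorem continuous_iff_chart {Z : Type*} [TopologicalSpace Z] {f : Germ G X → Z} :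
    Continuous f ↔ ∀ t : Elt G X, Continuous (f ∘ chart t) := by
  refine ⟨fun h t => h.comp (continuous_chart t), fun h => continuous_iff_continuousAt.mpr ?_⟩
  intro a
  obtain ⟨t, v, rfl⟩ := exists_chart a
  exact (isOpenEmbedding_chart t).continuousAt_iff.mp (h t).continuousAt

theorem isOpenMap_iff_chart {Z : Type*} [TopologicalSpace Z] {f : Germ G X → Z}
    (h : ∀ t : Elt G X, IsOpenMap (f ∘ chart t)) : IsOpenMap f := by
  refine IsOpenMap.of_nhds_le fun a => ?_
  obtain ⟨t, v, rfl⟩ := exists_chart a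
  rw [← (isOpenEmbedding_chart t).map_nhds_eq, Filter.map_map]
  exact (h t).nhds_le v

theorem unit_eq_chart : (unit : Word X → Germ G X) = chart (ofGroup 1) := rfl

theorem units_eq_range : units (Germ G X) = range (unit : Word X → Germ G X) := by
  ext a
  exact ⟨fun h => ⟨_, h⟩, by rintro ⟨w, rfl⟩; rfl⟩

theorem src_chart (t : Elt G X) (v : Word X) :
    src (chart t v) = unit (prepend t.suf v) := rfl

theorem rng_chart (t : Elt G X) (v : Word X) :
    rng (chart t v) = unit (prepend t.pre (wact t.mid v)) :=
  congrArg unit (act_prepend t v)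

theorem inv_chart (t : Elt G X) (v : Word X) :
    ArrowGroupoid.inv (chart t v) = chart t.star (wact t.mid v) := by
  refine mk_eq_iff.mpr ⟨act_prepend t v, t.pre, t.suf, t.mid⁻¹, act_mem _ _, ?_, ?_⟩ <;>
  exact ⟨[], by simp [Elt.star, lact, lsec]⟩

theorem continuous_unit : Continuous (unit : Word X → Germ G X) := continuous_chart _

theorem continuous_src : Continuous (src : Germ G X → Germ G X) :=
  continuous_iff_chart.mpr fun t => continuous_unit.comp (continuous_prepend t.suf)

theorem continuous_srcWord : Continuous (srcWord : Germ G X → Word X) :=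
  continuous_iff_chart.mpr fun t => continuous_prepend t.suf

theorem continuous_inv : Continuous (ArrowGroupoid.inv : Germ G X → Germ G X) :=
  continuous_iff_chart.mpr fun t => by
    have : ArrowGroupoid.inv ∘ chart t = chart t.star ∘ wact t.mid := funext (inv_chart t)
    rw [this]
    exact (continuous_chart _).comp (continuous_wact _)

theorem rng_eq_src_inv : (rng : Germ G X → Germ G X) = src ∘ ArrowGroupoid.inv :=
  funext fun a => (src_inv a).symm

theorem continuous_rng : Continuous (rng : Germ G X → Germ G X) := by
  rw [rng_eq_src_inv]
  exact continuous_src.comp continuous_inv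

theorem isOpenMap_src : IsOpenMap (src : Germ G X → Germ G X) :=
  isOpenMap_iff_chart fun t => (isOpenEmbedding_chart (ofGroup 1)).isOpenMap.comp
    (isOpenEmbedding_prepend t.suf).isOpenMap

theorem inv_inv (a : Germ G X) : ArrowGroupoid.inv (ArrowGroupoid.inv a) = a := by
  induction a using ind with
  | h t w hw =>
    obtain ⟨v, rfl⟩ := hw
    change ArrowGroupoid.inv (ArrowGroupoid.inv (chart t v)) = chart t v
    rw [inv_chart, inv_chart]
    refine mk_eq_iff.mpr ⟨?_, t.suf, t.pre, t.mid, prepend_mem _ _, ?_, ?_⟩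
    · change prepend t.suf (wact t.mid⁻¹ (wact t.mid v)) = _
      rw [← wact_mul, inv_mul_cancel, wact_one]
    · exact ⟨[], by simp [Elt.star, lact, lsec]⟩
    · exact ⟨[], by simp [lact, lsec]⟩

theorem isOpenMap_rng : IsOpenMap (rng : Germ G X → Germ G X) := by
  rw [rng_eq_src_inv]
  refine isOpenMap_src.comp fun U hU => ?_
  rw [image_eq_preimage_of_inverse (g := ArrowGroupoid.inv) inv_inv inv_inv]
  exact hU.preimage continuous_inv

/-- In the chart of α g β*, source and range become v ↦ βv and v ↦ αg(v). Both are injective, and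
source and range are open maps. -/
theorem isBisection_range_chart (t : Elt G X) : IsBisection (range (chart t)) := by
  have hU : IsOpen (range (chart t)) := (isOpenEmbedding_chart t).isOpen_range
  constructor
  · refine (IsOpenEmbedding.of_continuous_injective_isOpenMap
      (continuous_src.comp continuous_subtype_val) ?_
      (isOpenMap_src.comp hU.isOpenMap_subtype_val)).isEmbedding
    rintro ⟨_, v, rfl⟩ ⟨_, w, rfl⟩ h
    have h' := congrArg srcWord h
    exact Subtype.ext (congrArg (chart t) ((prepend_inj _).mp h'))
  · refine (IsOpenEmbedding.of_continuous_injective_isOpenMap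
      (continuous_rng.comp continuous_subtype_val) ?_
      (isOpenMap_rng.comp hU.isOpenMap_subtype_val)).isEmbedding
    rintro ⟨_, v, rfl⟩ ⟨_, w, rfl⟩ h
    have h' : rng (chart t v) = rng (chart t w) := h
    rw [rng_chart, rng_chart] at h'
    have h'' := (prepend_inj _).mp (unit_inj.mp h')
    refine Subtype.ext (congrArg _ ?_)
    rw [← wact_one (G := G) v, ← inv_mul_cancel t.mid, wact_mul, h'', ← wact_mul, inv_mul_cancel,
      wact_one]

end Germ

end SelfSimilarAction

theorem ArrowGroupoid.IsBisection.mono {Γ : Type u} [ArrowGroupoid Γ] [TopologicalSpace Γ]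
    {A B : Set Γ} (hB : IsBisection B) (h : A ⊆ B) : IsBisection A :=
  ⟨hB.1.comp (IsEmbedding.inclusion h), hB.2.comp (IsEmbedding.inclusion h)⟩

namespace SelfSimilarAction

open Word Elt ArrowGroupoid

namespace Germ

variable {G : Type u} {X : Type v} [Group G] [SelfSimilarAction G X]

theorem isBisection_chart_image (t : Elt G X) (V : Set (Word X)) : IsBisection (chart t '' V) :=
  (isBisection_range_chart t).mono (image_subset_range _ _)

/-- The sets `(α g β*, U)` with `U` basic compact open form a basis. -/
theorem isTopologicalBasis_chart_image :
    IsTopologicalBasis {A : Set (Germ G X) | ∃ t V, IsBasic V ∧ A = chart t '' V} := by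
  refine isTopologicalBasis_of_isOpen_of_nhds ?_ fun a O ha hO => ?_
  · rintro _ ⟨t, V, hV, rfl⟩
    exact (isOpenEmbedding_chart t).isOpenMap _ (isOpen_of_isBasic hV)
  · obtain ⟨t, v, rfl⟩ := exists_chart a
    obtain ⟨V, hV, hv, hVO⟩ := isTopologicalBasis_isBasic.exists_subset_of_mem_open
      (show v ∈ chart t ⁻¹' O from ha) (hO.preimage (continuous_chart t))
    exact ⟨_, ⟨t, V, hV, rfl⟩, ⟨v, hv, rfl⟩, image_subset_iff.mpr hVO⟩

theorem isCompact_chart_image (t : Elt G X) {V : Set (Word X)} (hV : IsBasic V) :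
    IsCompact (chart t '' V) :=
  (isClosed_of_isBasic hV).isCompact.image (continuous_chart t)

/-- The homeomorphism between words and units. -/
noncomputable def unitsHomeomorph : Word X ≃ₜ units (Germ G X) :=
  (isOpenEmbedding_chart (ofGroup 1)).isEmbedding.toHomeomorph.trans
    (Homeomorph.setCongr units_eq_range.symm)

theorem continuous_mul :
    Continuous (fun p : {p : Germ G X × Germ G X // src p.1 = rng p.2} =>
      ArrowGroupoid.mul p.1.1 p.1.2 p.2) := by
  refine continuous_iff_continuousAt.mpr ?_
  rintro ⟨⟨p, q⟩, h⟩
  induction p using ind with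
  | h s x hx =>
  induction q using ind with
  | h t y hy =>
  have hxy : x = t.act y := unit_inj.mp h
  obtain ⟨r, hyr, hr, e⟩ := exists_mul_mk hx hy hxy
  obtain ⟨v₀, hv₀⟩ := id hyr
  -- Near the given pair the product is [r, ·] for the fixed r = st, so it depends only on the
  -- source of the second factor.
  have hsrc : ContinuousAt (fun p : {p : Germ G X × Germ G X // src p.1 = rng p.2} =>
      chart r (drop r.suf.length (srcWord p.1.2))) ⟨(mk s x hx, mk t y hy), h⟩ := by
    have h1 : ContinuousAt (fun y => chart r (drop r.suf.length y)) y := by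
      rw [hv₀, ← (isOpenEmbedding_prepend r.suf).continuousAt_iff]
      have : (fun y => chart r (drop r.suf.length y)) ∘ prepend r.suf = chart r :=
        funext fun v => congrArg _ (drop_prepend _ _)
      rw [this]
      exact (continuous_chart r).continuousAt
    have h2 : Continuous fun p : {p : Germ G X × Germ G X // src p.1 = rng p.2} =>
      srcWord p.1.2 := continuous_srcWord.comp (continuous_snd.comp continuous_subtype_val)
    exact ContinuousAt.comp (g := fun y => chart r (drop r.suf.length y))
      (x := ⟨(mk s x hx, mk t y hy), h⟩) h1 h2.continuousAt
  refine hsrc.congr ?_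
  have hs : range (chart s) ∈ 𝓝 (mk s x hx) := by
    refine (isOpenEmbedding_chart s).isOpen_range.mem_nhds ?_
    obtain ⟨v, rfl⟩ := hx
    exact ⟨v, rfl⟩
  have ht : range (chart t) ∩ srcWord ⁻¹' D r.suf ∈ 𝓝 (mk t y hy) := by
    refine ((isOpenEmbedding_chart t).isOpen_range.inter
      ((isOpen_D _).preimage continuous_srcWord)).mem_nhds ⟨?_, hyr⟩
    obtain ⟨v, rfl⟩ := hy
    exact ⟨v, rfl⟩
  filter_upwards [(continuous_fst.comp continuous_subtype_val).continuousAt.preimage_mem_nhds hs,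
    (continuous_snd.comp continuous_subtype_val).continuousAt.preimage_mem_nhds ht]
  rintro ⟨⟨p', q'⟩, h'⟩ ⟨v, hv : chart s v = p'⟩ ⟨⟨v', hv' : chart t v' = q'⟩, h1⟩
  subst hv hv'
  obtain ⟨v₁, hv₁⟩ : prepend t.suf v' ∈ D r.suf := h1
  refine Eq.trans ?_ (mul_mk (unit_inj.mp h') hr ⟨v₁, hv₁⟩).symm
  change chart r (drop r.suf.length (prepend t.suf v')) = _
  simp only [hv₁, drop_prepend]
  rfl

variable (G X) in
theorem isAmple : IsAmple (Germ G X) where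
  continuous_src := continuous_src
  continuous_rng := continuous_rng
  continuous_inv := continuous_inv
  continuous_mul := continuous_mul
  t2_units := unitsHomeomorph.t2Space
  locallyCompact_units := unitsHomeomorph.symm.isClosedEmbedding.locallyCompactSpace
  isOpenMap_src := fun U hU => by
    have := (isOpenMap_src U hU).preimage (continuous_subtype_val (p := (· ∈ units (Germ G X))))
    convert this using 1
    ext ⟨a, ha⟩
    simp only [mem_image, mem_preimage]
    exact exists_congr fun x => and_congr_right fun _ => Subtype.ext_iff
  basis := by
    refine isTopologicalBasis_of_isOpen_of_nhds (fun U h => h.1) fun a O ha hO => ?_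
    obtain ⟨_, ⟨t, V, hV, rfl⟩, h1, h2⟩ :=
      isTopologicalBasis_chart_image.exists_subset_of_mem_open ha hO
    exact ⟨_, ⟨(isOpenEmbedding_chart t).isOpenMap _ (isOpen_of_isBasic hV),
      isBisection_chart_image t V⟩, h1, h2⟩
  compact_basis := by
    refine isTopologicalBasis_of_isOpen_of_nhds (fun U h => h.1) fun a O ha hO => ?_
    obtain ⟨_, ⟨t, V, hV, rfl⟩, h1, h2⟩ :=
      isTopologicalBasis_chart_image.exists_subset_of_mem_open ha hO
    exact ⟨_, ⟨(isOpenEmbedding_chart t).isOpenMap _ (isOpen_of_isBasic hV),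
      isCompact_chart_image t hV, isBisection_chart_image t V⟩, h1, h2⟩

end Germ

end SelfSimilarAction

/-! ### Permutation operators and restrictions on `ℓ²` -/

namespace ArrowGroupoid

section L2

variable {Γ : Type u}

theorem L2.norm_sq (ξ : L2 Γ) : ‖ξ‖ ^ 2 = ∑' γ, ‖ξ γ‖ ^ 2 := by
  have := lp.norm_rpow_eq_tsum (p := 2) (by norm_num) ξ
  simpa using this

theorem L2.summable_sq (ξ : L2 Γ) : Summable fun γ => ‖ξ γ‖ ^ 2 := by
  have := (lp.memℓp ξ).summable (by norm_num)
  simpa using this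

theorem L2.norm_mono {ξ ζ : L2 Γ} (h : ∀ γ, ‖ξ γ‖ ≤ ‖ζ γ‖) : ‖ξ‖ ≤ ‖ζ‖ :=
  lp.norm_mono two_ne_zero h

theorem L2.ext {ξ ζ : L2 Γ} (h : ∀ γ, ξ γ = ζ γ) : ξ = ζ := lp.ext (funext h)

theorem exists_permOp (σ : Equiv.Perm Γ) :
    ∃ T : L2 Γ →L[ℂ] L2 Γ, ∀ ξ γ, T ξ γ = ξ (σ⁻¹ γ) := by
  obtain ⟨T, hT⟩ := exists_weighted_perm univ (σ⁻¹ : Equiv.Perm Γ) (Equiv.injective _).injOn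
    (fun _ => 1) (fun η h => (h trivial).elim) 1 (fun _ => by simp)
  exact ⟨T, fun ξ γ => by rw [hT, one_mul]⟩

/-- The permutation representation on `ℓ²(Γ)`. -/
noncomputable def permOp : Equiv.Perm Γ →* (L2 Γ →L[ℂ] L2 Γ) where
  toFun σ := (exists_permOp σ).choose
  map_one' := by
    ext1 ξ
    refine L2.ext fun γ => ?_
    rw [(exists_permOp 1).choose_spec]
    rfl
  map_mul' σ τ := by
    ext1 ξ
    refine L2.ext fun γ => ?_
    rw [mul_apply_eq_comp, (exists_permOp _).choose_spec,
      (exists_permOp _).choose_spec, (exists_permOp _).choose_spec]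
    rfl

theorem permOp_apply (σ : Equiv.Perm Γ) (ξ : L2 Γ) (γ : Γ) : permOp σ ξ γ = ξ (σ⁻¹ γ) :=
  (exists_permOp σ).choose_spec ξ γ

theorem norm_permOp (σ : Equiv.Perm Γ) (ξ : L2 Γ) : ‖permOp σ ξ‖ = ‖ξ‖ := by
  rw [← sq_eq_sq₀ (norm_nonneg _) (norm_nonneg _), L2.norm_sq, L2.norm_sq]
  simp_rw [permOp_apply]
  exact Equiv.tsum_eq (σ⁻¹) fun γ => ‖ξ γ‖ ^ 2

theorem exists_restr (s : Set Γ) :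
    ∃ T : L2 Γ →L[ℂ] L2 Γ, ∀ ξ γ, T ξ γ = s.indicator ξ γ := by
  obtain ⟨T, hT⟩ := exists_weighted_perm univ (id : Γ → Γ) (injOn_id _)
    (s.indicator 1) (fun η h => (h trivial).elim) 1
    (fun η => by by_cases h : η ∈ s <;> simp [h])
  exact ⟨T, fun ξ γ => by rw [hT]; by_cases h : γ ∈ s <;> simp [h]⟩

/-- The projection of `ℓ²(Γ)` onto the functions supported on `s`. -/
noncomputable def restr (s : Set Γ) : L2 Γ →L[ℂ] L2 Γ := (exists_restr s).choose

theorem restr_apply (s : Set Γ) (ξ : L2 Γ) (γ : Γ) : restr s ξ γ = s.indicator ξ γ :=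
  (exists_restr s).choose_spec ξ γ

theorem norm_restr_le (s : Set Γ) (ξ : L2 Γ) : ‖restr s ξ‖ ≤ ‖ξ‖ := by
  refine L2.norm_mono fun γ => ?_
  rw [restr_apply]
  exact norm_indicator_le_norm_self _ _

theorem restr_univ (ξ : L2 Γ) : restr univ ξ = ξ := L2.ext fun γ => by simp [restr_apply]

theorem norm_restr_union {s t : Set Γ} (h : Disjoint s t) (ξ : L2 Γ) :
    ‖restr (s ∪ t) ξ‖ ^ 2 = ‖restr s ξ‖ ^ 2 + ‖restr t ξ‖ ^ 2 := by
  rw [L2.norm_sq, L2.norm_sq, L2.norm_sq, ← (L2.summable_sq _).tsum_add (L2.summable_sq _)]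
  refine tsum_congr fun γ => ?_
  simp_rw [restr_apply]
  by_cases hs : γ ∈ s
  · simp [hs, disjoint_left.mp h hs]
  · by_cases ht : γ ∈ t <;> simp [hs, ht]

theorem restr_add_restr_compl (s : Set Γ) (ξ : L2 Γ) : restr s ξ + restr sᶜ ξ = ξ :=
  L2.ext fun γ => by
    rw [lp.coeFn_add, Pi.add_apply, restr_apply, restr_apply]
    by_cases h : γ ∈ s <;> simp [h]

/-- The pointwise absolute value. -/
noncomputable def absL2 (ξ : L2 Γ) : L2 Γ :=
  ⟨fun γ => (‖ξ γ‖ : ℂ), (lp.memℓp ξ).mono' fun γ => by simp⟩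

theorem absL2_apply (ξ : L2 Γ) (γ : Γ) : absL2 ξ γ = (‖ξ γ‖ : ℂ) := rfl

theorem norm_absL2 (ξ : L2 Γ) : ‖absL2 ξ‖ = ‖ξ‖ :=
  le_antisymm (L2.norm_mono fun γ => by simp [absL2_apply])
    (L2.norm_mono fun γ => by simp [absL2_apply])

theorem L2.sum_apply {ι : Type*} (s : Finset ι) (f : ι → L2 Γ) (γ : Γ) :
    (∑ i ∈ s, f i) γ = ∑ i ∈ s, f i γ := by
  rw [lp.coeFn_sum, Finset.sum_apply]

end L2

/-! ### Averages of permutation operators over finite subsets of a non-amenable group -/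

section Amenable

variable {Γ : Type u} {H : Type v} [Group H] {ρ : H →* Equiv.Perm Γ} {Ω : Set Γ}

/-- Choose a representative in each orbit; the value at γ is the element carrying the representative
to γ, unique on `Ω` by freeness. Such a map transports vectors in ℓ² over `Ω` to mass distributions
on the group. -/
theorem exists_equivariant_of_free (hΩ : ∀ h, ∀ γ ∈ Ω, ρ h γ ∈ Ω)
    (hfree : ∀ h, ∀ γ ∈ Ω, ρ h γ = γ → h = 1) :
    ∃ p : Γ → H, ∀ h, ∀ γ ∈ Ω, p (ρ h γ) = h * p γ := by
  let R : Setoid Γ :=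
    { r := fun a b => ∃ h, ρ h a = b
      iseqv :=
        { refl := fun a => ⟨1, by simp⟩
          symm := fun {a b} ⟨h, hh⟩ => ⟨h⁻¹, by rw [← hh, ← Equiv.Perm.mul_apply, ← map_mul]; simp⟩
          trans := fun {a b c} ⟨h, hh⟩ ⟨k, hk⟩ => ⟨k * h, by
            rw [map_mul, Equiv.Perm.mul_apply, hh, hk]⟩ } }
  have hp : ∀ γ, ∃ h, ρ h (Quotient.mk R γ).out = γ := fun γ => Quotient.mk_out (s := R) γ
  choose p hp using hp
  refine ⟨p, fun h γ hγ => ?_⟩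
  have hq : Quotient.mk R (ρ h γ) = Quotient.mk R γ := Quotient.sound ⟨h⁻¹, by
    rw [← Equiv.Perm.mul_apply, ← map_mul]; simp⟩
  have h1 := hp (ρ h γ)
  rw [hq] at h1
  have hmem : (Quotient.mk R γ).out ∈ Ω := by
    have := hΩ (p γ)⁻¹ γ hγ
    nth_rewrite 2 [← hp γ] at this
    rw [← Equiv.Perm.mul_apply, ← map_mul] at this
    simpa using this
  have h2 : ρ ((h * p γ)⁻¹ * p (ρ h γ)) (Quotient.mk R γ).out = (Quotient.mk R γ).out := by
    rw [map_mul, Equiv.Perm.mul_apply, h1]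
    nth_rewrite 2 [← hp γ]
    rw [← Equiv.Perm.mul_apply, ← Equiv.Perm.mul_apply, ← map_mul, ← map_mul]
    simp
  exact (inv_mul_eq_one.mp (hfree _ _ hmem h2)).symm

/-- On vectors supported in `Ω`, translation by h carries the part over A to the part over hA.
Replacing the translate of ξ by ξ costs at most their distance. -/
theorem norm_restr_smul_le {p : Γ → H} (hp : ∀ h, ∀ γ ∈ Ω, p (ρ h γ) = h * p γ) (h : H)
    (A : Set H) (ξ : L2 Γ) (hξ : ∀ γ ∉ Ω, ξ γ = 0) :
    ‖restr (p ⁻¹' (h • A)) ξ‖ ≤ ‖restr (p ⁻¹' A) ξ‖ + ‖permOp (ρ h) ξ - ξ‖ := by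
  have h1 : restr (p ⁻¹' (h • A)) (permOp (ρ h) ξ) = permOp (ρ h) (restr (p ⁻¹' A) ξ) := by
    refine L2.ext fun γ => ?_
    rw [restr_apply, permOp_apply, restr_apply]
    by_cases hγ : (ρ h)⁻¹ γ ∈ Ω
    · have h2 := hp h _ hγ
      rw [show ρ h ((ρ h)⁻¹ γ) = γ from (ρ h).apply_symm_apply γ] at h2
      have h3 : γ ∈ p ⁻¹' (h • A) ↔ (ρ h)⁻¹ γ ∈ p ⁻¹' A := by
        rw [mem_preimage, mem_preimage, h2, ← smul_eq_mul, smul_mem_smul_set_iff]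
      by_cases h4 : (ρ h)⁻¹ γ ∈ p ⁻¹' A
      · rw [indicator_of_mem h4, indicator_of_mem (h3.mpr h4), permOp_apply]
      · rw [indicator_of_notMem h4, indicator_of_notMem (mt h3.mp h4)]
    · have h5 := hξ _ hγ
      rw [indicator_apply_eq_zero.mpr fun _ => by rw [permOp_apply, h5],
        indicator_apply_eq_zero.mpr fun _ => h5]
  calc ‖restr (p ⁻¹' (h • A)) ξ‖
      = ‖permOp (ρ h) (restr (p ⁻¹' A) ξ) - restr (p ⁻¹' (h • A)) (permOp (ρ h) ξ - ξ)‖ := by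
        rw [map_sub, h1, sub_sub_cancel]
    _ ≤ _ := (norm_sub_le _ _).trans
        (add_le_add (norm_permOp _ _).le (norm_restr_le _ _))

/-- A group with almost invariant unit vectors in `ℓ²` of a free action is amenable. -/
theorem isAmenableGroup_of_almost_invariant {p : Γ → H}
    (hp : ∀ h, ∀ γ ∈ Ω, p (ρ h γ) = h * p γ)
    (hinv : ∀ (E : Finset H) (δ : ℝ), 0 < δ → ∃ ξ : L2 Γ, ‖ξ‖ = 1 ∧ (∀ γ ∉ Ω, ξ γ = 0) ∧
      ∀ h ∈ E, ‖permOp (ρ h) ξ - ξ‖ ≤ δ) : IsAmenableGroup H := by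
  classical
  have hinv' : ∀ i : Finset H × ℕ, ∃ ξ : L2 Γ, ‖ξ‖ = 1 ∧ (∀ γ ∉ Ω, ξ γ = 0) ∧
      ∀ h ∈ i.1, ‖permOp (ρ h) ξ - ξ‖ ≤ 1 / ((i.2 : ℝ) + 1) := fun i => hinv i.1 _ (by positivity)
  choose ξ hξ1 hξΩ hξ using hinv'
  -- The vector with index (E, n) is moved by at most 1/(n+1) by each element of E; limits along an
  -- ultrafilter finer than `atTop` exist for all subsets of H at once.
  let F : Ultrafilter (Finset H × ℕ) := Ultrafilter.of atTop
  have hF : (F : Filter (Finset H × ℕ)) ≤ atTop := Ultrafilter.of_le _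
  have hlim : ∀ A : Set H, ∃ l, Tendsto (fun i => ‖restr (p ⁻¹' A) (ξ i)‖) F (𝓝 l) := by
    intro A
    obtain ⟨l, -, hl⟩ := (isCompact_Icc (a := (0 : ℝ)) (b := 1)).ultrafilter_le_nhds
      (F.map fun i => ‖restr (p ⁻¹' A) (ξ i)‖) (by
        refine le_principal_iff.mpr (Ultrafilter.mem_map.mpr (univ_mem' fun i => ?_))
        exact ⟨norm_nonneg _, (norm_restr_le _ _).trans (hξ1 i).le⟩)
    exact ⟨l, hl⟩
  choose Q hQ using hlim
  have hle : ∀ (h : H) A, Q (h • A) ≤ Q A := by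
    intro h A
    have h0 : Tendsto (fun i => ‖permOp (ρ h) (ξ i) - ξ i‖) F (𝓝 0) := by
      have h1 : Tendsto (fun i : Finset H × ℕ => 1 / ((i.2 : ℝ) + 1)) atTop (𝓝 0) :=
        tendsto_one_div_add_atTop_nhds_zero_nat.comp
          (tendsto_snd.mono_left prod_atTop_atTop_eq.ge)
      refine squeeze_zero' (.of_forall fun _ => norm_nonneg _) ?_ (h1.mono_left hF)
      refine hF ?_
      -- Beyond this index the finite set contains h, so the bound 1/(n+1) applies to h.
      filter_upwards [eventually_ge_atTop (({h}, 0) : Finset H × ℕ)] with i hi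
      exact hξ i h (hi.1 (Finset.mem_singleton_self h))
    have h2 := (hQ A).add h0
    rw [add_zero] at h2
    exact le_of_tendsto_of_tendsto' (hQ _) h2 fun i => norm_restr_smul_le hp h A (ξ i) (hξΩ i)
  have heq : ∀ (h : H) A, Q (h • A) = Q A := fun h A =>
    le_antisymm (hle h A) (by simpa using hle h⁻¹ (h • A))
  -- The mean is the square of the limit, because squared norms add over disjoint sets.
  refine ⟨fun A => ENNReal.ofReal (Q A ^ 2), ?_, fun s t hst => ?_, fun h A => ?_⟩
  · have : Q univ = 1 := tendsto_nhds_unique (hQ univ) (by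
      simp only [preimage_univ, restr_univ, hξ1]
      exact tendsto_const_nhds)
    simp [this]
  · dsimp only
    rw [← ENNReal.ofReal_add (sq_nonneg _) (sq_nonneg _)]
    congr 1
    refine tendsto_nhds_unique ((hQ (s ∪ t)).pow 2) ?_
    simp only [preimage_union, norm_restr_union (hst.preimage p)]
    exact ((hQ s).pow 2).add ((hQ t).pow 2)
  · dsimp only
    rw [heq]

/-- Spectral gap for a free action of a non-amenable group. -/
theorem exists_spectral_gap {p : Γ → H} (hp : ∀ h, ∀ γ ∈ Ω, p (ρ h γ) = h * p γ)
    (hH : ¬ IsAmenableGroup H) : ∃ (E : Finset H) (r : ℝ), E.Nonempty ∧ 0 ≤ r ∧ r < 1 ∧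
      ∀ ξ : L2 Γ, (∀ γ ∉ Ω, ξ γ = 0) → ‖∑ h ∈ E, permOp (ρ h) ξ‖ ≤ r * E.card * ‖ξ‖ := by
  classical
  by_contra! hcon
  refine hH (isAmenableGroup_of_almost_invariant hp fun E δ hδ => ?_)
  -- With the identity in the set, ξ itself is a summand and can be paired with each of its
  -- translates.
  set E' := insert 1 E with hE'
  have hN : (0 : ℝ) < E'.card := by
    exact_mod_cast Finset.card_pos.mpr (Finset.insert_nonempty _ _)
  -- Chosen so that 4c times the size of E' is δ², which is what the parallelogram law will produce.
  set c := δ ^ 2 / (4 * E'.card) with hc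
  have hc0 : 0 < c := by positivity
  obtain ⟨ξ, hξΩ, hξ⟩ := hcon E' (max (1 - c) 0) (Finset.insert_nonempty _ _) (le_max_right _ _)
    (max_lt (by linarith) one_pos)
  have hξ0 : ξ ≠ 0 := by
    rintro rfl
    simp at hξ
  have hn : 0 < ‖ξ‖ := norm_pos_iff.mpr hξ0
  have hr : (1 - c) * E'.card * ‖ξ‖ < ‖∑ h ∈ E', permOp (ρ h) ξ‖ := by
    refine lt_of_le_of_lt ?_ hξ
    gcongr
    exact le_max_left _ _
  refine ⟨((‖ξ‖⁻¹ : ℝ) : ℂ) • ξ, ?_, fun γ hγ => ?_, fun h hh => ?_⟩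
  · rw [norm_smul]
    simp [hn.ne']
  · rw [lp.coeFn_smul, Pi.smul_apply, hξΩ γ hγ, smul_zero]
  · rw [map_smul, ← smul_sub, norm_smul, Complex.norm_real, norm_inv, norm_norm,
      inv_mul_le_iff₀ hn]
    rcases eq_or_ne h 1 with rfl | h1
    · simp only [map_one, one_apply_eq_self, sub_self, norm_zero]
      positivity
    · have hsub : ({1, h} : Finset H) ⊆ E' := by
        intro x hx
        simp only [Finset.mem_insert, Finset.mem_singleton] at hx
        rcases hx with rfl | rfl
        · exact Finset.mem_insert_self _ _
        · exact Finset.mem_insert_of_mem hh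
      have hpair : ∑ x ∈ ({1, h} : Finset H), permOp (ρ x) ξ = ξ + permOp (ρ h) ξ := by
        rw [Finset.sum_pair h1.symm]
        simp
      have hcard : ((E' \ {1, h}).card : ℝ) = E'.card - 2 := by
        rw [Finset.card_sdiff_of_subset hsub, Nat.cast_sub (Finset.card_le_card hsub),
          Finset.card_pair h1.symm]
        simp
      -- The terms outside the pair contribute at most their number times the norm of ξ. Since the
      -- full sum is nearly maximal, the pair has nearly maximal norm 2‖ξ‖.
      have hrest : ‖∑ x ∈ E' \ {1, h}, permOp (ρ x) ξ‖ ≤ (E'.card - 2) * ‖ξ‖ := by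
        refine (norm_sum_le _ _).trans ?_
        simp only [norm_permOp, Finset.sum_const, nsmul_eq_mul, hcard, le_refl]
      have hx : (2 - c * E'.card) * ‖ξ‖ ≤ ‖ξ + permOp (ρ h) ξ‖ := by
        have := norm_add_le (∑ x ∈ E' \ {1, h}, permOp (ρ x) ξ)
          (∑ x ∈ ({1, h} : Finset H), permOp (ρ x) ξ)
        rw [Finset.sum_sdiff hsub, hpair] at this
        nlinarith
      have hpar := parallelogram_law_with_norm ℂ (permOp (ρ h) ξ) ξ
      rw [norm_permOp, add_comm (permOp (ρ h) ξ) ξ] at hpar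
      have hcN : 4 * (c * E'.card) = δ ^ 2 := by
        rw [hc]
        field_simp
      refine abs_le_of_sq_le_sq' ?_ (by positivity) |>.2
      -- The tangent line at 2‖ξ‖ bounds the square from below, so no sign condition on 2 - c|E'| is
      -- needed.
      have h4 : 4 * ‖ξ‖ * ((2 - c * E'.card) * ‖ξ‖) - 4 * ‖ξ‖ ^ 2 ≤ ‖ξ + permOp (ρ h) ξ‖ ^ 2 := by
        nlinarith [sq_nonneg (‖ξ + permOp (ρ h) ξ‖ - 2 * ‖ξ‖)]
      rw [mul_pow, ← hcN]
      nlinarith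

end Amenable

end ArrowGroupoid

/-! ### Norm-null averages over finite sets, from the spectral gap -/

namespace ArrowGroupoid

/-- Among the dyadic level sets of a function `N` with values below `2 ^ L`, one carries at least
the fraction `1 / L` of the mass. -/
theorem exists_level {ι : Type*} {N : ι →₀ ℕ} {L : ℕ} (hL : ∀ g, N g < 2 ^ L) (hN : N ≠ 0) :
    ∃ (i : ℕ) (A : Finset ι), A.Nonempty ∧ (∀ g ∈ A, 2 ^ i ≤ N g) ∧
      (N.sum fun _ c => c) ≤ L * (2 ^ i * A.card) := by
  classical
  -- Superlevel sets, so g lies in A i for every i up to log₂ N(g). The powers of two up to that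
  -- exponent add up to 2^(log₂ N(g) + 1) - 1, which is at least N(g).
  let A : ℕ → Finset ι := fun i => N.support.filter (fun g => 2 ^ i ≤ N g)
  have hsum : (N.sum fun _ c => c) ≤ ∑ i ∈ Finset.range L, 2 ^ i * (A i).card := by
    have h1 : ∀ i, 2 ^ i * (A i).card = ∑ g ∈ N.support, if 2 ^ i ≤ N g then 2 ^ i else 0 := by
      intro i
      rw [← Finset.sum_filter, Finset.sum_const, smul_eq_mul, mul_comm]
    simp_rw [h1]
    rw [Finset.sum_comm]
    refine Finset.sum_le_sum fun g hg => ?_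
    have hg0 : N g ≠ 0 := Finsupp.mem_support_iff.mp hg
    have h2 : Nat.log 2 (N g) < L := Nat.log_lt_of_lt_pow hg0 (hL g)
    rw [← Finset.sum_filter]
    have h3 : Finset.range (Nat.log 2 (N g) + 1) ⊆
        (Finset.range L).filter (fun i => 2 ^ i ≤ N g) := by
      intro i hi
      rw [Finset.mem_range] at hi
      rw [Finset.mem_filter, Finset.mem_range]
      exact ⟨by omega, (Nat.pow_le_pow_right two_pos (Nat.lt_succ_iff.mp hi)).trans
        (Nat.pow_log_le_self 2 hg0)⟩
    refine le_trans ?_ (Finset.sum_le_sum_of_subset h3)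
    have h4 := Nat.geomSum_eq (le_refl 2) (Nat.log 2 (N g) + 1)
    have h5 := Nat.lt_pow_succ_log_self one_lt_two (N g)
    simp only [Nat.succ_sub_succ_eq_sub, tsub_zero, Nat.div_one] at h4
    rw [h4]
    exact Nat.le_sub_one_of_lt h5
  have hpos : 0 < N.sum fun _ c => c := by
    obtain ⟨g, hg⟩ := Finsupp.support_nonempty_iff.mpr hN
    exact Finset.sum_pos (fun g hg => Nat.pos_of_ne_zero (Finsupp.mem_support_iff.mp hg)) ⟨g, hg⟩
  have hL0 : (Finset.range L).Nonempty := by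
    rw [Finset.nonempty_iff_ne_empty]
    intro h
    rw [h, Finset.sum_empty] at hsum
    omega
  obtain ⟨i, -, hi⟩ := Finset.exists_max_image (Finset.range L) (fun i => 2 ^ i * (A i).card) hL0
  have hle : (N.sum fun _ c => c) ≤ L * (2 ^ i * (A i).card) := by
    refine hsum.trans ((Finset.sum_le_card_nsmul _ _ _ hi).trans ?_)
    simp
  refine ⟨i, A i, ?_, fun g hg => (Finset.mem_filter.mp hg).2, hle⟩
  rw [Finset.nonempty_iff_ne_empty]
  intro h
  rw [h] at hle
  simp at hle
  omega

section Averages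

variable {Γ : Type u} {H : Type v} [Group H] {ρ : H →* Equiv.Perm Γ} {Ω : Set Γ}

/-- Invariance of `Ω` keeps the support condition after each application of the sum, so the estimate
can be iterated. -/
theorem norm_sum_permOp_pow_le (hΩ : ∀ h, ∀ γ ∈ Ω, ρ h γ ∈ Ω) {E : Finset H} {c : ℝ} (hc : 0 ≤ c)
    (hE : ∀ ξ : L2 Γ, (∀ γ ∉ Ω, ξ γ = 0) → ‖∑ h ∈ E, permOp (ρ h) ξ‖ ≤ c * ‖ξ‖) (n : ℕ)
    (ξ : L2 Γ) (hξ : ∀ γ ∉ Ω, ξ γ = 0) :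
    ‖((∑ h ∈ E, permOp (ρ h)) ^ n) ξ‖ ≤ c ^ n * ‖ξ‖ := by
  induction n generalizing ξ with
  | zero => simp
  | succ n ih =>
    rw [pow_succ, mul_apply_eq_comp]
    refine (ih _ fun γ hγ => ?_).trans ?_
    · rw [_root_.sum_apply, L2.sum_apply]
      refine Finset.sum_eq_zero fun h _ => ?_
      rw [permOp_apply]
      refine hξ _ fun h' => hγ ?_
      have := hΩ h _ h'
      rwa [show ρ h ((ρ h)⁻¹ γ) = γ from (ρ h).apply_symm_apply γ] at this
    · rw [pow_succ, mul_assoc, _root_.sum_apply]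
      gcongr
      exact hE ξ hξ

/-- If `N` dominates `m` times the characteristic function of `A`, then the norm of the sum of
the permutation operators over `A` is at most `1/m` times the norm of the operator given by `N`. -/
theorem norm_sum_permOp_le_of_le {N : H →₀ ℕ} {A : Finset H} {m : ℕ} (hA : ∀ g ∈ A, m ≤ N g)
    (ξ : L2 Γ) :
    m * ‖∑ g ∈ A, permOp (ρ g) ξ‖ ≤ ‖N.sum fun g c => c • permOp (ρ g) (absL2 ξ)‖ := by
  classical
  rw [← Complex.norm_natCast, ← norm_smul]
  refine L2.norm_mono fun γ => ?_
  have h1 : (N.sum fun g c => c • permOp (ρ g) (absL2 ξ)) γ =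
      ((∑ g ∈ N.support, N g * ‖ξ ((ρ g)⁻¹ γ)‖ : ℝ) : ℂ) := by
    rw [Finsupp.sum, L2.sum_apply]
    push_cast
    refine Finset.sum_congr rfl fun g _ => ?_
    change N g • permOp (ρ g) (absL2 ξ) γ = _
    rw [permOp_apply, absL2_apply, nsmul_eq_mul]
  rw [h1, Complex.norm_real, Real.norm_of_nonneg (by positivity), lp.coeFn_smul, Pi.smul_apply,
    norm_smul, Complex.norm_natCast, L2.sum_apply]
  rcases Nat.eq_zero_or_pos m with rfl | hm
  · simp only [Nat.cast_zero, zero_mul]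
    positivity
  calc (m : ℝ) * ‖∑ g ∈ A, permOp (ρ g) ξ γ‖ ≤ m * ∑ g ∈ A, ‖ξ ((ρ g)⁻¹ γ)‖ := by
        gcongr
        refine (norm_sum_le _ _).trans (Finset.sum_le_sum fun g _ => ?_)
        rw [permOp_apply]
    _ = ∑ g ∈ A, m * ‖ξ ((ρ g)⁻¹ γ)‖ := Finset.mul_sum _ _ _
    _ ≤ ∑ g ∈ A, N g * ‖ξ ((ρ g)⁻¹ γ)‖ := by
        refine Finset.sum_le_sum fun g hg => ?_
        gcongr
        exact_mod_cast hA g hg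
    _ ≤ ∑ g ∈ N.support, N g * ‖ξ ((ρ g)⁻¹ γ)‖ := by
        refine Finset.sum_le_sum_of_subset_of_nonneg (fun g hg => ?_) fun _ _ _ => by positivity
        exact Finsupp.mem_support_iff.mpr (by have := hA g hg; omega)

/-- In a free action of a non-amenable group `H`, the averages over suitable finite subsets of `H`
tend to zero in norm. -/
theorem exists_averages_tendsto_zero (hΩ : ∀ h, ∀ γ ∈ Ω, ρ h γ ∈ Ω)
    (hfree : ∀ h, ∀ γ ∈ Ω, ρ h γ = γ → h = 1) (hH : ¬ IsAmenableGroup H) :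
    ∃ (S : ℕ → Finset H) (c : ℕ → ℝ), (∀ n, (S n).Nonempty) ∧ (∀ n, 0 ≤ c n) ∧
      Tendsto c atTop (𝓝 0) ∧
      ∀ n, ∀ ξ : L2 Γ, (∀ γ ∉ Ω, ξ γ = 0) →
        ‖∑ h ∈ S n, permOp (ρ h) ξ‖ ≤ c n * (S n).card * ‖ξ‖ := by
  classical
  obtain ⟨p, hp⟩ := exists_equivariant_of_free hΩ hfree
  obtain ⟨E, r, hE, hr0, hr1, hgap⟩ := exists_spectral_gap hp hH
  set k := E.card with hk
  have hk0 : 0 < k := Finset.card_pos.mpr hE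
  have main : ∀ n : ℕ, ∃ A : Finset H, A.Nonempty ∧ ∀ ξ : L2 Γ, (∀ γ ∉ Ω, ξ γ = 0) →
      ‖∑ h ∈ A, permOp (ρ h) ξ‖ ≤ (k * (n * r ^ n) + r ^ n) * A.card * ‖ξ‖ := by
    intro n
    -- The coefficient at g counts the words of length n over E with product g. Its image under the
    -- permutation representation is the n-th power of the operator sum, and its augmentation is
    -- k^n.
    let x : MonoidAlgebra ℕ H := (∑ h ∈ E, MonoidAlgebra.of ℕ H h) ^ n
    have hx : MonoidAlgebra.lift ℕ (L2 Γ →L[ℂ] L2 Γ) H (permOp.comp ρ) x =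
        (∑ h ∈ E, permOp (ρ h)) ^ n := by
      simp only [x, map_pow, map_sum, MonoidAlgebra.lift_of, MonoidHom.comp_apply]
    have hmass : (x.coeff.sum fun _ c => c) = k ^ n := by
      have h1 : MonoidAlgebra.lift ℕ ℕ H 1 x = k ^ n := by
        simp only [x, map_pow, map_sum, MonoidAlgebra.lift_of, MonoidHom.one_apply,
          Finset.sum_const, smul_eq_mul, mul_one, hk]
      rw [MonoidAlgebra.lift_apply] at h1
      simpa using h1
    have hx0 : x.coeff ≠ 0 := by
      intro h
      rw [h, Finsupp.sum_zero_index] at hmass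
      exact (pow_pos hk0 n).ne hmass
    -- From k < 2^k each coefficient is at most 2^(kn); the extra 1 makes the inequality strict. The
    -- number kn+1 of dyadic levels is only linear in n.
    have hlt : ∀ g, x.coeff g < 2 ^ (k * n + 1) := by
      intro g
      have h1 : x.coeff g ≤ k ^ n := by
        rw [← hmass]
        by_cases hg : g ∈ x.coeff.support
        · exact Finset.single_le_sum (f := fun g => x.coeff g) (fun _ _ => Nat.zero_le _) hg
        · rw [Finsupp.notMem_support_iff.mp hg]
          exact Nat.zero_le _
      refine h1.trans_lt ((Nat.pow_le_pow_left Nat.lt_two_pow_self.le n).trans_lt ?_)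
      rw [← pow_mul]
      exact Nat.pow_lt_pow_right one_lt_two (Nat.lt_succ_self _)
    obtain ⟨i, A, hA, hAi, hmassA⟩ := exists_level hlt hx0
    refine ⟨A, hA, fun ξ hξ => ?_⟩
    have h1 := norm_sum_permOp_le_of_le (ρ := ρ) hAi ξ
    have h2 : (x.coeff.sum fun g c => c • permOp (ρ g) (absL2 ξ)) =
        ((∑ h ∈ E, permOp (ρ h)) ^ n) (absL2 ξ) := by
      rw [← hx, MonoidAlgebra.lift_apply, Finsupp.sum, Finsupp.sum, _root_.sum_apply]
      rfl
    have h3 := norm_sum_permOp_pow_le hΩ (c := r * k) (by positivity) hgap n (absL2 ξ)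
      (fun γ hγ => by rw [absL2_apply, hξ γ hγ]; simp)
    rw [← h2, norm_absL2] at h3
    have h4 : (k : ℝ) ^ n ≤ (k * n + 1) * (2 ^ i * A.card) := by
      rw [hmass] at hmassA
      exact_mod_cast hmassA
    have h5 : (2 : ℝ) ^ i * ‖∑ g ∈ A, permOp (ρ g) ξ‖ ≤ r ^ n * k ^ n * ‖ξ‖ := by
      rw [← mul_pow]
      refine le_trans ?_ (h1.trans h3)
      push_cast
      exact le_rfl
    -- The level set satisfies k^n ≤ (kn+1)·2^i·|A|, so after cancelling 2^i only (kn+1)rⁿ|A|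
    -- remains, and (kn+1)rⁿ tends to 0.
    have h6 : (2 : ℝ) ^ i * ‖∑ g ∈ A, permOp (ρ g) ξ‖ ≤
        2 ^ i * ((k * (n * r ^ n) + r ^ n) * A.card * ‖ξ‖) := by
      refine h5.trans ?_
      calc r ^ n * (k : ℝ) ^ n * ‖ξ‖ ≤ r ^ n * ((k * n + 1) * (2 ^ i * A.card)) * ‖ξ‖ := by gcongr
        _ = _ := by ring
    exact le_of_mul_le_mul_left h6 (by positivity)
  choose S hS hSξ using main
  refine ⟨S, fun n => k * (n * r ^ n) + r ^ n, hS, fun n => by positivity, ?_, hSξ⟩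
  have h1 := tendsto_self_mul_const_pow_of_lt_one hr0 hr1
  have h2 := tendsto_pow_atTop_nhds_zero_of_lt_one hr0 hr1
  simpa using (h1.const_mul (k : ℝ)).add h2

end Averages

end ArrowGroupoid

/-! ### The regular representation -/

namespace ArrowGroupoid

section Regular

variable {Γ : Type u}

theorem delta_self (γ : Γ) : (delta γ : L2 Γ) γ = 1 := by simp [delta]

theorem delta_ne {γ η : Γ} (h : η ≠ γ) : (delta γ : L2 Γ) η = 0 := by simp [delta, h]

theorem norm_delta (γ : Γ) : ‖(delta γ : L2 Γ)‖ = 1 := by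
  classical
  rw [delta, lp.norm_single two_pos, norm_one]

theorem permOp_delta (σ : Equiv.Perm Γ) (γ : Γ) : permOp σ (delta γ) = delta (σ γ) := by
  refine L2.ext fun η => ?_
  rw [permOp_apply]
  by_cases h : η = σ γ
  · subst h
    rw [delta_self, show σ⁻¹ (σ γ) = γ from σ.symm_apply_apply γ, delta_self]
  · rw [delta_ne h, delta_ne]
    rintro rfl
    exact h (σ.apply_symm_apply η).symm

theorem restr_delta_of_mem {s : Set Γ} {γ : Γ} (h : γ ∈ s) : restr s (delta γ) = delta γ := by
  refine L2.ext fun η => ?_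
  rw [restr_apply]
  by_cases hη : η = γ
  · subst hη
    rw [indicator_of_mem h]
  · rw [delta_ne hη]
    exact indicator_apply_eq_zero.mpr fun _ => delta_ne hη

theorem restr_delta_of_notMem {s : Set Γ} {γ : Γ} (h : γ ∉ s) : restr s (delta γ) = 0 := by
  refine L2.ext fun η => ?_
  rw [restr_apply]
  refine indicator_apply_eq_zero.mpr fun hη => delta_ne ?_
  rintro rfl
  exact h hη

/-- Bounded operators on `ℓ²` are determined by their values on the basis vectors. -/
theorem clm_ext_delta {T T' : L2 Γ →L[ℂ] L2 Γ} (h : ∀ γ, T (delta γ) = T' (delta γ)) :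
    T = T' := by
  classical
  refine lp.ext_continuousLinearMap (by norm_num) fun γ => ?_
  ext1
  have := h γ
  simp only [delta] at this
  rw [ContinuousLinearMap.comp_apply, ContinuousLinearMap.comp_apply,
    lp.singleContinuousLinearMap_apply]
  convert this

/-- This turns convergence in the reduced norm into uniform convergence of functions on the
groupoid. -/
theorem norm_jMap_le [ArrowGroupoid Γ] (T : L2 Γ →L[ℂ] L2 Γ) (γ : Γ) : ‖jMap T γ‖ ≤ ‖T‖ := by
  refine (lp.norm_apply_le_norm two_ne_zero _ γ).trans ((T.le_opNorm _).trans ?_)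
  rw [norm_delta, mul_one]

variable [ArrowGroupoid Γ]

theorem IsRegularRep.unique {f : Γ → ℂ} {T T' : L2 Γ →L[ℂ] L2 Γ} (hT : IsRegularRep f T)
    (hT' : IsRegularRep f T') : T = T' := by
  refine clm_ext_delta fun γ => L2.ext fun η => ?_
  by_cases h : src η = src γ
  · rw [(hT γ η).1 (src_eq_rng_inv h), (hT' γ η).1 (src_eq_rng_inv h)]
  · rw [(hT γ η).2 h, (hT' γ η).2 h]

theorem IsRegularRep.regularRep_eq {f : Γ → ℂ} {T : L2 Γ →L[ℂ] L2 Γ} (hT : IsRegularRep f T) :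
    regularRep f = T := by
  have h : ∃ T, IsRegularRep f T := ⟨T, hT⟩
  rw [regularRep, dif_pos h]
  exact h.choose_spec.unique hT

theorem IsRegularRep.add {f g : Γ → ℂ} {T T' : L2 Γ →L[ℂ] L2 Γ} (hT : IsRegularRep f T)
    (hT' : IsRegularRep g T') : IsRegularRep (f + g) (T + T') := fun γ η =>
  ⟨fun h => congrArg₂ (· + ·) ((hT γ η).1 h) ((hT' γ η).1 h),
    fun h => (congrArg₂ (· + ·) ((hT γ η).2 h) ((hT' γ η).2 h)).trans (add_zero _)⟩

theorem IsRegularRep.smul {f : Γ → ℂ} {T : L2 Γ →L[ℂ] L2 Γ} (hT : IsRegularRep f T) (a : ℂ) :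
    IsRegularRep (a • f) (a • T) := fun γ η =>
  ⟨fun h => congrArg (a * ·) ((hT γ η).1 h),
    fun h => (congrArg (a * ·) ((hT γ η).2 h)).trans (mul_zero _)⟩

theorem isRegularRep_zero : IsRegularRep (0 : Γ → ℂ) 0 := fun _ _ =>
  ⟨fun _ => rfl, fun _ => rfl⟩

theorem IsRegularRep.sub {f g : Γ → ℂ} {T T' : L2 Γ →L[ℂ] L2 Γ} (hT : IsRegularRep f T)
    (hT' : IsRegularRep g T') : IsRegularRep (f - g) (T - T') := by
  have := hT.add (hT'.smul (-1))
  simpa [sub_eq_add_neg] using this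

theorem IsRegularRep.sum {ι : Type*} {s : Finset ι} {f : ι → Γ → ℂ} {T : ι → L2 Γ →L[ℂ] L2 Γ}
    (h : ∀ i ∈ s, IsRegularRep (f i) (T i)) : IsRegularRep (∑ i ∈ s, f i) (∑ i ∈ s, T i) := by
  classical
  induction s using Finset.induction_on with
  | empty => exact isRegularRep_zero
  | insert i s hi ih =>
    rw [Finset.sum_insert hi, Finset.sum_insert hi]
    exact (h i (Finset.mem_insert_self _ _)).add
      (ih fun j hj => h j (Finset.mem_insert_of_mem hj))

theorem inv_src (γ : Γ) : inv (src γ) = src γ := by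
  have h1 : src (inv (src γ)) = src γ := by rw [src_inv, rng_src]
  have h2 : src (inv (src γ)) = rng (src γ) := by rw [src_inv]
  have h3 := inv_mul_self (src γ) h2
  rw [src_src] at h3
  have : ∀ x (hx : x = src (inv (src γ))) (h : src (inv (src γ)) = rng x),
      mul (inv (src γ)) x h = inv (src γ) := by
    rintro x rfl h
    exact mul_unit _ h
  rw [← this (src γ) h1.symm h2, h3]

theorem IsRegularRep.jMap_eq {f : Γ → ℂ} {T : L2 Γ →L[ℂ] L2 Γ} (hT : IsRegularRep f T) :
    jMap T = f := by
  funext γ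
  have h : src γ = rng (inv (src γ)) := src_eq_rng_inv (src_src γ).symm
  rw [jMap, (hT (src γ) γ).1 h]
  congr 1
  have : ∀ x (hx : x = src γ) (h : src γ = rng x), mul γ x h = γ := by
    rintro x rfl h
    exact mul_unit _ h
  exact this _ (inv_src γ) h

variable [TopologicalSpace Γ]

theorem steinbergAlg_le_contAlg : steinbergAlg Γ ≤ contAlg Γ := by
  refine Submodule.span_mono ?_
  rintro _ ⟨U, hU, hUc, hUb, rfl⟩
  have h1 : (fun γ : U => U.indicator (1 : Γ → ℂ) γ) = fun _ => 1 :=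
    funext fun γ => indicator_of_mem γ.2 _
  refine ⟨U, hU, hUb, ?_, ?_, fun γ hγ => indicator_of_notMem hγ _⟩
  · rw [h1]
    exact continuous_const
  -- Compact support is meant inside U, so it does not matter that a compact U need not be closed in
  -- a non-Hausdorff groupoid.
  · have : CompactSpace U := isCompact_iff_compactSpace.mp hUc
    exact isClosed_closure.isCompact

theorem jMap_regularRep {f : Γ → ℂ} (hf : f ∈ contAlg Γ) : jMap (regularRep f) = f :=
  (isRegularRep_regularRep hf).jMap_eq

theorem steinbergSingularIdeal_subset : steinbergSingularIdeal Γ ⊆ algSingularIdeal Γ :=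
  inter_subset_inter_right _ (image_mono steinbergAlg_le_contAlg)

/-- Elements of the closure of the algebraic singular ideal are uniform limits of singular
functions in `𝒞(Γ)`. -/
theorem exists_tendstoUniformly_of_mem_closure {T : L2 Γ →L[ℂ] L2 Γ}
    (hT : T ∈ closure (algSingularIdeal Γ)) :
    ∃ f : ℕ → Γ → ℂ, (∀ n, f n ∈ contAlg Γ ∧ IsSingular (f n)) ∧
      TendstoUniformly f (jMap T) atTop := by
  obtain ⟨u, hu, hlim⟩ := mem_closure_iff_seq_limit.mp hT
  refine ⟨fun n => jMap (u n), fun n => ?_, ?_⟩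
  · obtain ⟨⟨_, h1⟩, f, hf, hfu⟩ := hu n
    refine ⟨?_, h1⟩
    have h2 : jMap (u n) = f := by rw [← hfu, jMap_regularRep hf]
    exact (congrArg (· ∈ contAlg Γ) h2).mpr hf
  · rw [Metric.tendstoUniformly_iff]
    intro ε hε
    filter_upwards [Metric.tendsto_nhds.mp hlim ε hε] with n hn γ
    rw [dist_comm, dist_eq_norm]
    rw [dist_eq_norm] at hn
    exact (norm_jMap_le (u n - T) γ).trans_lt hn

end Regular

end ArrowGroupoid

/-! ### The action of the group on its groupoid of germs -/

namespace SelfSimilarAction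

open Word Elt ArrowGroupoid

variable {G : Type u} {X : Type v} [Group G] [SelfSimilarAction G X]

/-- The product `g (α h β*) = g(α) (g|_α h) β*`. -/
def Elt.leftMul (g : G) (t : Elt G X) : Elt G X := ⟨lact g t.pre, lsec g t.pre * t.mid, t.suf⟩

theorem Elt.Maps.leftMul {t : Elt G X} {γ μ : List X} {k : G} (h : t.Maps γ μ k) (g : G) :
    (t.leftMul g).Maps γ (lact g μ) (lsec g μ * k) := by
  obtain ⟨γ', rfl, rfl, rfl⟩ := h
  exact ⟨γ', rfl, by simp [Elt.leftMul, lact_append, lact_mul],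
    by simp [Elt.leftMul, lsec_append, lsec_mul]⟩

namespace Germ

instance : MulAction G (Germ G X) where
  smul g := Quotient.lift (fun p => mk (p.1.1.leftMul g) p.1.2 p.2) (by
    intro p q h
    obtain ⟨hw, γ, μ, k, hγ, h1, h2⟩ := germRel_iff.mp h
    exact mk_eq_iff.mpr ⟨hw, γ, _, _, hγ, h1.leftMul g, h2.leftMul g⟩)
  one_smul := ind fun t w hw => by
    change mk (t.leftMul 1) w hw = mk t w hw
    simp [Elt.leftMul, lact_one, lsec_one]
  mul_smul g h := ind fun t w hw => by
    change mk (t.leftMul (g * h)) w hw = mk ((t.leftMul h).leftMul g) w hw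
    simp [Elt.leftMul, lact_mul, lsec_mul, mul_assoc]

theorem smul_mk (g : G) (t : Elt G X) (w : Word X) (hw : w ∈ D t.suf) :
    g • mk t w hw = mk (t.leftMul g) w hw := rfl

theorem srcWord_smul (g : G) (a : Germ G X) : srcWord (g • a) = srcWord a := by
  induction a using ind with
  | h t w hw => rfl

theorem rngWord_smul (g : G) (a : Germ G X) : rngWord (g • a) = wact g (rngWord a) := by
  induction a using ind with
  | h t w hw =>
    change (t.leftMul g).act w = wact g (t.act w)
    rw [act, act, wact_prepend, Elt.leftMul, wact_mul]

theorem smul_unit (g : G) (w : Word X) : g • (unit w : Germ G X) = mk (ofGroup g) w ⟨w, rfl⟩ := by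
  have h : (ofGroup 1 : Elt G X).leftMul g = ofGroup g := by
    simp [Elt.leftMul, ofGroup, lact, lsec]
  change mk ((ofGroup 1 : Elt G X).leftMul g) w ⟨w, rfl⟩ = _
  simp only [h]

/-- Identifies the action on representatives with left multiplication by the germ of g at the range
of a. -/
theorem mul_ofGroup (g : G) (a : Germ G X) : mul (g • unit (rngWord a)) a = g • a := by
  induction a using ind with
  | h t w hw =>
    rw [smul_unit, smul_mk]
    exact mul_mk rfl (by simp [Elt.mul, ofGroup, Elt.leftMul]) _

theorem smul_mul (g : G) {a b : Germ G X} (h : src a = rng b) : mul (g • a) b = g • mul a b := by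
  have h1 : src (g • unit (rngWord a) : Germ G X) = rng a := by
    rw [smul_unit]
    rfl
  rw [← mul_ofGroup, ← mul_ofGroup g (mul a b)]
  have h2 : rngWord (mul a b) = rngWord a := unit_inj.mp (rng_mul a b h)
  rw [h2]
  refine assoc (g • unit (rngWord a)) a b h1 h ?_ ?_
  · exact (src_mul _ a h1).trans h
  · exact h1.trans (rng_mul a b h).symm

theorem mem_bisection_ofGroup {g : G} {U : Set (Word X)} {a : Germ G X} :
    a ∈ bisection (ofGroup g) U ↔ srcWord a ∈ U ∧ a = g • unit (srcWord a) := by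
  constructor
  · rintro ⟨w, hw, hU, rfl⟩
    exact ⟨hU, (smul_unit g w).symm⟩
  · rintro ⟨hU, h⟩
    exact ⟨srcWord a, ⟨_, rfl⟩, hU, h.trans (smul_unit g _)⟩

/-- The arrow ηγ⁻¹ lies in (g, D(ε)) exactly when η = gγ. The regular representation thus becomes a
permutation representation, to which the averaging results apply. -/
theorem isRegularRep_indicator_bisection (g : G) :
    IsRegularRep ((bisection (ofGroup g) (D [])).indicator 1 : Germ G X → ℂ)
      (permOp (MulAction.toPermHom G (Germ G X) g)) := by
  intro γ η
  rw [permOp_delta, MulAction.toPermHom_apply, MulAction.toPerm_apply]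
  refine ⟨fun h => ?_, fun h => delta_ne ?_⟩
  · have hsrc : srcWord (ArrowGroupoid.mul η (ArrowGroupoid.inv γ) h) = rngWord γ :=
      unit_inj.mp ((src_mul _ _ h).trans (src_inv γ))
    have key : ArrowGroupoid.mul η (ArrowGroupoid.inv γ) h ∈ bisection (ofGroup g) (D []) ↔
        η = g • γ := by
      rw [mem_bisection_ofGroup, hsrc, D_nil]
      constructor
      · rintro ⟨-, h1⟩
        have h2 : mul (mul η (ArrowGroupoid.inv γ)) γ = η := by
          have h3 := assoc η (ArrowGroupoid.inv γ) γ h (src_inv γ)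
            ((src_mul _ _ h).trans (src_inv γ))
            (h.trans (rng_mul (ArrowGroupoid.inv γ) γ (src_inv γ)).symm)
          have h4 : mul (ArrowGroupoid.inv γ) γ = src γ := inv_mul_self γ (src_inv γ)
          have h5 : src γ = src η := (h.trans (rng_inv γ)).symm
          refine h3.trans ?_
          change mul η (mul (ArrowGroupoid.inv γ) γ) = η
          rw [h4, h5]
          exact mul_unit η (rng_src η).symm
        rw [← h2]
        refine Eq.trans ?_ (mul_ofGroup g γ)
        exact congrArg (fun a => mul a γ) h1
      · rintro rfl
        refine ⟨trivial, ?_⟩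
        refine (smul_mul g (rng_inv γ).symm).trans (congrArg (g • ·) ?_)
        exact mul_inv_self γ (rng_inv γ).symm
    by_cases hη : η = g • γ
    · rw [indicator_of_mem (key.mpr hη)]
      subst hη
      exact delta_self _
    · rw [indicator_of_notMem (mt key.mp hη), delta_ne hη]
  · rintro rfl
    exact h (congrArg unit (srcWord_smul g γ))

theorem indicator_bisection_mem_steinbergAlg (g : G) :
    ((bisection (ofGroup g) (D [])).indicator 1 : Germ G X → ℂ) ∈ steinbergAlg (Germ G X) := by
  refine Submodule.subset_span ⟨_, ?_, ?_, ?_, rfl⟩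
  all_goals rw [show bisection (ofGroup g) (D []) = chart (X := X) (ofGroup g) '' D [] by
    rw [chart_image, prepend_image_D]; rfl]
  · exact (isOpenEmbedding_chart _).isOpenMap _ (isOpen_D _)
  · exact isCompact_chart_image _ (isBasic_D _)
  · exact isBisection_chart_image _ _

end Germ

end SelfSimilarAction

/-! ### Minimality, effectiveness and limits along distinct letters -/

namespace SelfSimilarAction

open Word Elt ArrowGroupoid

namespace Word

variable {X : Type v}

theorem eq_nil_or_exists_mem_D (w : Word X) : w = fin [] ∨ ∃ x, w ∈ D [x] := by
  cases w with
  | fin l =>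
    cases l with
    | nil => exact Or.inl rfl
    | cons x l => exact Or.inr ⟨x, fin_mem_D.mpr ⟨l, rfl⟩⟩
  | inf w => exact Or.inr ⟨w 0, inf_mem_D.mpr rfl⟩

theorem eq_of_mem_D_singleton {x y : X} {w : Word X} (hx : w ∈ D [x]) (hy : w ∈ D [y]) :
    x = y := by
  rcases prefix_total hx hy with h | h
  · exact (List.cons_prefix_cons.mp h).1
  · exact (List.cons_prefix_cons.mp h).1.symm

theorem eq_nil_of_mem_D {x y : X} (hxy : x ≠ y) {v w : Word X} (hv : v ∈ D [x]) (hw : w ∈ D [y])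
    {β : List X} (hv' : v ∈ D β) (hw' : w ∈ D β) : β = [] := by
  cases β with
  | nil => rfl
  | cons z β =>
    have hz : [z] <+: z :: β := ⟨β, rfl⟩
    exact (hxy ((eq_of_mem_D_singleton hv (mem_D_of_prefix hz hv')).trans
      (eq_of_mem_D_singleton hw (mem_D_of_prefix hz hw')).symm)).elim

/-- Only the finitely many letters that begin a removed word are lost. With an infinite alphabet
this drives minimality, effectiveness and all limits at the empty word. -/
theorem IsBasic.eventually_D_subset {U : Set (Word X)} (hU : IsBasic U) (hne : U.Nonempty) :
    ∃ α, U ⊆ D α ∧ fin α ∈ U ∧ ∀ᶠ x in cofinite, D (α ++ [x]) ⊆ U := by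
  obtain ⟨α, s, rfl, hα⟩ := fin_mem_of_isBasic hU hne
  refine ⟨α, sdiff_subset, hα, ?_⟩
  have hfin : {x : X | ∃ β ∈ s, [x] <+: β}.Finite := by
    have : {x : X | ∃ β ∈ s, [x] <+: β} = ⋃ β ∈ s, {x | [x] <+: β} := by
      ext x
      simp
    rw [this]
    refine s.finite_toSet.biUnion fun β _ => Set.Subsingleton.finite fun x hx y hy => ?_
    exact eq_of_mem_D_singleton (w := fin β) (fin_mem_D.mpr hx) (fin_mem_D.mpr hy)
  refine hfin.subset fun x hx => ?_
  by_contra hxs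
  refine hx fun w hw => ⟨mem_D_of_prefix (List.prefix_append _ _) hw, fun h => ?_⟩
  obtain ⟨β, hβ, hwβ⟩ := mem_iUnion₂.mp h
  rcases prefix_total hw hwβ with h | h
  · exact hxs ⟨β, hβ, (List.prefix_append_right_inj α).mp h⟩
  · have h1 := (List.prefix_append_right_inj α).mp h
    cases β with
    | nil => exact hα.2 (mem_iUnion₂.mpr ⟨[], hβ, by simpa using hα.1⟩)
    | cons y β =>
      obtain ⟨rfl, h2⟩ := List.cons_prefix_cons.mp h1
      exact hxs ⟨_, hβ, List.cons_prefix_cons.mpr ⟨rfl, List.nil_prefix⟩⟩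

/-- Words starting with pairwise distinct letters converge to the empty word. -/
theorem tendsto_nil {I : Type*} {x : I → X} (hx : Function.Injective x) {w : I → Word X}
    (hw : ∀ n, w n ∈ D [x n]) : Tendsto w cofinite (𝓝 (fin [])) := by
  refine isTopologicalBasis_isBasic.nhds_hasBasis.ge_iff.mpr ?_
  rintro U ⟨hU, hmem⟩
  obtain ⟨α, hUα, -, hev⟩ := hU.eventually_D_subset ⟨_, hmem⟩
  obtain rfl : α = [] := List.prefix_nil.mp (fin_mem_D.mp (hUα hmem))
  rw [Filter.mem_map]
  filter_upwards [hx.tendsto_cofinite.eventually hev] with n hn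
  exact hn (hw n)

end Word

namespace Germ

variable {G : Type u} {X : Type v} [Group G] [SelfSimilarAction G X]

theorem smul_unit_eq_chart (g : G) (w : Word X) : g • (unit w : Germ G X) = chart (ofGroup g) w :=
  smul_unit g w

theorem smul_unit_eq_iff {g g' : G} {w : Word X} :
    g • (unit w : Germ G X) = g' • unit w ↔
      ∃ γ, w ∈ D γ ∧ lact g γ = lact g' γ ∧ lsec g γ = lsec g' γ := by
  rw [smul_unit, smul_unit]
  refine mk_eq_iff.trans ⟨?_, ?_⟩
  · rintro ⟨-, γ, μ, k, hγ, ⟨γ', rfl, rfl, rfl⟩, ⟨γ'', h1, h2, h3⟩⟩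
    obtain rfl : γ = γ'' := h1
    exact ⟨γ, hγ, h2, h3⟩
  · rintro ⟨γ, hγ, h1, h2⟩
    exact ⟨rfl, γ, lact g γ, lsec g γ, hγ, ⟨γ, rfl, rfl, rfl⟩, ⟨γ, rfl, h1, h2⟩⟩

/-- The empty word has no prefix but itself, so its germs remember the whole group element. -/
theorem smul_unit_nil_inj {g g' : G} :
    g • (unit (fin []) : Germ G X) = g' • unit (fin []) ↔ g = g' := by
  refine ⟨fun h => ?_, fun h => h ▸ rfl⟩
  obtain ⟨γ, hγ, -, h2⟩ := smul_unit_eq_iff.mp h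
  obtain rfl : γ = [] := List.prefix_nil.mp (fin_mem_D.mp hγ)
  exact h2

theorem smul_unit_eq_of_letter {g g' : G} {x : X} {w : Word X} (hw : w ∈ D [x])
    (h1 : g • x = g' • x) (h2 : SelfSimilarAction.sec g x = SelfSimilarAction.sec g' x) :
    g • (unit w : Germ G X) = g' • unit w :=
  smul_unit_eq_iff.mpr ⟨[x], hw, congrArg (fun y => [y]) h1, h2⟩

theorem smul_letter_eq {g g' : G} {x : X} {w : Word X} (hw : w ∈ D [x])
    (h : g • (unit w : Germ G X) = g' • unit w) : g • x = g' • x := by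
  obtain ⟨γ, hγ, h1, h2⟩ := smul_unit_eq_iff.mp h
  cases γ with
  | nil => rw [show g = g' from h2]
  | cons y γ =>
    obtain rfl := eq_of_mem_D_singleton hw (mem_D_of_prefix ⟨γ, rfl⟩ hγ)
    exact (List.cons.inj h1).1

theorem smul_unit_fin_singleton_eq_iff {g g' : G} {x : X} :
    g • (unit (fin [x]) : Germ G X) = g' • unit (fin [x]) ↔
      g • x = g' • x ∧ SelfSimilarAction.sec g x = SelfSimilarAction.sec g' x := by
  have hx : fin [x] ∈ D [x] := fin_mem_D.mpr List.prefix_rfl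
  refine ⟨fun h => ⟨smul_letter_eq hx h, ?_⟩, fun h => smul_unit_eq_of_letter hx h.1 h.2⟩
  obtain ⟨γ, hγ, -, h2⟩ := smul_unit_eq_iff.mp h
  cases γ with
  | nil => rw [show g = g' from h2]
  | cons y γ =>
    obtain ⟨rfl, h3⟩ := List.cons_prefix_cons.mp (fin_mem_D.mp hγ)
    obtain rfl := List.prefix_nil.mp h3
    exact h2

/-- Cancelling the arrow a on the right shows that only its range matters. -/
theorem smul_eq_smul_iff {g g' : G} {a : Germ G X} :
    g • a = g' • a ↔ g • (unit (rngWord a) : Germ G X) = g' • unit (rngWord a) := by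
  constructor
  · intro h
    have key : ∀ g : G, mul (g • a) (ArrowGroupoid.inv a) = g • unit (rngWord a) := fun g =>
      (smul_mul g (rng_inv a).symm).trans
        (congrArg (g • ·) (mul_inv_self a (rng_inv a).symm))
    rw [← key, ← key, h]
  · intro h
    rw [← mul_ofGroup g a, ← mul_ofGroup g' a, h]

theorem rngWord_smul_unit (g : G) (w : Word X) : rngWord (g • (unit w : Germ G X)) = wact g w := by
  rw [rngWord_smul]
  exact congrArg _ (ofGroup_one_act w)

theorem wact_mem_D_singleton (g : G) {x : X} {w : Word X} (h : w ∈ D [x]) :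
    wact g w ∈ D [g • x] := by
  obtain ⟨v, rfl⟩ := h
  rw [wact_prepend]
  exact prepend_mem _ _

theorem tendsto_smul_unit_nil {I : Type*} {x : I → X} (hx : Function.Injective x)
    {w : I → Word X} (hw : ∀ n, w n ∈ D [x n]) (g : G) :
    Tendsto (fun n => g • (unit (w n) : Germ G X)) cofinite (𝓝 (g • unit (fin []))) := by
  simp_rw [smul_unit_eq_chart]
  exact ((continuous_chart _).tendsto _).comp (tendsto_nil hx hw)

theorem isOpen_units : IsOpen (units (Germ G X)) := by
  rw [units_eq_range, unit_eq_chart]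
  exact (isOpenEmbedding_chart _).isOpen_range

variable (G X) in
-- The orbit of w contains μw for every finite word μ, and every non-empty basic open set contains a
-- cylinder D(αx).
theorem isMinimal [Infinite X] : IsMinimal (Germ G X) := by
  intro a ha b hb
  rw [units_eq_range] at ha hb
  obtain ⟨w, rfl⟩ := ha
  obtain ⟨v, rfl⟩ := hb
  refine mem_closure_iff.mpr fun O hO hv => ?_
  obtain ⟨U, hU, hvU, hUO⟩ := isTopologicalBasis_isBasic.exists_subset_of_mem_open
    (show v ∈ unit ⁻¹' O from hv) (hO.preimage continuous_unit)
  obtain ⟨α, -, -, hev⟩ := hU.eventually_D_subset ⟨v, hvU⟩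
  obtain ⟨x, hx⟩ := hev.exists
  refine ⟨_, hUO (hx (prepend_mem _ w)), chart (ofWord (α ++ [x])) w, rfl, ?_⟩
  rw [rng_chart, ofWord, wact_one]

variable (G X) in
/-- The groupoid of germs is effective if a group element fixing all but finitely many letters is
trivial. -/
theorem isEffective (hfix : ∀ g : G, (∀ᶠ x : X in cofinite, g • x = x) → g = 1) :
    IsEffective (Germ G X) := by
  refine subset_antisymm (fun a ha => ?_) (isOpen_units.subset_interior_iff.mpr ?_)
  · obtain ⟨_, ⟨t, V, hV, rfl⟩, ⟨v, hv, rfl⟩, hsub⟩ :=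
      isTopologicalBasis_chart_image.exists_subset_of_mem_open ha isOpen_interior
    have hfixed : ∀ v ∈ V, prepend t.pre (wact t.mid v) = prepend t.suf v := by
      intro v hv
      have h1 : src (chart t v) = rng (chart t v) :=
        interior_subset (s := isotropy (Germ G X)) (hsub ⟨v, hv, rfl⟩)
      rw [src_chart, rng_chart] at h1
      exact (unit_inj.mp h1).symm
    obtain ⟨γ, hVγ, hγ, hev⟩ := hV.eventually_D_subset ⟨v, hv⟩
    -- Isotropy at the finite word γ itself identifies the prefixes.
    have hγ1 : t.pre ++ lact t.mid γ = t.suf ++ γ := by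
      have := hfixed _ hγ
      simpa only [wact, prepend_fin, Word.fin.injEq] using this
    -- Isotropy at γx, for all but finitely many letters x, shows that the section at γ fixes those
    -- letters.
    have hk : lsec t.mid γ = 1 := by
      refine hfix _ (hev.mono fun x hx => ?_)
      have := hfixed _ (hx (fin_mem_D.mpr List.prefix_rfl))
      simp only [wact, prepend_fin, Word.fin.injEq, lact_append, ← List.append_assoc] at this
      rw [hγ1] at this
      exact (List.cons.inj (List.append_cancel_left this)).1
    rw [units_eq_range]
    refine ⟨prepend t.suf v, ?_⟩
    refine mk_eq_iff.mpr ⟨rfl, t.suf ++ γ, t.suf ++ γ, 1, ?_, ofGroup_one_maps _,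
      ⟨γ, rfl, hγ1.symm, hk.symm⟩⟩
    rw [← prepend_image_D]
    exact ⟨v, hVγ hv, rfl⟩
  · rintro a ha
    rw [units_eq_range] at ha
    obtain ⟨w, rfl⟩ := ha
    exact congrArg unit (ofGroup_one_act w).symm

/-- A set of germs at words with at most one letter has empty interior. -/
theorem interior_eq_empty_of_srcWord [Infinite X] {A : Set (Germ G X)}
    (hA : ∀ a ∈ A, ∃ l : List X, l.length ≤ 1 ∧ srcWord a = fin l) : interior A = ∅ := by
  by_contra hne
  obtain ⟨a, ha⟩ := nonempty_iff_ne_empty.mpr hne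
  obtain ⟨_, ⟨t, V, hV, rfl⟩, ⟨v, hv, rfl⟩, hsub⟩ :=
    isTopologicalBasis_chart_image.exists_subset_of_mem_open ha isOpen_interior
  obtain ⟨γ, -, -, hev⟩ := hV.eventually_D_subset ⟨v, hv⟩
  obtain ⟨x, hx⟩ := hev.exists
  -- Two letters are appended to γ, so the word is too long for the assumption on A.
  have hmem : fin (γ ++ [x] ++ [x]) ∈ V := hx (fin_mem_D.mpr (List.prefix_append _ _))
  obtain ⟨l, hl, h⟩ := hA _ (interior_subset (hsub ⟨_, hmem, rfl⟩))
  change prepend t.suf (fin _) = _ at h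
  rw [prepend_fin, Word.fin.injEq] at h
  rw [← h] at hl
  simp at hl
  omega

/-- Near the empty word, the values of a function in `𝒞` at germs `[g₁, wₙ]`, for words `wₙ`
starting with pairwise distinct letters, tend to the sum of its values at the germs `[g, ε]` with
`[g, wₙ] = [g₁, wₙ]`. -/
theorem tendsto_of_mem_contAlg {I : Type*} {x : I → X} (hx : Function.Injective x)
    {w : I → Word X} (hw : ∀ n, w n ∈ D [x n]) {g₁ : G} {N : Set G}
    (hN : ∀ n g, g • (unit (w n) : Germ G X) = g₁ • unit (w n) ↔ g ∈ N)
    {f : Germ G X → ℂ} (hf : f ∈ contAlg (Germ G X)) :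
    (Function.support fun g : G => f (g • unit (fin []))).Finite ∧
      Tendsto (fun n => f (g₁ • unit (w n))) cofinite
        (𝓝 (∑ᶠ g ∈ N, f (g • unit (fin [])))) := by
  refine Submodule.span_induction ?_ ?_ ?_ ?_ hf
  · rintro f ⟨U, hUo, hUb, hcont, hsupp, h0⟩
    -- All germs [g, ε] share the source ε, and the source map is injective on the bisection, so at
    -- most one of them carries a nonzero value.
    have hinj : ∀ g g' : G, f (g • unit (fin [])) ≠ 0 → f (g' • unit (fin [])) ≠ 0 → g = g' := by
      intro g g' hg hg'
      have h1 := injOn_iff_injective.mpr hUb.1.injective (not_imp_comm.mp (h0 _) hg)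
        (not_imp_comm.mp (h0 _) hg') (congrArg unit (by rw [srcWord_smul, srcWord_smul]))
      exact smul_unit_nil_inj.mp h1
    refine ⟨Set.Subsingleton.finite fun g hg g' hg' => hinj g g' hg hg', ?_⟩
    by_cases hex : ∃ g₀ ∈ N, f (g₀ • unit (fin [])) ≠ 0
    · obtain ⟨g₀, hg₀N, hg₀⟩ := hex
      have hsum : ∑ᶠ g ∈ N, f (g • unit (fin [])) = f (g₀ • unit (fin [])) := by
        rw [← finsum_mem_inter_support, show N ∩ (Function.support fun g : G =>
          f (g • unit (fin []))) = {g₀} from ?_, finsum_mem_singleton]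
        exact subset_antisymm (fun g hg => hinj _ _ hg.2 hg₀)
          (singleton_subset_iff.mpr ⟨hg₀N, hg₀⟩)
      rw [hsum]
      -- The germs may be rewritten with g₀ in place of g₁; they then converge to [g₀, ε], where f
      -- is continuous.
      simp_rw [← (hN _ g₀).mpr hg₀N]
      have hU : g₀ • unit (fin []) ∈ U := not_imp_comm.mp (h0 _) hg₀
      have hc : ContinuousAt f (g₀ • unit (fin [])) :=
        (continuousOn_iff_continuous_domRestrict.mpr hcont).continuousAt (hUo.mem_nhds hU)
      exact hc.tendsto.comp (tendsto_smul_unit_nil hx hw g₀)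
    · push Not at hex
      rw [finsum_mem_eq_zero_of_forall_eq_zero hex, Metric.tendsto_nhds]
      intro ε hε
      by_contra hnot
      -- If the values do not tend to 0, infinitely many germs lie in a compact subset of U on which
      -- |f| ≥ ε, so they have a cluster point there. It will be shown to be some [g, ε] with g in
      -- N, where f vanishes.
      have hfreq : ∃ᶠ n in cofinite, g₁ • (unit (w n) : Germ G X) ∈
          Subtype.val '' (tsupport (fun γ : U => f γ) ∩ {γ : U | ε ≤ ‖f γ‖}) := by
        refine Filter.not_eventually.mp hnot |>.mono fun n hn => ?_
        rw [dist_zero_right, not_lt] at hn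
        have hne : f (g₁ • unit (w n)) ≠ 0 := norm_pos_iff.mp (hε.trans_le hn)
        have hU : g₁ • unit (w n) ∈ U := not_imp_comm.mp (h0 _) hne
        exact ⟨⟨_, hU⟩, ⟨subset_closure hne, hn⟩, rfl⟩
      have hcomp : IsCompact (Subtype.val '' (tsupport (fun γ : U => f γ) ∩
          {γ : U | ε ≤ ‖f γ‖})) :=
        (hsupp.isCompact.inter_right (isClosed_le continuous_const hcont.norm)).image
          continuous_subtype_val
      obtain ⟨_, ⟨⟨a, haU⟩, ⟨-, haε⟩, rfl⟩, hclus⟩ :=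
        hcomp.exists_mapClusterPt_of_frequently hfreq
      -- Every neighbourhood of the cluster point contains two of the germs with different first
      -- letters. This forces every prefix attached to the neighbourhood to be empty.
      have htwo : ∀ O : Set (Germ G X), IsOpen O → a ∈ O → ∃ n m, x n ≠ x m ∧
          g₁ • unit (w n) ∈ O ∧ g₁ • unit (w m) ∈ O := by
        intro O hO haO
        have h1 := hclus.frequently (hO.mem_nhds haO)
        obtain ⟨n, hn⟩ := h1.exists
        obtain ⟨m, hm, hmn⟩ := (h1.and_eventually (eventually_cofinite_ne n)).exists
        exact ⟨n, m, fun h => hmn (hx h).symm, hn, hm⟩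
      obtain ⟨t, v, rfl⟩ := exists_chart a
      obtain ⟨n, m, hnm, ⟨vn, hvn⟩, ⟨vm, hvm⟩⟩ := htwo _ (isOpenEmbedding_chart t).isOpen_range
        (mem_range_self v)
      have hsrc : ∀ n, srcWord (g₁ • unit (w n) : Germ G X) = w n := fun n => srcWord_smul _ _
      have hpre : ∀ n v, chart t v = g₁ • unit (w n) → wact g₁ (w n) ∈ D t.pre := by
        intro n v h
        rw [← rngWord_smul_unit, ← h]
        exact act_mem _ _
      have hsuf : ∀ n v, chart t v = g₁ • unit (w n) → w n ∈ D t.suf := by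
        intro n v h
        rw [← hsrc n, ← h]
        exact prepend_mem _ _
      have e1 : t.suf = [] := eq_nil_of_mem_D hnm (hw n) (hw m) (hsuf _ _ hvn) (hsuf _ _ hvm)
      have e2 : t.pre = [] := eq_nil_of_mem_D ((MulAction.injective g₁).ne hnm)
        (wact_mem_D_singleton g₁ (hw n)) (wact_mem_D_singleton g₁ (hw m))
        (hpre _ _ hvn) (hpre _ _ hvm)
      obtain ⟨pre, g, suf⟩ := t
      obtain rfl : suf = [] := e1
      obtain rfl : pre = [] := e2
      have hv : v = fin [] := by
        refine (eq_nil_or_exists_mem_D v).resolve_right ?_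
        rintro ⟨y, hy⟩
        obtain ⟨n, m, hnm, ⟨vn, hyn, hvn⟩, ⟨vm, hym, hvm⟩⟩ := htwo _
          ((isOpenEmbedding_chart ⟨[], g, []⟩).isOpenMap _ (isOpen_D [y])) (mem_image_of_mem _ hy)
        have e3 : ∀ n v, chart ⟨[], g, []⟩ v = g₁ • (unit (w n) : Germ G X) → v = w n := by
          intro n v h
          rw [← hsrc n, ← h]
          rfl
        rw [e3 _ _ hvn] at hyn
        rw [e3 _ _ hvm] at hym
        simpa using eq_nil_of_mem_D hnm (hw n) (hw m) hyn hym
      subst hv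
      -- The chart of g meets the family in [g, w_n] = [g₁, w_n], which is the defining condition of
      -- N.
      have hgN : g ∈ N := by
        have e4 : vn = w n := by
          rw [← hsrc n, ← hvn]
          rfl
        refine (hN n g).mp ?_
        rw [← hvn, e4]
        exact smul_unit g _
      have h5 : f (chart ⟨[], g, []⟩ (fin [])) = 0 := by
        rw [← hex g hgN, smul_unit_eq_chart]
        rfl
      have h6 : ε ≤ ‖f (chart ⟨[], g, []⟩ (fin []))‖ := haε
      rw [h5, norm_zero] at h6
      exact absurd h6 hε.not_ge
  · simpa using tendsto_const_nhds
  · rintro f g - - ⟨hf, hf'⟩ ⟨hg, hg'⟩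
    refine ⟨(hf.union hg).subset (Function.support_add _ _), ?_⟩
    simp only [Pi.add_apply]
    rw [finsum_mem_add_distrib' (hf.subset inter_subset_right) (hg.subset inter_subset_right)]
    exact hf'.add hg'
  · rintro c f - ⟨hf, hf'⟩
    refine ⟨hf.subset (Function.support_const_smul_subset c _), ?_⟩
    have h1 : ∑ᶠ g ∈ N, (c • f) (g • unit (fin [])) = c * ∑ᶠ g ∈ N, f (g • unit (fin [])) :=
      ((AddMonoidHom.mulLeft c).map_finsum_mem' (hf.subset inter_subset_right)).symm
    rw [h1]
    exact hf'.const_mul c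

/-- A singular function vanishes at some germ `[g, w]` with `w` in a given cylinder. -/
theorem exists_eq_zero_of_isSingular {f : Germ G X → ℂ} (hf : IsSingular f) (g : G)
    (α : List X) : ∃ w ∈ D α, f (g • unit w) = 0 := by
  by_contra! h
  have h1 : chart (ofGroup g) '' D α ⊆ interior (Function.support f) := by
    refine interior_maximal ?_ ((isOpenEmbedding_chart _).isOpenMap _ (isOpen_D α))
    rintro _ ⟨w, hw, rfl⟩
    rw [← smul_unit_eq_chart]
    exact h w hw
  rw [hf] at h1
  exact h1 (mem_image_of_mem _ (fin_mem_D.mpr (List.prefix_rfl (l := α))))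

end Germ

end SelfSimilarAction

/-! ### The example -/

namespace SingularExample

open SelfSimilarAction SelfSimilarAction.Word SelfSimilarAction.Germ ArrowGroupoid

section

variable {H : Type u}

theorem injective_y (i : Fin 2) : Function.Injective (Letter.y i : ℤ → Letter H) :=
  fun _ _ h => by simpa using h

theorem injective_z (i : Fin 2) : Function.Injective (Letter.z i : GrpK H → Letter H) :=
  fun _ _ h => by simpa using h

/-- The words whose first letter is in `Y`. -/
def wordsB (H : Type u) : Set (Word (Letter H)) := ⋃ (i : Fin 2) (n : ℤ), D [Letter.y i n]

theorem mem_wordsB {w : Word (Letter H)} : w ∈ wordsB H ↔ ∃ i n, w ∈ D [Letter.y i n] := by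
  simp [wordsB]

theorem notMem_wordsB {w : Word (Letter H)} (hw : w ∉ wordsB H) :
    w = fin [] ∨ ∃ i k, w ∈ D [Letter.z i k] := by
  refine (eq_nil_or_exists_mem_D w).imp_right ?_
  rintro ⟨x, hx⟩
  cases x with
  | y i n => exact (hw (mem_wordsB.mpr ⟨i, n, hx⟩)).elim
  | z i k => exact ⟨i, k, hx⟩

end

variable {H : Type u} [Group H]

theorem smul_y (g : GrpG H) (i : Fin 2) (n : ℤ) :
    g • (Letter.y i n : Letter H) = .y i (Multiplicative.toAdd (zeta i g) + n) := rfl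

theorem smul_z (g : GrpG H) (i : Fin 2) (k : GrpK H) :
    g • (Letter.z i k : Letter H) = .z i (proj i g * k) := rfl

theorem sec_y (g : GrpG H) (i : Fin 2) (n : ℤ) :
    SelfSimilarAction.sec g (Letter.y i n : Letter H) = tau g := rfl

theorem smul_y_eq_iff {g g' : GrpG H} {i : Fin 2} {n : ℤ} :
    g • (Letter.y i n : Letter H) = g' • Letter.y i n ↔ zeta i g = zeta i g' := by
  rw [smul_y, smul_y, Letter.y.injEq]
  simp

theorem smul_z_eq_iff {g g' : GrpG H} {i : Fin 2} {k : GrpK H} :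
    g • (Letter.z i k : Letter H) = g' • Letter.z i k ↔ proj i g = proj i g' := by
  rw [smul_z, smul_z, Letter.z.injEq]
  simp

instance : Infinite (Letter H) := Infinite.of_injective _ (injective_y 0)

instance : Infinite (GrpK H) := Infinite.of_injective
  (fun n : Multiplicative ℤ => ((1, 1, n) : GrpK H)) fun m n h => by simpa using h

variable (H) in
-- Fixing one letter z_k of each colour makes both projections to K trivial, because translations of
-- K are free; the two projections together separate G.
theorem isEffective_grpd : IsEffective (Grpd H) := by
  refine isEffective _ _ fun g hg => ?_
  have h : ∀ i, proj i g = 1 := by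
    intro i
    obtain ⟨k, hk⟩ := ((injective_z i).tendsto_cofinite.eventually hg).exists
    rw [smul_z, Letter.z.injEq] at hk
    simpa using hk
  have h0 := h 0
  have h1 := h 1
  simp only [proj, zeta, Prod.mk_eq_one] at h0 h1
  exact Prod.ext h0.1 (Prod.ext h0.2.1 (Prod.ext h0.2.2 h1.2.2))

variable (H) in
-- A generator of the second copy of ℤ fixes the letters y_n of colour 0 with trivial section, so
-- the units y_n converge both to [1, ε] and to the germ of this generator at ε.
theorem not_t2Space_grpd : ¬ T2Space (Grpd H) := by
  intro hT2
  let g : GrpG H := (1, 1, 1, Multiplicative.ofAdd 1)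
  have hw : ∀ n : ℤ, fin [Letter.y 0 n] ∈ D [(Letter.y 0 n : Letter H)] :=
    fun n => fin_mem_D.mpr List.prefix_rfl
  have h1 := tendsto_smul_unit_nil (injective_y (H := H) 0) hw g
  have h2 := tendsto_smul_unit_nil (injective_y (H := H) 0) hw (1 : GrpG H)
  have heq : ∀ n : ℤ, g • (unit (fin [Letter.y 0 n]) : Grpd H) = 
      (1 : GrpG H) • unit (fin [Letter.y 0 n]) := fun n =>
    smul_unit_fin_singleton_eq_iff.mpr ⟨smul_y_eq_iff.mpr rfl, by rw [sec_y, sec_y]; simp [tau, g]⟩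
  simp_rw [heq] at h1
  have h3 := smul_unit_nil_inj.mp (tendsto_nhds_unique h1 h2)
  simp [g] at h3

theorem wact_mem_wordsB (g : GrpG H) {w : Word (Letter H)} (hw : w ∈ wordsB H) :
    wact g w ∈ wordsB H := by
  obtain ⟨i, n, h⟩ := mem_wordsB.mp hw
  exact mem_wordsB.mpr ⟨i, _, wact_mem_D_singleton g h⟩

theorem mem_setB {a : Grpd H} : a ∈ setB H ↔ srcWord a ∈ wordsB H ∧ a = unit (srcWord a) := by
  rw [setB, mem_bisection_ofGroup, one_smul]
  rfl

open Classical in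
theorem chi_apply (g : GrpG H) (a : Grpd H) :
    chi g a = if a = g • unit (srcWord a) then 1 else 0 := by
  rw [chi, indicator_apply]
  simp only [mem_bisection_ofGroup, D_nil, mem_univ, true_and]
  rfl

theorem chi_congr {g g' : GrpG H} {a : Grpd H}
    (h : g • (unit (srcWord a) : Grpd H) = g' • unit (srcWord a)) : chi g a = chi g' a := by
  rw [chi_apply, chi_apply, h]

theorem chi_mem_steinbergAlg (g : GrpG H) : chi g ∈ steinbergAlg (Grpd H) :=
  indicator_bisection_mem_steinbergAlg g

theorem isRegularRep_chi (g : GrpG H) :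
    IsRegularRep (chi g) (permOp (MulAction.toPermHom (GrpG H) (Grpd H) g)) :=
  isRegularRep_indicator_bisection g

/-- The only factorization of γ with second factor in B is γ times its source. -/
theorem conv_chiB (f : Grpd H → ℂ) (γ : Grpd H) :
    conv f (chiB H) γ = {γ | srcWord γ ∈ wordsB H}.indicator f γ := by
  have hsrc : ∀ p : {p : Grpd H × Grpd H // ∃ h : src p.1 = rng p.2, ArrowGroupoid.mul p.1 p.2 h = γ},
      p.1.2 ∈ setB H → p.1 = (γ, src γ) ∧ srcWord γ ∈ wordsB H := by
    rintro ⟨⟨p, q⟩, h, hm⟩ hq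
    obtain ⟨h1, h2⟩ := mem_setB.mp hq
    change srcWord q ∈ wordsB H at h1
    change q = src q at h2
    have h3 : src q = src γ := (src_mul p q h).symm.trans (congrArg src hm)
    have h4 : q = src p := by rw [h, h2, rng_src]
    have h5 : ∀ x (hx : x = src p) (h : src p = rng x), ArrowGroupoid.mul p x h = p := by
      rintro x rfl h
      exact mul_unit _ h
    have h6 : srcWord q = srcWord γ := unit_inj.mp h3
    exact ⟨Prod.ext ((h5 q h4 h).symm.trans hm) (h2.trans h3), h6 ▸ h1⟩
  by_cases hγ : srcWord γ ∈ wordsB H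
  · have hc : src γ = rng (src γ) := (rng_src γ).symm
    rw [indicator_of_mem (show γ ∈ {γ | srcWord γ ∈ wordsB H} from hγ), conv,
      finsum_eq_single _ ⟨(γ, src γ), hc, mul_unit γ hc⟩]
    · have h : src γ ∈ setB H := mem_setB.mpr ⟨hγ, rfl⟩
      change f γ * chiB H (src γ) = f γ
      rw [chiB, indicator_of_mem h, Pi.one_apply, mul_one]
    · intro p hp
      rw [chiB, indicator_of_notMem, mul_zero]
      exact fun h => hp (Subtype.ext (hsrc p h).1)
  · rw [indicator_of_notMem (show γ ∉ {γ | srcWord γ ∈ wordsB H} from hγ)]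
    refine finsum_eq_zero_of_forall_eq_zero fun p => ?_
    rw [chiB, indicator_of_notMem, mul_zero]
    exact fun h => hγ (hsrc p h).2

/-! #### The function `a ∗ χ_B` is singular -/

/-- After a letter of Y only τ(g) is left to act, so g enters through ζ_i(g) and the action and
section of τ(g) at the second letter. -/
theorem smul_unit_eq_of_two_letters {g g' : GrpG H} {i : Fin 2} {n : ℤ} {x : Letter H}
    {w : Word (Letter H)} (hw : w ∈ D [Letter.y i n, x]) (h1 : zeta i g = zeta i g')
    (h2 : tau g • x = tau g' • x)
    (h3 : SelfSimilarAction.sec (tau g) x = SelfSimilarAction.sec (tau g') x) :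
    g • (unit w : Grpd H) = g' • unit w := by
  refine smul_unit_eq_iff.mpr ⟨_, hw, ?_, h3⟩
  simp only [lact, sec_y, h2, smul_y_eq_iff.mpr h1]

/-- The section τ(g) acts on x only through the coordinate given by the colour j of x, and its
section at x is trivial. For j = 0 the terms of 1 and b agree, as do those of a and ab; for j = 1
the roles of a and b are exchanged. -/
theorem funA_eq_zero {a : Grpd H} {i : Fin 2} {n : ℤ} {x : Letter H}
    (ha : srcWord a ∈ D [Letter.y i n, x]) : funA H a = 0 := by
  have key : ∀ g g' : GrpG H, zeta i g = zeta i g' → tau g • x = tau g' • x →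
      SelfSimilarAction.sec (tau g) x = SelfSimilarAction.sec (tau g') x → chi g a = chi g' a :=
    fun g g' h1 h2 h3 => chi_congr (smul_unit_eq_of_two_letters ha h1 h2 h3)
  have hsec : ∀ g g' : GrpG H,
      SelfSimilarAction.sec (tau g) x = SelfSimilarAction.sec (tau g') x := by
    intro g g'
    cases x with
    | y j m => simp [sec_y, tau]
    | z j k => rfl
  have hsmul : ∀ (g g' : GrpG H) (j : Fin 2), (∃ n, x = .y j n) ∨ (∃ k, x = .z j k) →
      zeta j (tau g) = zeta j (tau g') → tau g • x = tau g' • x := by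
    rintro g g' j (⟨m, rfl⟩ | ⟨k, rfl⟩) h
    · exact smul_y_eq_iff.mpr h
    · refine smul_z_eq_iff.mpr ?_
      rw [proj, proj, h]
      rfl
  have hx : ∃ j, (∃ n, x = .y j n) ∨ (∃ k, x = .z j k) := by
    cases x with
    | y j m => exact ⟨j, Or.inl ⟨m, rfl⟩⟩
    | z j k => exact ⟨j, Or.inr ⟨k, rfl⟩⟩
  obtain ⟨j, hj⟩ := hx
  have hzeta : ∀ u v : FreeGroup (Fin 2),
      zeta i ((1, u, 1, 1) : GrpG H) = zeta i ((1, v, 1, 1) : GrpG H) := by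
    intro u v
    fin_cases i <;> rfl
  have h1 : (1 : GrpG H) = (1, 1, 1, 1) := rfl
  simp only [funA, Pi.add_apply, Pi.sub_apply, h1]
  have hkey : ∀ u v : FreeGroup (Fin 2), expo j u = expo j v →
      chi ((1, u, 1, 1) : GrpG H) a = chi ((1, v, 1, 1) : GrpG H) a := by
    intro u v h
    refine key _ _ (hzeta u v) (hsmul _ _ j hj ?_) (hsec _ _)
    fin_cases j <;> exact h
  fin_cases j
  · rw [hkey (FreeGroup.of 1) 1 (by simp [expo]),
      hkey (FreeGroup.of 0 * FreeGroup.of 1) (FreeGroup.of 0) (by simp [expo])]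
    ring
  · rw [hkey (FreeGroup.of 0) 1 (by simp [expo]),
      hkey (FreeGroup.of 0 * FreeGroup.of 1) (FreeGroup.of 1) (by simp [expo])]
    ring

/-- At a one-letter word the germ still sees all of τ(g), and τ is nontrivial at a, b and ab, so
only the term of 1 contributes. -/
theorem funA_unit_y (n : ℤ) : funA H (unit (fin [Letter.y 0 n])) = 1 := by
  have h : ∀ u : FreeGroup (Fin 2), (expo 0 u ≠ 1 ∨ expo 1 u ≠ 1) →
      chi ((1, u, 1, 1) : GrpG H) (unit (fin [Letter.y 0 n])) = 0 := by
    intro u hu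
    rw [chi_apply, if_neg]
    intro h
    change unit (fin [Letter.y 0 n]) = _ • unit (fin [Letter.y 0 n]) at h
    rw [← one_smul (GrpG H) (unit (fin [Letter.y 0 n]) : Grpd H), smul_smul, mul_one,
      smul_unit_fin_singleton_eq_iff, sec_y, sec_y, map_one] at h
    have h2 := h.2
    simp only [tau, MonoidHom.coe_mk, OneHom.coe_mk] at h2
    have h3 := h2.symm
    simp only [Prod.mk_eq_one] at h3
    rcases hu with hu | hu
    · exact hu h3.2.2.1
    · exact hu h3.2.2.2
  have h1 : chi (1 : GrpG H) (unit (fin [Letter.y 0 n])) = 1 := by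
    rw [chi_apply, one_smul, if_pos]
    rfl
  simp only [funA, Pi.add_apply, Pi.sub_apply, h1]
  rw [h _ (by left; simp [expo]), h _ (by right; simp [expo]), h _ (by left; simp [expo])]
  ring

theorem isSingular_conv : IsSingular (conv (funA H) (chiB H)) := by
  refine interior_eq_empty_of_srcWord fun a ha => ?_
  rw [Function.mem_support, conv_chiB] at ha
  have hB : srcWord a ∈ wordsB H := by
    by_contra h
    exact ha (indicator_of_notMem (show a ∉ {γ | srcWord γ ∈ wordsB H} from h) _)
  rw [indicator_of_mem (show a ∈ {γ | srcWord γ ∈ wordsB H} from hB)] at ha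
  obtain ⟨i, n, v, hv⟩ := mem_wordsB.mp hB
  rcases eq_nil_or_exists_mem_D v with rfl | ⟨x, v', rfl⟩
  · exact ⟨[Letter.y i n], by simp, hv⟩
  · exact (ha (funA_eq_zero (i := i) (n := n) (x := x) ⟨v', hv⟩)).elim

theorem conv_unit_y (n : ℤ) : conv (funA H) (chiB H) (unit (fin [Letter.y 0 n])) = 1 := by
  rw [conv_chiB, indicator_of_mem, funA_unit_y]
  exact mem_wordsB.mpr ⟨0, n, fin_mem_D.mpr List.prefix_rfl⟩

/-! #### Singular functions in `𝒞` tend to zero at the units `y_n` -/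

/-- Germs over D(z_k) see exactly π_0(g). A singular function has a zero in each (g₁, D(z_k)), and
along these zeros its limit is the fibre sum. -/
theorem finsum_proj_eq_zero {f : Grpd H → ℂ} (hf : f ∈ contAlg (Grpd H)) (hs : IsSingular f)
    (κ : GrpK H) :
    (Function.support fun g : GrpG H => f (g • unit (fin []))).Finite ∧
      ∑ᶠ g ∈ {g : GrpG H | proj 0 g = κ}, f (g • unit (fin [])) = 0 := by
  let g₁ : GrpG H := (κ.1, κ.2.1, κ.2.2, 1)
  choose w hw hfw using fun k : GrpK H => exists_eq_zero_of_isSingular hs g₁ [Letter.z 0 k]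
  have hN : ∀ k (g : GrpG H), g • (unit (w k) : Grpd H) = g₁ • unit (w k) ↔
      g ∈ {g : GrpG H | proj 0 g = κ} := fun k g =>
    ⟨fun h => smul_z_eq_iff.mp (smul_letter_eq (hw k) h),
      fun h => smul_unit_eq_of_letter (hw k) (smul_z_eq_iff.mpr h) rfl⟩
  obtain ⟨h1, h2⟩ := tendsto_of_mem_contAlg (injective_z 0) hw hN hf
  refine ⟨h1, tendsto_nhds_unique h2 ?_⟩
  simp only [hfw]
  exact tendsto_const_nhds

/-- The limit is a sum over `N`, the elements whose germ at y_n is a unit. Since ζ_0 and τ both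
factor through π_0, this sum splits into fibre sums, which all vanish. -/
theorem tendsto_unit_y {f : Grpd H → ℂ} (hf : f ∈ contAlg (Grpd H)) (hs : IsSingular f) :
    Tendsto (fun n : ℤ => f (unit (fin [Letter.y 0 n]))) cofinite (𝓝 0) := by
  classical
  set N : Set (GrpG H) := {g | zeta 0 g = 1 ∧ tau g = 1} with hN
  obtain ⟨hfin, hlim⟩ := tendsto_of_mem_contAlg (injective_y (H := H) 0)
    (fun n => fin_mem_D.mpr (List.prefix_rfl (l := [Letter.y 0 n]))) (g₁ := 1) (N := N)
    (fun n g => by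
      rw [smul_unit_fin_singleton_eq_iff, smul_y_eq_iff, sec_y, sec_y, map_one, zeta_one]
      rfl) hf
  simp only [one_smul] at hlim
  convert hlim using 2
  symm
  rw [finsum_mem_eq_sum_filter _ _ hfin, ← Finset.sum_fiberwise_of_maps_to
    (g := proj 0) (t := (hfin.toFinset.filter (· ∈ N)).image (proj 0))
    fun g hg => Finset.mem_image_of_mem _ hg]
  refine Finset.sum_eq_zero fun κ hκ => ?_
  obtain ⟨g₀, hg₀, rfl⟩ := Finset.mem_image.mp hκ
  have h0 := (finsum_proj_eq_zero hf hs (proj 0 g₀)).2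
  rw [finsum_mem_eq_sum_filter _ _ hfin] at h0
  rw [Finset.filter_filter]
  -- A fibre of π_0 that meets `N` is contained in it, so the restriction to `N` does not change the
  -- fibre sum.
  refine Eq.trans (Finset.sum_congr (Finset.filter_congr fun g _ => ?_) fun _ _ => rfl) h0
  refine ⟨fun h => h.2, fun h => ⟨?_, h⟩⟩
  have hg₀N : zeta 0 g₀ = 1 ∧ tau g₀ = 1 := (Finset.mem_filter.mp hg₀).2
  have h' : proj 0 g = proj 0 g₀ := h
  simp only [proj, Prod.mk.injEq] at h'
  refine ⟨h'.2.2.trans hg₀N.1, Eq.trans ?_ hg₀N.2⟩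
  simp [tau, h'.2.1]

/-- At y_n the target has value 1, while each singular approximant tends to 0 there; a uniform error
below 1/2 is therefore impossible. -/
theorem not_tendstoUniformly_conv : ¬ ∃ f : ℕ → Grpd H → ℂ,
    (∀ n, f n ∈ contAlg (Grpd H) ∧ IsSingular (f n)) ∧
      TendstoUniformly f (conv (funA H) (chiB H)) atTop := by
  rintro ⟨f, hf, hlim⟩
  obtain ⟨m, hm⟩ := (Metric.tendstoUniformly_iff.mp hlim (1 / 2) (by norm_num)).exists
  obtain ⟨n, hn⟩ := (Metric.tendsto_nhds.mp (tendsto_unit_y (hf m).1 (hf m).2) (1 / 2)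
    (by norm_num)).exists
  have h1 := hm (unit (fin [Letter.y 0 n]))
  rw [conv_unit_y] at h1
  have h2 := dist_triangle (1 : ℂ) (f m (unit (fin [Letter.y 0 n]))) 0
  rw [dist_zero_right, norm_one] at h2
  linarith

end SingularExample

/-- The free group of rank two is not amenable. -/
theorem not_isAmenableGroup_freeGroup : ¬ IsAmenableGroup (FreeGroup (Fin 2)) := by
  rintro ⟨m, h1, hadd, hinv⟩
  have hmono : ∀ s t : Set (FreeGroup (Fin 2)), s ⊆ t → m s ≤ m t := by
    intro s t hst
    rw [← union_sdiff_cancel hst, hadd s (t \ s) disjoint_sdiff_right]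
    exact le_self_add
  have hpair : ∀ i : Fin 2,
      1 ≤ m (FreeGroup.startsWith (i, true)) + m (FreeGroup.startsWith (i, false)) := by
    intro i
    -- A reduced word that does not start with the generator starts with its inverse after left
    -- multiplication by that inverse. Thus two of the four disjoint pieces have total mean at least
    -- 1, and all four at least 2.
    have hcover : univ ⊆ FreeGroup.startsWith (i, true) ∪
        (FreeGroup.mk [(i, true)]) • FreeGroup.startsWith (i, false) := by
      intro g _
      by_cases hg : g ∈ FreeGroup.startsWith (i, true)
      · exact Or.inl hg
      · refine Or.inr (mem_smul_set_iff_inv_smul_mem.mpr ?_)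
        rw [smul_eq_mul, FreeGroup.inv_mk]
        exact FreeGroup.startsWith_mk_mul (w := (i, false)) g hg
    have hsub : ∀ s t : Set (FreeGroup (Fin 2)), m (s ∪ t) ≤ m s + m t := by
      intro s t
      rw [← union_sdiff_self, hadd s (t \ s) disjoint_sdiff_right]
      exact add_le_add le_rfl (hmono _ _ sdiff_subset)
    rw [← h1]
    exact (hmono _ _ hcover).trans ((hsub _ _).trans (by rw [hinv]))
  have hdisj : Disjoint
      (FreeGroup.startsWith ((0 : Fin 2), true) ∪ FreeGroup.startsWith ((0 : Fin 2), false))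
      (FreeGroup.startsWith ((1 : Fin 2), true) ∪ FreeGroup.startsWith ((1 : Fin 2), false)) := by
    simp [disjoint_union_left, disjoint_union_right]
  have h2 := hmono _ _ (subset_univ
    ((FreeGroup.startsWith ((0 : Fin 2), true) ∪ FreeGroup.startsWith ((0 : Fin 2), false)) ∪
      (FreeGroup.startsWith ((1 : Fin 2), true) ∪ FreeGroup.startsWith ((1 : Fin 2), false))))
  rw [hadd _ _ hdisj, hadd _ _ (by simp), hadd _ _ (by simp), h1] at h2
  have h3 := (add_le_add (hpair 0) (hpair 1)).trans h2
  norm_num at h3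

/-! ### The operators of χ_B and a ∗ χ_B -/

namespace SingularExample

open SelfSimilarAction SelfSimilarAction.Word SelfSimilarAction.Germ ArrowGroupoid

variable {H : Type u} [Group H]

variable (H) in
/-- The arrows whose range lies in `B`. -/
def arrowsB : Set (Grpd H) := {γ | rngWord γ ∈ wordsB H}

variable (H) in
/-- The action of `H` on the arrows of the groupoid by left multiplication. -/
def permH : H →* Equiv.Perm (Grpd H) :=
  (MulAction.toPermHom (GrpG H) (Grpd H)).comp (MonoidHom.inl H _)

theorem permH_apply (h : H) (γ : Grpd H) : permH H h γ = ((h, 1, 1, 1) : GrpG H) • γ := rfl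

theorem permH_mem_compl (h : H) {γ : Grpd H} (hγ : γ ∈ (arrowsB H)ᶜ) :
    permH H h γ ∈ (arrowsB H)ᶜ := by
  intro hmem
  refine hγ ?_
  have h1 : wact ((h, 1, 1, 1) : GrpG H)⁻¹ (rngWord (permH H h γ)) ∈ wordsB H :=
    wact_mem_wordsB _ hmem
  rw [permH_apply, rngWord_smul, ← wact_mul, inv_mul_cancel, wact_one] at h1
  exact h1

/-- The range is either empty, where germs determine the group element, or begins with a letter of
Z, where H acts by translation. -/
theorem eq_one_of_permH_apply_eq (h : H) {γ : Grpd H} (hγ : γ ∈ (arrowsB H)ᶜ)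
    (heq : permH H h γ = γ) : h = 1 := by
  have h1 : ((h, 1, 1, 1) : GrpG H) • γ = (1 : GrpG H) • γ := by
    rw [one_smul]
    exact heq
  rw [smul_eq_smul_iff] at h1
  rcases notMem_wordsB hγ with h2 | ⟨i, k, h2⟩
  · rw [h2, smul_unit_nil_inj] at h1
    exact congrArg Prod.fst h1
  · exact congrArg Prod.fst (smul_z_eq_iff.mp (smul_letter_eq h2 h1))

/-- Elements of H have trivial ζ_i and trivial τ, so over a first letter in Y they have the germ of
the identity. -/
theorem permH_apply_of_mem (h : H) {γ : Grpd H} (hγ : γ ∈ arrowsB H) : permH H h γ = γ := by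
  obtain ⟨i, n, hn⟩ := mem_wordsB.mp hγ
  have h1 : ((h, 1, 1, 1) : GrpG H) • γ = (1 : GrpG H) • γ :=
    smul_eq_smul_iff.mpr (smul_unit_eq_of_letter hn
      (smul_y_eq_iff.mpr (by fin_cases i <;> rfl)) (by rw [sec_y, sec_y]; simp [tau]))
  rwa [one_smul] at h1

theorem permOp_permH_restr (h : H) (ξ : L2 (Grpd H)) :
    permOp (permH H h) (restr (arrowsB H) ξ) = restr (arrowsB H) ξ := by
  refine L2.ext fun γ => ?_
  rw [permOp_apply, ← map_inv]
  by_cases hγ : γ ∈ arrowsB H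
  · rw [permH_apply_of_mem _ hγ]
  · rw [restr_apply, restr_apply, indicator_of_notMem hγ,
      indicator_of_notMem (permH_mem_compl h⁻¹ hγ)]

/-- The operator of the average over `S`. -/
noncomputable def averageOp (S : Finset H) : L2 (Grpd H) →L[ℂ] L2 (Grpd H) :=
  (S.card : ℂ)⁻¹ • ∑ h ∈ S, permOp (permH H h)

theorem isRegularRep_average (S : Finset H) : IsRegularRep (average S) (averageOp S) :=
  (IsRegularRep.sum fun h _ => isRegularRep_chi ((h, 1, 1, 1) : GrpG H)).smul _

theorem average_mem_steinbergAlg (S : Finset H) : average S ∈ steinbergAlg (Grpd H) :=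
  Submodule.smul_mem _ _ (Submodule.sum_mem _ fun _ _ => chi_mem_steinbergAlg _)

/-- The average is the identity on the part of ξ over B, so the difference is the average applied to
the part over the complement. -/
theorem norm_averageOp_sub_restr_le {S : Finset H} (hS : S.Nonempty) {c : ℝ} (hc : 0 ≤ c)
    (hSc : ∀ ξ : L2 (Grpd H), (∀ γ ∉ (arrowsB H)ᶜ, ξ γ = 0) →
      ‖∑ h ∈ S, permOp (permH H h) ξ‖ ≤ c * S.card * ‖ξ‖) :
    ‖averageOp S - restr (arrowsB H)‖ ≤ c := by
  have hcard : (0 : ℝ) < S.card := by exact_mod_cast hS.card_pos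
  have hcard' : (S.card : ℂ) ≠ 0 := by exact_mod_cast hcard.ne'
  refine ContinuousLinearMap.opNorm_le_bound _ hc fun ξ => ?_
  have h1 : (averageOp S - restr (arrowsB H)) ξ =
      (S.card : ℂ)⁻¹ • ∑ h ∈ S, permOp (permH H h) (restr (arrowsB H)ᶜ ξ) := by
    have h2 : ∑ h ∈ S, permOp (permH H h) ξ = (S.card : ℂ) • restr (arrowsB H) ξ +
        ∑ h ∈ S, permOp (permH H h) (restr (arrowsB H)ᶜ ξ) := by
      conv_lhs => rw [← restr_add_restr_compl (arrowsB H) ξ]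
      simp only [map_add, Finset.sum_add_distrib, permOp_permH_restr, Finset.sum_const,
        Nat.cast_smul_eq_nsmul]
    rw [_root_.sub_apply, averageOp, _root_.smul_apply,
      _root_.sum_apply, h2, smul_add, inv_smul_smul₀ hcard', add_sub_cancel_left]
  rw [h1, norm_smul, norm_inv, Complex.norm_natCast, inv_mul_le_iff₀ hcard]
  refine (hSc _ fun γ hγ => ?_).trans ?_
  · rw [restr_apply, indicator_of_notMem hγ]
  · rw [mul_comm c, mul_assoc]
    gcongr
    exact norm_restr_le _ _

variable (H) in
/-- The operator of `χ₁ - χ_a - χ_b + χ_{ab}`. -/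
noncomputable def opA : L2 (Grpd H) →L[ℂ] L2 (Grpd H) :=
  let U := fun g : GrpG H => permOp (MulAction.toPermHom (GrpG H) (Grpd H) g)
  U 1 - U (1, FreeGroup.of 0, 1, 1) - U (1, FreeGroup.of 1, 1, 1) +
    U (1, FreeGroup.of 0 * FreeGroup.of 1, 1, 1)

variable (H) in
theorem isRegularRep_funA : IsRegularRep (funA H) (opA H) :=
  (((isRegularRep_chi _).sub (isRegularRep_chi _)).sub (isRegularRep_chi _)).add
    (isRegularRep_chi _)

variable (H) in
theorem funA_mem_steinbergAlg : funA H ∈ steinbergAlg (Grpd H) :=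
  Submodule.add_mem _ (Submodule.sub_mem _ (Submodule.sub_mem _ (chi_mem_steinbergAlg _)
    (chi_mem_steinbergAlg _)) (chi_mem_steinbergAlg _)) (chi_mem_steinbergAlg _)

/-- A translate of an average is the regular representation of a function in `𝒞`. -/
theorem exists_isRegularRep_permOp_averageOp (g : GrpG H) (S : Finset H) :
    ∃ f ∈ contAlg (Grpd H), IsRegularRep f
      (permOp (MulAction.toPermHom (GrpG H) (Grpd H) g) ∘L averageOp S) := by
  refine ⟨(S.card : ℂ)⁻¹ • ∑ h ∈ S, chi (g * ((h, 1, 1, 1) : GrpG H)),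
    steinbergAlg_le_contAlg
      (Submodule.smul_mem _ _ (Submodule.sum_mem _ fun _ _ => chi_mem_steinbergAlg _)), ?_⟩
  have h1 : permOp (MulAction.toPermHom (GrpG H) (Grpd H) g) ∘L averageOp S =
      (S.card : ℂ)⁻¹ • ∑ h ∈ S,
        permOp (MulAction.toPermHom (GrpG H) (Grpd H) (g * ((h, 1, 1, 1) : GrpG H))) := by
    change permOp (MulAction.toPermHom (GrpG H) (Grpd H) g) * averageOp S = _
    rw [averageOp, mul_smul_comm, Finset.mul_sum]
    simp only [map_mul]
    rfl
  rw [h1]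
  exact (IsRegularRep.sum fun h _ => isRegularRep_chi _).smul _

/-- These are the approximants that put the operator of a ∗ χ_B in the closure of λ(𝒞). -/
theorem opA_comp_averageOp_mem (S : Finset H) :
    opA H ∘L averageOp S ∈ regularRep '' (contAlg (Grpd H) : Set (Grpd H → ℂ)) := by
  obtain ⟨f₁, hf₁, h₁⟩ := exists_isRegularRep_permOp_averageOp 1 S
  obtain ⟨f₂, hf₂, h₂⟩ := exists_isRegularRep_permOp_averageOp (1, FreeGroup.of 0, 1, 1) S
  obtain ⟨f₃, hf₃, h₃⟩ := exists_isRegularRep_permOp_averageOp (1, FreeGroup.of 1, 1, 1) S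
  obtain ⟨f₄, hf₄, h₄⟩ := exists_isRegularRep_permOp_averageOp
    (1, FreeGroup.of 0 * FreeGroup.of 1, 1, 1) S
  refine ⟨f₁ - f₂ - f₃ + f₄, Submodule.add_mem _ (Submodule.sub_mem _
    (Submodule.sub_mem _ hf₁ hf₂) hf₃) hf₄, ?_⟩
  exact (((h₁.sub h₂).sub h₃).add h₄).regularRep_eq

variable (H) in
-- The projection restricts by range; the coefficients test it on basis vectors at units, where
-- range and source coincide.
theorem jMap_restr : jMap (restr (arrowsB H)) = chiB H := by
  funext γ
  rw [jMap, chiB]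
  have hmem : src γ ∈ arrowsB H ↔ srcWord γ ∈ wordsB H := by
    change Elt.act _ _ ∈ wordsB H ↔ _
    rw [ofGroup_one_act]
  by_cases hγ : srcWord γ ∈ wordsB H
  · rw [restr_delta_of_mem (hmem.mpr hγ)]
    by_cases h : γ = src γ
    · rw [indicator_of_mem (mem_setB.mpr ⟨hγ, h⟩), Pi.one_apply, ← h, delta_self]
    · rw [delta_ne h, indicator_of_notMem]
      exact fun h' => h (mem_setB.mp h').2
  · rw [restr_delta_of_notMem (mt hmem.mp hγ), indicator_of_notMem]
    · rfl
    · exact fun h' => hγ (mem_setB.mp h').1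

variable (H) in
theorem jMap_opA_comp_restr :
    jMap (opA H ∘L restr (arrowsB H)) = conv (funA H) (chiB H) := by
  funext γ
  rw [conv_chiB, jMap, ContinuousLinearMap.comp_apply]
  have hmem : src γ ∈ arrowsB H ↔ srcWord γ ∈ wordsB H := by
    change Elt.act _ _ ∈ wordsB H ↔ _
    rw [ofGroup_one_act]
  by_cases hγ : srcWord γ ∈ wordsB H
  · rw [restr_delta_of_mem (hmem.mpr hγ),
      indicator_of_mem (show γ ∈ {γ | srcWord γ ∈ wordsB H} from hγ)]
    exact congrFun (isRegularRep_funA H).jMap_eq γ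
  · rw [restr_delta_of_notMem (mt hmem.mp hγ), map_zero,
      indicator_of_notMem (show γ ∉ {γ | srcWord γ ∈ wordsB H} from hγ)]
    rfl

theorem exists_averages (hH : ¬ IsAmenableGroup H) :
    ∃ S : ℕ → Finset H, (∀ n, (S n).Nonempty) ∧
      Tendsto (fun n => averageOp (S n)) atTop (𝓝 (restr (arrowsB H))) := by
  obtain ⟨S, c, hS, hc, hlim, hSc⟩ := exists_averages_tendsto_zero (ρ := permH H)
    (Ω := (arrowsB H)ᶜ) (fun h γ hγ => permH_mem_compl h hγ)
    (fun h γ hγ => eq_one_of_permH_apply_eq h hγ) hH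
  refine ⟨S, hS, tendsto_iff_norm_sub_tendsto_zero.mpr ?_⟩
  exact squeeze_zero (fun _ => norm_nonneg _)
    (fun n => norm_averageOp_sub_restr_le (hS n) (hc n) (hSc n)) hlim

/-- Non-amenability is needed only for membership in the reduced algebra; singularity of the
coefficient function holds for every H. -/
theorem opA_comp_restr_mem_singularIdeal (hH : ¬ IsAmenableGroup H) :
    opA H ∘L restr (arrowsB H) ∈ singularIdeal (Grpd H) := by
  obtain ⟨S, -, hlim⟩ := exists_averages hH
  refine ⟨?_, ?_⟩
  · have h1 : Tendsto (fun n => opA H ∘L averageOp (S n)) atTop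
        (𝓝 (opA H ∘L restr (arrowsB H))) := hlim.const_mul (opA H)
    exact mem_closure_of_tendsto h1 (.of_forall fun n => opA_comp_averageOp_mem _)
  · rw [jMap_opA_comp_restr]
    exact isSingular_conv

variable (H) in
theorem opA_comp_restr_notMem_closure :
    opA H ∘L restr (arrowsB H) ∉ closure (algSingularIdeal (Grpd H)) := by
  intro h
  have := exists_tendstoUniformly_of_mem_closure h
  rw [jMap_opA_comp_restr] at this
  exact not_tendstoUniformly_conv this

theorem not_singularIdeal_subset (hH : ¬ IsAmenableGroup H) :
    ¬ singularIdeal (Grpd H) ⊆ closure (algSingularIdeal (Grpd H)) ∧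
      ¬ singularIdeal (Grpd H) ⊆ closure (steinbergSingularIdeal (Grpd H)) := by
  have h1 : ¬ singularIdeal (Grpd H) ⊆ closure (algSingularIdeal (Grpd H)) := fun h =>
    opA_comp_restr_notMem_closure H (h (opA_comp_restr_mem_singularIdeal hH))
  exact ⟨h1, fun h => h1 (h.trans (closure_mono steinbergSingularIdeal_subset))⟩

end SingularExample

open ArrowGroupoid SingularExample in
theorem mainTheorem1 :
    (∀ (H : Type u) [Group H] [Countable H], ¬ IsAmenableGroup H →
      IsAmple (Grpd H) ∧ ¬ T2Space (Grpd H) ∧ IsMinimal (Grpd H) ∧ IsEffective (Grpd H) ∧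
      -- neither algebraic singular ideal is dense in the C*-singular ideal
      ¬ singularIdeal (Grpd H) ⊆ closure (algSingularIdeal (Grpd H)) ∧
      ¬ singularIdeal (Grpd H) ⊆ closure (steinbergSingularIdeal (Grpd H)) ∧
      -- `b = χ_B` is the reduced-norm limit of averages over finite subsets of `H`
      ∃ (S : ℕ → Finset H) (b : L2 (Grpd H) →L[ℂ] L2 (Grpd H)),
        (∀ n, (S n).Nonempty) ∧ (∀ n, average (S n) ∈ steinbergAlg (Grpd H)) ∧
        Tendsto (fun n => regularRep (average (S n))) atTop (𝓝 b) ∧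
        b ∈ reducedCStar (Grpd H) ∧ jMap b = chiB H ∧
        -- `a ∗ χ_B` is the witness
        funA H ∈ steinbergAlg (Grpd H) ∧
        regularRep (funA H) ∘L b ∈ singularIdeal (Grpd H) ∧
        jMap (regularRep (funA H) ∘L b) = conv (funA H) (chiB H) ∧
        regularRep (funA H) ∘L b ∉ closure (algSingularIdeal (Grpd H)) ∧
        ¬ ∃ f : ℕ → Grpd H → ℂ,
          (∀ n, f n ∈ contAlg (Grpd H) ∧ IsSingular (f n)) ∧
          TendstoUniformly f (conv (funA H) (chiB H)) atTop) ∧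
    ∃ (Γ : Type) (_ : ArrowGroupoid Γ) (_ : TopologicalSpace Γ),
      IsAmple Γ ∧ IsMinimal Γ ∧ IsEffective Γ ∧
      ¬ singularIdeal Γ ⊆ closure (algSingularIdeal Γ) ∧
      ¬ singularIdeal Γ ⊆ closure (steinbergSingularIdeal Γ) := by
  -- For the existence statement, the free group of rank two also serves as H.
  refine ⟨fun H _ _ hH => ?_, Grpd (FreeGroup (Fin 2)), inferInstance, inferInstance,
    SelfSimilarAction.Germ.isAmple _ _, SelfSimilarAction.Germ.isMinimal _ _, isEffective_grpd _,
    not_singularIdeal_subset not_isAmenableGroup_freeGroup⟩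
  obtain ⟨S, hS, hlim⟩ := exists_averages hH
  refine ⟨SelfSimilarAction.Germ.isAmple _ _, not_t2Space_grpd H,
    SelfSimilarAction.Germ.isMinimal _ _, isEffective_grpd H, (not_singularIdeal_subset hH).1,
    (not_singularIdeal_subset hH).2, S, restr (arrowsB H), hS,
    fun n => average_mem_steinbergAlg _, ?_, ?_, jMap_restr H, funA_mem_steinbergAlg H, ?_⟩
  · simpa only [(isRegularRep_average _).regularRep_eq] using hlim
  · exact mem_closure_of_tendsto hlim (.of_forall fun n => ⟨average (S n),
      steinbergAlg_le_contAlg (average_mem_steinbergAlg _),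
      (isRegularRep_average _).regularRep_eq⟩)
  · rw [(isRegularRep_funA H).regularRep_eq]
    exact ⟨opA_comp_restr_mem_singularIdeal hH, jMap_opA_comp_restr H,
      opA_comp_restr_notMem_closure H, not_tendstoUniformly_conv⟩
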